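/- **Theorem 1.** Let $x>1$ be real, $\alpha=2x\log x$, and for $n\ge 1$ let $$\wp_n(z)=\sum_{k=0}^n\binom nk z^{k(k-1)/2},\qquad \psi(s)=\frac{s^2}{4n\log x}-\log(1+xe^{is}),$$ all logarithms and square roots being principal. For all sufficiently large $n$ and every integer $k\ge 0$ there is exactly one $\sigma_k=\sigma_k(n)\in\mathbb C$ such that $s_k:=\sigma_k+2\pi k$ is a saddle point of $\psi$ (that is, $\psi'(s_k)=0$) and $$\log(\sigma_k+2\pi k)-i\sigma_k+\log(1+xe^{i\sigma_k})=\log(in\alpha).$$ The saddle $s_0=\sigma_0$ lies on the imaginary axis: with $y=x^2$, $\sigma_0=i\,r(n)$, where $r(n)$ is the unique positive solution of $t(e^t+\sqrt y)=n\sqrt y\log y$. Put $$\lambda_k=xe^{is_k},\quad a_k=\frac{(1+\lambda_k)^2}{4n\lambda_k\log x},\quad \omega_k=\frac{2n\lambda_k\log x}{(1+\lambda_k)^2},\quad \chi_k=\frac{\log n}{n\lambda_k},$$ $$c_{0k}=1,\quad c_{1k}=\frac{-Q_1(a_k,\lambda_k)\chi_k}{6(1+2a_k)^3},\quad c_{2k}=\frac{Q_2(a_k,\lambda_k)\chi_k^2}{216(1+2a_k)^6},\quad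 c_{3k}=\frac{Q_3(a_k,\lambda_k)\chi_k^3}{97200(1+2a_k)^9},$$ where $$\begin{aligned} Q_1(a,\xi)&=1+\xi+\xi^2-3a(1-4\xi+\xi^2),\\ Q_2(a,\xi)&=(1+\xi+\xi^2)^2-6a(13+5\xi-10\xi^2+5\xi^3+13\xi^4)\\ &\quad+3a^2(67-328\xi+278\xi^2-328\xi^3+67\xi^4)-48a^3(1-26\xi+66\xi^2-26\xi^3+\xi^4),\\ Q_3(a,\xi)&=139+417\xi+402\xi^2+109\xi^3+402\xi^4+417\xi^5+139\xi^6\\ &\quad+27a(151+378\xi+308\xi^2+56\xi^3+308\xi^4+378\xi^5+151\xi^6)\\ &\quad-9a^2(9271-3497\xi-10867\xi^2+766\xi^3-10867\xi^4-3497\xi^5+9271\xi^6)\\ &\quad+27a^3(7349-48668\xi+45007\xi^2-24056\xi^3+45007\xi^4-48668\xi^5+7349\xi^6)\\ &\quad-432a^4(203-5016\xi+18729\xi^2-24392\xi^3+18729\xi^4-5016\xi^5+203\xi^6)\\ &\quad+4320a^5(1-120\xi+1191\xi^2-2416\xi^3+1191\xi^4-120\xi^5+\xi^6). \end{aligned}$$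 For $0\le N\le 3$ let, with $(\tfrac12)_j=\Gamma(j+\tfrac12)/\Gamma(\tfrac12)$, $$S_{k,N}=\frac{e^{-n\psi(\sigma_k)}}{\sqrt{1+\omega_k}}\sum_{j=0}^N\frac{(\frac12)_j\,c_{jk}}{(\log n)^j},\qquad E_N(n)=S_{0,N}+2\,\mathrm{Re}\sum_{k=1}^\infty\exp\Bigl(-\frac{\pi^2k^2+\pi k\sigma_k}{\log x}\Bigr)S_{k,N}.$$ Then, as $n\to\infty$ with $x$ fixed: 1. $c_{jk}=O(1)$ for each $j\le 3$ and each $k\ge0$; the series in $E_N(n)$ converges absolutely for all large $n$; and for each $N\in\{0,1,2,3\}$ $$\wp_n(x^{-2})=E_N(n)+O\Bigl(\frac{e^{-n\psi(\sigma_0)}}{\sqrt{1+\omega_0}}\,(\log n)^{-N-1}\Bigr).$$ 2. The contribution of $s_0$ is dominant: for each $k\ge1$ and $N\le 3$, $\bigl|\exp\bigl(-\tfrac{\pi^2k^2+\pi k\sigma_k}{\log x}\bigr)S_{k,N}\bigr|<|S_{0,N}|$ for all large $n$. 3. The leading terms recover the Gawronski–Neuschel formula: with $y=x^2$ and $\Theta(y)=1+2\sum_{k\ge1}e^{-2\pi^2k^2/\log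 y}\cos\bigl(2\pi k\,r(n)/\log y\bigr)$, $$E_0(n)=\frac{1}{\sqrt{r(n)}}\exp\Bigl(\frac{r(n)^2+2r(n)}{2\log y}\Bigr)\{\Theta(y)+o(1)\},$$ and the same holds with $\wp_n(1/y)$ in place of $E_0(n)$. -/

import Mathlib

open Filter Topology Asymptotics

noncomputable section

namespace Lacunary

/-- The lacunary binomial-type polynomial `℘_n(z) = ∑_{k=0}^n C(n,k) z^{k(k-1)/2}`
(the division by two is exact). -/
def wp (n : ℕ) (z : ℝ) : ℝ :=
  ∑ k ∈ Finset.range (n + 1), (n.choose k : ℝ) * z ^ (k * (k - 1) / 2)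

/-- The phase function `ψ(s) = s² / (4 n log x) - log (1 + x e^{is})`. -/
def psi (x : ℝ) (n : ℕ) (s : ℂ) : ℂ :=
  s ^ 2 / (4 * n * (Real.log x : ℂ)) - Complex.log (1 + x * Complex.exp (Complex.I * s))

/-- `s` is a saddle point of `ψ`: `ψ'(s) = 0`. -/
def IsSaddle (x : ℝ) (n : ℕ) (s : ℂ) : Prop :=
  HasDerivAt (psi x n) 0 s

/-- `s_k = σ + 2πk`. -/
def shift (k : ℕ) (σ : ℂ) : ℂ := σ + 2 * Real.pi * k

/-- `σ` is the quantity `σ_k`: the point `s_k = σ + 2πk` is a saddle point of `ψ`, and its label `k`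
is fixed by the logarithmic form of the saddle-point equation, with `α = 2 x log x` and principal
logarithms. -/
def IsSaddleShift (x : ℝ) (n k : ℕ) (σ : ℂ) : Prop :=
  IsSaddle x n (shift k σ) ∧
    Complex.log (shift k σ) - Complex.I * σ
        + Complex.log (1 + x * Complex.exp (Complex.I * σ))
      = Complex.log (Complex.I * n * (2 * x * Real.log x : ℝ))

/-- `λ = x e^{is}`. -/
def lam (x : ℝ) (s : ℂ) : ℂ := x * Complex.exp (Complex.I * s)

/-- `a = (1 + λ)² / (4 n λ log x)`. -/
def aCoef (x : ℝ) (n : ℕ) (s : ℂ) : ℂ :=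
  (1 + lam x s) ^ 2 / (4 * n * lam x s * (Real.log x : ℂ))

/-- `ω = 2 n λ log x / (1 + λ)²`. -/
def omega (x : ℝ) (n : ℕ) (s : ℂ) : ℂ :=
  2 * n * lam x s * (Real.log x : ℂ) / (1 + lam x s) ^ 2

/-- `χ = log n / (n λ)`. -/
def chi (x : ℝ) (n : ℕ) (s : ℂ) : ℂ := (Real.log n : ℂ) / (n * lam x s)

def P11 (ξ : ℂ) : ℂ := 1 + ξ + ξ ^ 2
def P12 (ξ : ℂ) : ℂ := 1 - 4 * ξ + ξ ^ 2
def P21 (ξ : ℂ) : ℂ := (1 + ξ + ξ ^ 2) ^ 2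
def P22 (ξ : ℂ) : ℂ := 13 + 5 * ξ - 10 * ξ ^ 2 + 5 * ξ ^ 3 + 13 * ξ ^ 4
def P23 (ξ : ℂ) : ℂ := 67 - 328 * ξ + 278 * ξ ^ 2 - 328 * ξ ^ 3 + 67 * ξ ^ 4
def P24 (ξ : ℂ) : ℂ := 1 - 26 * ξ + 66 * ξ ^ 2 - 26 * ξ ^ 3 + ξ ^ 4
def P31 (ξ : ℂ) : ℂ :=
  139 + 417 * ξ + 402 * ξ ^ 2 + 109 * ξ ^ 3 + 402 * ξ ^ 4 + 417 * ξ ^ 5 + 139 * ξ ^ 6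
def P32 (ξ : ℂ) : ℂ :=
  151 + 378 * ξ + 308 * ξ ^ 2 + 56 * ξ ^ 3 + 308 * ξ ^ 4 + 378 * ξ ^ 5 + 151 * ξ ^ 6
def P33 (ξ : ℂ) : ℂ :=
  9271 - 3497 * ξ - 10867 * ξ ^ 2 + 766 * ξ ^ 3 - 10867 * ξ ^ 4 - 3497 * ξ ^ 5 + 9271 * ξ ^ 6
def P34 (ξ : ℂ) : ℂ :=
  7349 - 48668 * ξ + 45007 * ξ ^ 2 - 24056 * ξ ^ 3 + 45007 * ξ ^ 4 - 48668 * ξ ^ 5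
    + 7349 * ξ ^ 6
def P35 (ξ : ℂ) : ℂ :=
  203 - 5016 * ξ + 18729 * ξ ^ 2 - 24392 * ξ ^ 3 + 18729 * ξ ^ 4 - 5016 * ξ ^ 5 + 203 * ξ ^ 6
def P36 (ξ : ℂ) : ℂ :=
  1 - 120 * ξ + 1191 * ξ ^ 2 - 2416 * ξ ^ 3 + 1191 * ξ ^ 4 - 120 * ξ ^ 5 + ξ ^ 6

def Q1 (a ξ : ℂ) : ℂ := P11 ξ - 3 * a * P12 ξ
def Q2 (a ξ : ℂ) : ℂ := P21 ξ - 6 * a * P22 ξ + 3 * a ^ 2 * P23 ξ - 48 * a ^ 3 * P24 ξ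
def Q3 (a ξ : ℂ) : ℂ :=
  P31 ξ + 27 * a * P32 ξ - 9 * a ^ 2 * P33 ξ + 27 * a ^ 3 * P34 ξ - 432 * a ^ 4 * P35 ξ
    + 4320 * a ^ 5 * P36 ξ

/-- The coefficients `c_j` (`j ≤ 3`) attached to the saddle `s`; indices `j ≥ 4` are never used. -/
def coeff (x : ℝ) (n : ℕ) (s : ℂ) : ℕ → ℂ
  | 0 => 1
  | 1 => -(Q1 (aCoef x n s) (lam x s) * chi x n s) / (6 * (1 + 2 * aCoef x n s) ^ 3)
  | 2 => Q2 (aCoef x n s) (lam x s) * chi x n s ^ 2 / (216 * (1 + 2 * aCoef x n s) ^ 6)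
  | 3 => Q3 (aCoef x n s) (lam x s) * chi x n s ^ 3 / (97200 * (1 + 2 * aCoef x n s) ^ 9)
  | _ => 0

/-- The prefactor `e^{-n ψ(σ)} / √(1 + ω_k)` (principal square root), where `s_k = σ + 2πk`. -/
def prefactor (x : ℝ) (n k : ℕ) (σ : ℂ) : ℂ :=
  Complex.exp (-(n * psi x n σ)) / (1 + omega x n (shift k σ)) ^ (1 / 2 : ℂ)

/-- `e^{-n ψ(σ)} / √(1 + ω_k) · ∑_{j=0}^N (1/2)_j c_{jk} / (log n)^j`. -/
def saddleSeries (N : ℕ) (x : ℝ) (n k : ℕ) (σ : ℂ) : ℂ :=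
  prefactor x n k σ *
    ∑ j ∈ Finset.range (N + 1),
      (ascPochhammer ℂ j).eval (1 / 2 : ℂ) * coeff x n (shift k σ) j / (Real.log n : ℂ) ^ j

/-- The weighted contribution of the saddle `s_k`:
`exp (-(π²k² + πkσ) / log x)` times the series above. -/
def contribution (N : ℕ) (x : ℝ) (n k : ℕ) (σ : ℂ) : ℂ :=
  Complex.exp (-((Real.pi : ℂ) ^ 2 * k ^ 2 + Real.pi * k * σ) / (Real.log x : ℂ)) *
    saddleSeries N x n k σ

/-- The expansion: the series of the saddle `s_0`, plus `2 Re` of the sum of the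
contributions of the saddles `s_k`, `k ≥ 1`; here `σ k` is `σ_k`. -/
def expansion (N : ℕ) (x : ℝ) (n : ℕ) (σ : ℕ → ℂ) : ℂ :=
  saddleSeries N x n 0 (σ 0) +
    ((2 * (∑' k : ℕ, contribution N x n (k + 1) (σ (k + 1))).re : ℝ) : ℂ)

/-- `t` is the positive solution of `t (e^t + √y) = n √y log y`. -/
def IsPosRoot (y : ℝ) (n : ℕ) (t : ℝ) : Prop :=
  0 < t ∧ t * (Real.exp t + √y) = n * √y * Real.log y

/-- `r^{-1/2} exp ((r² + 2r) / (2 log y))`. -/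
def gnFactor (y r : ℝ) : ℝ :=
  1 / √r * Real.exp ((r ^ 2 + 2 * r) / (2 * Real.log y))

/-- `Θ(y) = 1 + 2 ∑_{k ≥ 1} e^{-2π²k² / log y} cos (2πkr / log y)`. -/
def theta (y r : ℝ) : ℝ :=
  1 + 2 * ∑' k : ℕ, Real.exp (-(2 * Real.pi ^ 2 * ((k : ℝ) + 1) ^ 2) / Real.log y) *
    Real.cos (2 * Real.pi * ((k : ℝ) + 1) * r / Real.log y)

end Lacunary

end

/-!
# The saddle-point expansion of `℘_n(x⁻²)`

Write `L = log x`, `M = 2 n L` and `F(s) = e^{-s²/(4L)} (1 + x e^{is})^n`, the function `integrand`,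
which is `e^{-nψ(s)}` wherever the latter is defined. Expanding the binomial and integrating
Gaussians gives `√(4πL) ℘_n(x⁻²) = ∫ F(v + it) dv` for every height `t` (`integral_integrand`). The
line is cut into the windows `[2πk - π, 2πk + π]`; since `F(-s̄)` is the conjugate of `F(s)`, the
window `-k` is conjugate to the window `k` (`hasSum_window_nat`). Each window with `k ≥ 0` contains
the real part of one saddle `s_k`.

*Saddles.* Eliminating `λ` from the saddle-point equation leaves `λ (M + is) = -is`. On the strip
`0 < Im s < M` the labelled saddles are the level points of `saddleMap`; after multiplication by `i`
this map has derivative of real part at least `1`, whence uniqueness; the saddle `s_0` is `i r(n)`,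
and a contraction argument gives the others. The same equation yields `log x < Im s_k ≤ r(n)`, the
location of `Re s_k` (`re_bounds`), and `|F(s_k)| ≤ e^{-(Re s_k)²/(4L)} F(s_0)`
(`norm_integrand_le`), which makes the series converge and lets `s_0` dominate.

*One window.* For `k² ≤ log n` the window is moved from the height `r(n)` to that of `s_k`. On the
vertical sides `λ` is negative of modulus below `1`, so that `|1 + λ| ≤ 1` there and the sides are
negligible (`norm_window_sub_window_le`). On the new line, with `τ = -is_k/(2L)` and `b = 1/(4L)`,
`F(s_k + u) = F(s_k) e^{-bu² - iτu} (1 + τ(e^{iu} - 1)/n)^n` exactly (`integrand_add`). This is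
close to `F(s_k) exp(-bu² + τ(e^{iu} - 1 - iu))`, and Laplace's method for that model integral,
whose Gaussian has the complex variance `1/(τ + 2b)`, produces the polynomials `Q_1, Q_2, Q_3` at
`ξ = 0` through an identity between finite moment sums (`momentSum_total`). Replacing `(b/τ, 0, 1/τ)`
by `(a_k, λ_k, 1/(nλ_k))` changes the result only by `O(λ_k)`, which is smaller than any power of
`1/log n` (`exists_norm_expansion_sub_le`). For `k² > log n` both the window and the contribution of
the saddle are trivially small. The bounds are summable in `k`
(`exists_norm_window_sub_contribution_le`), and the expansion follows.

*The limit formula.* On the line at height `r(n)` the window `k` equals the window `0` times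
`e^{-π²k²/L - iπkr(n)/L}`, apart from a factor `e^{-πku/L}` inside the integral, which is close to
one where the integrand is concentrated (`norm_window_sub_phase_mul_le`). The sum of the phases is
`Θ(x²)`, and the leading factor of `s_0` is asymptotic to `gnFactor`
(`tendsto_prefactor_div_gnFactor`).
-/


noncomputable section

namespace Lacunary

/-! ### Gaussian moments with a complex variance -/

/-- The moments `E[(iu)^m]` of a centred Gaussian variable `u` of (complex) variance `v`, given by
the recursion that integration by parts produces. -/
def imagMoment (v : ℂ) : ℕ → ℂ
  | 0 => 1
  | 1 => 0
  | m + 2 => -((m + 1 : ℕ) : ℂ) * v * imagMoment v m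

lemma norm_cexp_gaussian (c : ℂ) (u : ℝ) :
    ‖Complex.exp (-c * u ^ 2 / 2)‖ = Real.exp (-(c.re / 2) * u ^ 2) := by
  rw [Complex.norm_exp]
  congr 1
  rw [show -c * (u : ℂ) ^ 2 / 2 = ((u ^ 2 / 2 : ℝ) : ℂ) * (-c) by push_cast; ring,
    Complex.re_ofReal_mul, Complex.neg_re]
  ring

lemma integrable_pow_mul_gaussian {c : ℂ} (hc : 0 < c.re) (m : ℕ) :
    MeasureTheory.Integrable
      fun u : ℝ => (Complex.I * u) ^ m * Complex.exp (-c * u ^ 2 / 2) := by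
  have h := (integrable_rpow_mul_exp_neg_mul_sq (b := c.re / 2) (by linarith) (s := m)
    (by have : (0 : ℝ) ≤ m := by positivity
        linarith)).norm
  refine h.mono' (by fun_prop) (Eventually.of_forall fun u => ?_)
  rw [norm_mul, norm_cexp_gaussian, norm_mul, Real.rpow_natCast, norm_pow, norm_mul,
    Complex.norm_I, one_mul, Complex.norm_real, norm_pow, Real.norm_of_nonneg (Real.exp_pos _).le]

lemma integral_pow_mul_gaussian {c : ℂ} (hc : 0 < c.re) (m : ℕ) :
    ∫ u : ℝ, (Complex.I * u) ^ m * Complex.exp (-c * u ^ 2 / 2)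
      = (2 * Real.pi / c) ^ (1 / 2 : ℂ) * imagMoment c⁻¹ m := by
  have hc0 : c ≠ 0 := by rintro rfl; simp at hc
  have hderiv (u : ℝ) : HasDerivAt (fun u : ℝ => Complex.exp (-c * u ^ 2 / 2))
      (-c * u * Complex.exp (-c * u ^ 2 / 2)) u := by
    have h1 : HasDerivAt (fun u : ℝ => (u : ℂ)) 1 u := Complex.ofRealCLM.hasDerivAt
    have h2 := (((h1.pow 2).const_mul (-c)).div_const 2).cexp
    refine h2.congr_deriv ?_
    push_cast
    simp only [Pi.pow_apply]
    ring
  induction m using Nat.strong_induction_on with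
  | _ m ih =>
    match m with
    | 0 =>
      simp only [pow_zero, one_mul, imagMoment, mul_one]
      have h := integral_gaussian_complex (b := c / 2) (by simpa using hc)
      rw [show (Real.pi : ℂ) / (c / 2) = 2 * Real.pi / c by field_simp] at h
      rw [← h]
      congr 1; ext u; congr 1; ring
    | 1 =>
      have h := MeasureTheory.integral_eq_zero_of_hasDerivAt_of_integrable hderiv
        (((integrable_pow_mul_gaussian hc 1).const_mul (-c * -Complex.I)).congr
          (Eventually.of_forall fun u => by
            simp only [pow_one]; linear_combination
              (c * u * Complex.exp (-c * u ^ 2 / 2)) * Complex.I_sq))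
        ((integrable_pow_mul_gaussian hc 0).congr (Eventually.of_forall fun u => by simp))
      simp only [imagMoment, mul_zero, pow_one]
      have h2 : (fun u : ℝ => Complex.I * u * Complex.exp (-c * u ^ 2 / 2))
          = fun u : ℝ => (-Complex.I / c) * (-c * u * Complex.exp (-c * u ^ 2 / 2)) := by
        ext u; field_simp
      rw [h2, MeasureTheory.integral_const_mul, h, mul_zero]
    | m + 2 =>
      have hd (u : ℝ) : HasDerivAt
          (fun u : ℝ => (Complex.I * u) ^ (m + 1) * Complex.exp (-c * u ^ 2 / 2))
          (Complex.I * ((m + 1 : ℕ) * ((Complex.I * u) ^ m * Complex.exp (-c * u ^ 2 / 2))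
            + c * ((Complex.I * u) ^ (m + 2) * Complex.exp (-c * u ^ 2 / 2)))) u := by
        have h1 : HasDerivAt (fun u : ℝ => Complex.I * (u : ℂ)) (Complex.I * 1) u :=
          Complex.ofRealCLM.hasDerivAt.const_mul _
        have h2 := (h1.pow (m + 1)).mul (hderiv u)
        refine h2.congr_deriv ?_
        simp only [Pi.pow_apply, Nat.add_sub_cancel]
        linear_combination (-(c * u * (Complex.I * u) ^ (m + 1)
          * Complex.exp (-c * u ^ 2 / 2))) * Complex.I_sq
      have i1 := (integrable_pow_mul_gaussian hc m).const_mul ((m + 1 : ℕ) : ℂ)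
      have i2 := (integrable_pow_mul_gaussian hc (m + 2)).const_mul c
      have h := MeasureTheory.integral_eq_zero_of_hasDerivAt_of_integrable hd
        ((i1.add i2).const_mul Complex.I) (integrable_pow_mul_gaussian hc (m + 1))
      rw [MeasureTheory.integral_const_mul, MeasureTheory.integral_add i1 i2,
        MeasureTheory.integral_const_mul, MeasureTheory.integral_const_mul, ih m (by omega)] at h
      have h3 := (mul_eq_zero.mp h).resolve_left Complex.I_ne_zero
      refine mul_left_cancel₀ hc0 ?_
      rw [imagMoment]
      linear_combination h3 + ((m + 1 : ℕ) : ℂ) * (2 * Real.pi / c) ^ (1 / 2 : ℂ)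
        * imagMoment c⁻¹ m * mul_inv_cancel₀ hc0

/-- The polynomial with the given coefficients, lowest degree first. -/
def hornerEval : List ℂ → ℂ → ℂ
  | [], _ => 0
  | a :: l, z => a + z * hornerEval l z

/-- The Gaussian mean of `z ^ m * hornerEval l z` at `z = iu`. -/
def momentSum (v : ℂ) : ℕ → List ℂ → ℂ
  | _, [] => 0
  | m, a :: l => a * imagMoment v m + momentSum v (m + 1) l

lemma integrable_horner_mul_gaussian {c : ℂ} (hc : 0 < c.re) (l : List ℂ) (m : ℕ) :
    MeasureTheory.Integrable fun u : ℝ => (Complex.I * u) ^ m * hornerEval l (Complex.I * u)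
      * Complex.exp (-c * u ^ 2 / 2) := by
  induction l generalizing m with
  | nil => simp [hornerEval]
  | cons a l ih =>
    refine (((integrable_pow_mul_gaussian hc m).const_mul a).add (ih (m + 1))).congr
      (Eventually.of_forall fun u => ?_)
    simp only [hornerEval, Pi.add_apply]; ring

lemma integral_horner_mul_gaussian {c : ℂ} (hc : 0 < c.re) (l : List ℂ) (m : ℕ) :
    ∫ u : ℝ, (Complex.I * u) ^ m * hornerEval l (Complex.I * u) * Complex.exp (-c * u ^ 2 / 2)
      = (2 * Real.pi / c) ^ (1 / 2 : ℂ) * momentSum c⁻¹ m l := by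
  induction l generalizing m with
  | nil => simp [hornerEval, momentSum]
  | cons a l ih =>
    have : (fun u : ℝ => (Complex.I * u) ^ m * hornerEval (a :: l) (Complex.I * u)
        * Complex.exp (-c * u ^ 2 / 2)) = fun u : ℝ =>
        a * ((Complex.I * u) ^ m * Complex.exp (-c * u ^ 2 / 2)) +
        (Complex.I * u) ^ (m + 1) * hornerEval l (Complex.I * u)
          * Complex.exp (-c * u ^ 2 / 2) := by
      ext u; simp only [hornerEval]; ring
    rw [this, MeasureTheory.integral_add ((integrable_pow_mul_gaussian hc m).const_mul a)
      (integrable_horner_mul_gaussian hc l _), MeasureTheory.integral_const_mul,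
      integral_pow_mul_gaussian hc, ih, momentSum]
    ring

/-! ### The formal expansion -/

/-- `c_j / χ^j` as a function of `a` and `ξ = λ`. -/
def reducedCoeff (a ξ : ℂ) : ℕ → ℂ
  | 0 => 1
  | 1 => -(Q1 a ξ) / (6 * (1 + 2 * a) ^ 3)
  | 2 => Q2 a ξ / (216 * (1 + 2 * a) ^ 6)
  | 3 => Q3 a ξ / (97200 * (1 + 2 * a) ^ 9)
  | _ => 0

/-- The truncated expansion as a function of `a`, `ξ = λ` and `w = 1 / (nλ)`. -/
def truncSeries (N : ℕ) (a ξ w : ℂ) : ℂ :=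
  ∑ j ∈ Finset.range (N + 1), (ascPochhammer ℂ j).eval (1 / 2 : ℂ) * reducedCoeff a ξ j * w ^ j

/-- The Taylor polynomial of `e^{iu} - 1 - iu + u²/2` of degree `10 - j`. -/
def expTail (j : ℕ) (u : ℝ) : ℂ :=
  ∑ m ∈ Finset.Ico 3 (11 - j), (Complex.I * u) ^ m / m.factorial

/-- The coefficients of `expTail j u ^ j / (iu)^{3j}` as a polynomial in `iu`, for `j ≤ 7`. -/
def tailPowerCoeffs : ℕ → List ℂ
  | 0 => [1]
  | 1 => [1 / 6, 1 / 24, 1 / 120, 1 / 720, 1 / 5040, 1 / 40320, 1 / 362880]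
  | 2 => [1 / 36, 1 / 72, 13 / 2880, 1 / 864, 19 / 75600, 29 / 604800, 53 / 7257600,
      1 / 1036800, 11 / 101606400, 1 / 101606400, 1 / 1625702400]
  | 3 => [1 / 216, 1 / 288, 1 / 640, 37 / 69120, 41 / 268800, 173 / 4838400, 517 / 72576000,
      59 / 48384000, 181 / 1016064000, 391 / 18289152000, 13 / 6096384000, 1 / 6096384000,
      1 / 128024064000]
  | 4 => [1 / 1296, 1 / 1296, 23 / 51840, 59 / 311040, 521 / 8294400, 7 / 414720, 13 / 3456000,
      43 / 62208000, 131 / 1244160000, 73 / 5598720000, 7 / 5598720000, 1 / 11197440000,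
      1 / 268738560000]
  | 5 => [1 / 7776, 5 / 31104, 7 / 62208, 13 / 248832, 59 / 3317760, 181 / 39813120,
      59 / 66355200, 13 / 99532800, 7 / 497664000, 1 / 995328000, 1 / 24883200000]
  | 6 => [1 / 46656, 1 / 31104, 5 / 248832, 5 / 746496, 5 / 3981312, 1 / 7962624, 1 / 191102976]
  | 7 => [1 / 279936]
  | _ => []

lemma expTail_pow_eq {j : ℕ} (hj : j < 8) (u : ℝ) :
    expTail j u ^ j
      = (Complex.I * u) ^ (3 * j) * hornerEval (tailPowerCoeffs j) (Complex.I * u) := by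
  generalize hz : Complex.I * (u : ℂ) = z
  interval_cases j <;>
  · simp only [expTail, hz, tailPowerCoeffs, hornerEval, Finset.sum_Ico_eq_sum_range,
      Finset.sum_range_succ, Finset.sum_range_zero, Nat.factorial]
    push_cast
    ring

/-- The terms of order `w⁴` and higher in the Gaussian mean of `momentSum_total`, divided by
`w⁴`. -/
def momentRemainder (w d : ℂ) : ℂ :=
  ((583 / 15360) * d ^ 6 + (-24739 / 30720) * d ^ 7 + (521521 / 98304) * d ^ 8
      + (-1106105 / 73728) * d ^ 9 + (8083075 / 442368) * d ^ 10)
    + w ^ 1 * ((-1573 / 215040) * d ^ 7 + (8437 / 20480) * d ^ 8 + (-221221 / 40960) * d ^ 9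
      + (58521463 / 2359296) * d ^ 10 + (-56581525 / 2359296) * d ^ 11)
    + w ^ 2 * ((143 / 229376) * d ^ 8 + (-950521 / 7741440) * d ^ 9
      + (42355313 / 14745600) * d ^ 10 + (-29422393 / 1966080) * d ^ 11
      + (260275015 / 113246208) * d ^ 12)
    + w ^ 3 * ((46189 / 2580480) * d ^ 10 + (-15842827 / 22118400) * d ^ 11
      + (52055003 / 19660800) * d ^ 12)
    + w ^ 4 * ((52055003 / 1061683200) * d ^ 12)

/-- The Gaussian mean of the first eight terms of the exponential series agrees with the expansion
through the order `w³`, up to a factor `w⁴` times a polynomial. Here `d = 1 / (1 + 2a)`. -/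
lemma momentSum_total {w d a : ℂ} (hw : w ≠ 0) (hd : d * (1 + 2 * a) = 1) :
    ∑ j ∈ Finset.range 8, w⁻¹ ^ j / j.factorial * momentSum (w * d) (3 * j) (tailPowerCoeffs j)
      = truncSeries 3 a 0 w + w ^ 4 * momentRemainder w d := by
  have ha : 1 + 2 * a ≠ 0 := fun h => by simp [h] at hd
  have hd0 : d ≠ 0 := fun h => by simp [h] at hd
  obtain rfl : a = (1 - d) / (2 * d) := by
    field_simp; linear_combination hd
  have h1 : 1 + 2 * ((1 - d) / (2 * d)) = d⁻¹ := by field_simp; ring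
  simp only [momentRemainder, truncSeries, reducedCoeff, h1, Finset.sum_range_succ,
    Finset.sum_range_zero, tailPowerCoeffs, momentSum, imagMoment, Nat.factorial, Q1, Q2, Q3, P11, P12, P21, P22, P23, P24,
    P31, P32, P33, P34, P35, P36, ascPochhammer_succ_eval, ascPochhammer_zero, Polynomial.eval_one]
  push_cast
  field_simp
  ring

/-! ### Laplace's method for the model integral -/

lemma norm_pow_sub_pow_le {a b : ℂ} {B : ℝ} (ha : ‖a‖ ≤ B) (hb : ‖b‖ ≤ B) (j : ℕ) :
    ‖a ^ j - b ^ j‖ ≤ j * ‖a - b‖ * B ^ (j - 1) := by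
  have hB : 0 ≤ B := (norm_nonneg a).trans ha
  induction j with
  | zero => simp
  | succ j ih =>
    rcases Nat.eq_zero_or_pos j with rfl | hj
    · simp
    rw [show a ^ (j + 1) - b ^ (j + 1) = a * (a ^ j - b ^ j) + (a - b) * b ^ j by ring]
    calc _ ≤ ‖a‖ * ‖a ^ j - b ^ j‖ + ‖a - b‖ * ‖b‖ ^ j := by
          refine (norm_add_le _ _).trans ?_
          rw [norm_mul, norm_mul, norm_pow]
      _ ≤ B * (j * ‖a - b‖ * B ^ (j - 1)) + ‖a - b‖ * B ^ j := by gcongr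
      _ = _ := by
          obtain ⟨i, rfl⟩ : ∃ i, j = i + 1 := ⟨j - 1, by omega⟩
          simp only [Nat.add_sub_cancel]
          push_cast; ring

/-- The part of `e^{iu}` beyond its quadratic Taylor polynomial. -/
def expRem (u : ℝ) : ℂ := Complex.exp (Complex.I * u) - 1 - Complex.I * u + u ^ 2 / 2

lemma norm_I_mul (u : ℝ) : ‖Complex.I * (u : ℂ)‖ = |u| := by
  rw [norm_mul, Complex.norm_I, one_mul, Complex.norm_real, Real.norm_eq_abs]

lemma expRem_eq (u : ℝ) : expRem u = Complex.exp (Complex.I * u)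
    - ∑ m ∈ Finset.range 3, (Complex.I * u) ^ m / m.factorial := by
  simp only [expRem, Finset.sum_range_succ, Finset.sum_range_zero, Nat.factorial]
  push_cast
  linear_combination ((u : ℂ) ^ 2 / 2) * Complex.I_sq

lemma norm_expRem_le {u : ℝ} (hu : |u| ≤ 1) : ‖expRem u‖ ≤ 2 / 9 * |u| ^ 3 := by
  have h := Complex.exp_bound (x := Complex.I * u) (by rwa [norm_I_mul]) (n := 3) (by norm_num)
  rw [← expRem_eq, norm_I_mul] at h
  refine h.trans (le_of_eq ?_)
  norm_num [Nat.factorial]; ring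

lemma norm_expRem_sub_expTail_le {u : ℝ} (hu : |u| ≤ 1) {j : ℕ} (hj : j < 8) :
    ‖expRem u - expTail j u‖ ≤ |u| ^ (11 - j) := by
  have h := Complex.exp_bound (x := Complex.I * u) (by rwa [norm_I_mul]) (n := 11 - j) (by omega)
  have h2 : expRem u - expTail j u = Complex.exp (Complex.I * u)
      - ∑ m ∈ Finset.range (11 - j), (Complex.I * u) ^ m / m.factorial := by
    rw [expRem_eq, expTail, ← Finset.sum_range_add_sum_Ico _ (show 3 ≤ 11 - j by omega)]
    ring
  rw [← h2, norm_I_mul] at h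
  refine h.trans (mul_le_of_le_one_right (by positivity) ?_)
  interval_cases j <;> norm_num [Nat.factorial]

lemma norm_expTail_le {u : ℝ} (hu : |u| ≤ 1) {j : ℕ} (hj : j < 8) :
    ‖expTail j u‖ ≤ |u| ^ 3 := by
  have h : expTail j u = ∑ m ∈ Finset.Ico 3 (11 - j), (Complex.I * u) ^ m / m.factorial := rfl
  calc ‖expTail j u‖ ≤ ∑ m ∈ Finset.Ico 3 (11 - j), |u| ^ 3 * (1 / m.factorial) := by
        rw [h]
        refine (norm_sum_le _ _).trans (Finset.sum_le_sum fun m hm => ?_)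
        rw [norm_div, norm_pow, norm_I_mul, Complex.norm_natCast, div_eq_mul_one_div]
        gcongr 1
        exact pow_le_pow_of_le_one (abs_nonneg u) hu (Finset.mem_Ico.mp hm).1
    _ = |u| ^ 3 * ∑ m ∈ Finset.Ico 3 (11 - j), (1 / m.factorial : ℝ) := by rw [Finset.mul_sum]
    _ ≤ |u| ^ 3 * 1 := by
        gcongr
        interval_cases j <;>
          norm_num [Finset.sum_Ico_eq_sum_range, Finset.sum_range_succ, Nat.factorial]
    _ = _ := mul_one _

lemma norm_expTail_le_of_one_le {u : ℝ} (hu : 1 ≤ |u|) {j : ℕ} (hj : j < 8) :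
    ‖expTail j u‖ ≤ |u| ^ 10 := by
  have h : expTail j u = ∑ m ∈ Finset.Ico 3 (11 - j), (Complex.I * u) ^ m / m.factorial := rfl
  calc ‖expTail j u‖ ≤ ∑ m ∈ Finset.Ico 3 (11 - j), |u| ^ 10 * (1 / m.factorial) := by
        rw [h]
        refine (norm_sum_le _ _).trans (Finset.sum_le_sum fun m hm => ?_)
        rw [norm_div, norm_pow, norm_I_mul, Complex.norm_natCast, div_eq_mul_one_div]
        gcongr 1
        exact pow_le_pow_right₀ hu (by have := (Finset.mem_Ico.mp hm).2; omega)
    _ = |u| ^ 10 * ∑ m ∈ Finset.Ico 3 (11 - j), (1 / m.factorial : ℝ) := by rw [Finset.mul_sum]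
    _ ≤ |u| ^ 10 * 1 := by
        gcongr
        interval_cases j <;>
          norm_num [Finset.sum_Ico_eq_sum_range, Finset.sum_range_succ, Nat.factorial]
    _ = _ := mul_one _

/-- The integrand of the model integral: near a saddle `s`, with `τ = -is / (2 log x)` and
`b = 1 / (4 log x)`, it is the limit of the ratio of the original integrand at `s + u` to its value
at `s`. -/
def modelKernel (b : ℝ) (τ : ℂ) (u : ℝ) : ℂ :=
  Complex.exp (-b * u ^ 2 + τ * (Complex.exp (Complex.I * u) - 1 - Complex.I * u))

lemma modelKernel_eq (b : ℝ) (τ : ℂ) (u : ℝ) :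
    modelKernel b τ u = Complex.exp (-(τ + 2 * b) * u ^ 2 / 2) * Complex.exp (τ * expRem u) := by
  rw [modelKernel, expRem, ← Complex.exp_add]
  congr 1; ring

lemma norm_le_of_sector {τ : ℂ} (hs : |τ.im| ≤ τ.re / 100) : ‖τ‖ ≤ 101 / 100 * τ.re := by
  have h0 : 0 ≤ τ.re := by linarith [abs_nonneg τ.im]
  have := Complex.norm_le_abs_re_add_abs_im τ
  rw [abs_of_nonneg h0] at this
  linarith

lemma norm_mul_expRem_le {τ : ℂ} (hs : |τ.im| ≤ τ.re / 100) {u : ℝ} (hu : |u| ≤ 1) :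
    ‖τ * expRem u‖ ≤ τ.re * |u| ^ 3 / 4 := by
  have h0 : 0 ≤ τ.re := by linarith [abs_nonneg τ.im]
  rw [norm_mul]
  calc _ ≤ 101 / 100 * τ.re * (2 / 9 * |u| ^ 3) := by
        gcongr; exacts [norm_le_of_sector hs, norm_expRem_le hu]
    _ ≤ _ := by
        have : 0 ≤ τ.re * |u| ^ 3 := by positivity
        linarith

/-- On the whole window the model integrand decays like a Gaussian: near the origin by Taylor's
formula, further out because `1 - cos u` is bounded below. -/
lemma norm_modelKernel_le {b : ℝ} (hb : 0 ≤ b) {τ : ℂ} (hs : |τ.im| ≤ τ.re / 100) {u : ℝ}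
    (hu : |u| ≤ Real.pi + 1) : ‖modelKernel b τ u‖ ≤ Real.exp (-(τ.re * u ^ 2 / 100)) := by
  have h0 : 0 ≤ τ.re := by linarith [abs_nonneg τ.im]
  have hu2 : 0 ≤ τ.re * u ^ 2 := by positivity
  rcases le_total |u| 1 with h1 | h1
  · rw [modelKernel_eq, norm_mul, norm_cexp_gaussian, Complex.norm_exp, ← Real.exp_add]
    refine Real.exp_le_exp.mpr ?_
    have h2 := (Complex.re_le_norm _).trans (norm_mul_expRem_le hs h1)
    have h3 : |u| ^ 3 ≤ u ^ 2 := by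
      rw [← sq_abs u]; exact pow_le_pow_of_le_one (abs_nonneg u) h1 (by norm_num)
    have h4 : τ.re * |u| ^ 3 ≤ τ.re * u ^ 2 := by gcongr
    have h5 : (τ + 2 * b).re = τ.re + 2 * b := by simp
    rw [h5]
    have h6 : 0 ≤ b * u ^ 2 := by positivity
    nlinarith
  · rw [modelKernel, Complex.norm_exp]
    refine Real.exp_le_exp.mpr ?_
    have hpi := Real.pi_gt_three
    have hpi2 := Real.pi_lt_d2
    have e1 : (-b * (u : ℂ) ^ 2 + τ * (Complex.exp (Complex.I * u) - 1 - Complex.I * u)).re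
        = -b * u ^ 2 + (τ.re * (Real.cos u - 1) - τ.im * (Real.sin u - u)) := by
      rw [mul_comm Complex.I (u : ℂ), Complex.exp_mul_I, ← Complex.ofReal_cos, ← Complex.ofReal_sin,
        ← Complex.ofReal_pow, ← Complex.ofReal_neg, ← Complex.ofReal_mul, Complex.add_re,
        Complex.ofReal_re, Complex.mul_re]
      simp [Complex.cos_ofReal_re, Complex.sin_ofReal_re]
    rw [e1]
    have hcos : Real.cos u ≤ 5 / 9 := by
      rw [← Real.cos_abs]
      refine le_trans ?_ Real.cos_one_le
      rcases le_total |u| Real.pi with h | h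
      · exact Real.cos_le_cos_of_nonneg_of_le_pi zero_le_one h h1
      · rw [← Real.cos_two_pi_sub]
        exact Real.cos_le_cos_of_nonneg_of_le_pi zero_le_one (by linarith) (by linarith)
    have hsin : |τ.im * (Real.sin u - u)| ≤ τ.re / 100 * (1 + |u|) := by
      rw [abs_mul]
      gcongr
      exact (abs_sub _ _).trans (by gcongr; exact Real.abs_sin_le_one u)
    have h3 := (abs_le.mp hsin).1
    have h4 : u ^ 2 ≤ 18 := by rw [← sq_abs]; nlinarith [abs_nonneg u]
    have h6 : 0 ≤ b * u ^ 2 := by positivity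
    have h7 : τ.re * u ^ 2 ≤ τ.re * 18 := by gcongr
    have h8 : τ.re * (Real.cos u - 1) ≤ τ.re * (-4 / 9) := by gcongr; linarith
    have h9 : τ.re / 100 * (1 + |u|) ≤ τ.re / 100 * 6 := by gcongr; linarith
    linarith

lemma exists_pow_mul_exp_le : ∃ C : ℝ, 0 < C ∧ ∀ m ≤ 64, ∀ y : ℝ, 0 ≤ y →
    y ^ m * Real.exp (-(y / 100)) ≤ C * Real.exp (-(y / 200)) := by
  refine ⟨(Nat.factorial 64 : ℝ) * 200 ^ 64, by positivity, fun m hm y hy => ?_⟩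
  have h := Real.pow_div_factorial_le_exp (y / 200) (by positivity) m
  have h1 : y ^ m ≤ (m.factorial : ℝ) * 200 ^ m * Real.exp (y / 200) := by
    rw [div_pow, div_div, div_le_iff₀ (by positivity)] at h
    linarith
  calc _ ≤ (m.factorial : ℝ) * 200 ^ m * Real.exp (y / 200) * Real.exp (-(y / 100)) := by gcongr
    _ = (m.factorial : ℝ) * 200 ^ m * Real.exp (-(y / 200)) := by
        rw [mul_assoc, ← Real.exp_add]; congr 2; ring
    _ ≤ _ := by
        gcongr
        norm_num

/-- The Gaussian times the first eight terms of the exponential series of `τ * expRem u`, each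
truncated at the order that is needed for an error of order `τ⁻⁴`. -/
def modelApprox (b : ℝ) (τ : ℂ) (u : ℝ) : ℂ :=
  Complex.exp (-(τ + 2 * b) * u ^ 2 / 2)
    * ∑ j ∈ Finset.range 8, τ ^ j / j.factorial * expTail j u ^ j

lemma norm_gaussian_le {b : ℝ} (hb : 0 ≤ b) {τ : ℂ} {u : ℝ} :
    ‖Complex.exp (-(τ + 2 * b) * u ^ 2 / 2)‖ ≤ Real.exp (-(τ.re * u ^ 2 / 2)) := by
  rw [norm_cexp_gaussian]
  refine Real.exp_le_exp.mpr ?_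
  have h5 : (τ + 2 * b).re = τ.re + 2 * b := by simp
  rw [h5]
  have h6 : 0 ≤ b * u ^ 2 := by positivity
  linarith

lemma exists_norm_modelKernel_sub_le {b : ℝ} (hb : 0 ≤ b) : ∃ C : ℝ, 0 < C ∧
    ∀ τ : ℂ, 1 ≤ τ.re → |τ.im| ≤ τ.re / 100 → ∀ u : ℝ, |u| ≤ 1 →
      ‖modelKernel b τ u - modelApprox b τ u‖
        ≤ C * (τ.re ^ 4)⁻¹ * Real.exp (-(τ.re * u ^ 2 / 200)) := by
  obtain ⟨C, hC, hCb⟩ := exists_pow_mul_exp_le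
  refine ⟨C + ∑ j ∈ Finset.range 8, 2 ^ j * j * C, by positivity, fun τ ht hs u hu => ?_⟩
  set t := τ.re with htdef
  have ht0 : 0 < t := by linarith
  have hτ : ‖τ‖ ≤ 2 * t := (norm_le_of_sector hs).trans (by linarith)
  set y := t * u ^ 2 with hy
  have hy0 : 0 ≤ y := by positivity
  have hyu : y = t * |u| ^ 2 := by rw [sq_abs]
  set z := τ * expRem u with hz
  have hzn : ‖z‖ ≤ t * |u| ^ 3 / 4 := norm_mul_expRem_le hs hu
  have hzy : ‖z‖ ≤ y / 4 := by
    refine hzn.trans ?_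
    rw [hyu]
    have : |u| ^ 3 ≤ |u| ^ 2 := pow_le_pow_of_le_one (abs_nonneg u) hu (by norm_num)
    gcongr
  have hg := norm_gaussian_le hb (τ := τ) (u := u)
  rw [← htdef, ← hy] at hg
  set g := Complex.exp (-(τ + 2 * b) * u ^ 2 / 2) with hgdef
  have e1 : modelKernel b τ u - modelApprox b τ u
      = g * (Complex.exp z - ∑ j ∈ Finset.range 8, z ^ j / j.factorial)
        + ∑ j ∈ Finset.range 8, g * (τ ^ j / j.factorial * (expRem u ^ j - expTail j u ^ j)) := by
    rw [modelKernel_eq, modelApprox, ← hgdef, ← hz, ← Finset.mul_sum, ← mul_add, ← mul_sub]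
    congr 1
    have : ∑ j ∈ Finset.range 8, z ^ j / j.factorial
        = ∑ j ∈ Finset.range 8, τ ^ j / j.factorial * expRem u ^ j :=
      Finset.sum_congr rfl fun j _ => by rw [hz, mul_pow]; ring
    rw [this]
    simp only [mul_sub, Finset.sum_sub_distrib]
    ring
  have b1 : ‖g * (Complex.exp z - ∑ j ∈ Finset.range 8, z ^ j / j.factorial)‖
      ≤ C * (t ^ 4)⁻¹ * Real.exp (-(y / 200)) := by
    rw [norm_mul]
    calc _ ≤ Real.exp (-(y / 2)) * ((t * |u| ^ 3) ^ 8 * Real.exp (y / 4)) := by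
          gcongr
          refine (Complex.norm_exp_sub_sum_le_norm_mul_exp z 8).trans ?_
          gcongr
          exact hzn.trans (by have : 0 ≤ t * |u| ^ 3 := by positivity
                              linarith)
      _ = (t ^ 4)⁻¹ * (y ^ 12 * Real.exp (-(y / 4))) := by
          rw [show Real.exp (-(y / 4)) = Real.exp (-(y / 2)) * Real.exp (y / 4) by
            rw [← Real.exp_add]; congr 1; ring, hyu]
          field_simp
      _ ≤ (t ^ 4)⁻¹ * (y ^ 12 * Real.exp (-(y / 100))) := by gcongr; norm_num
      _ ≤ (t ^ 4)⁻¹ * (C * Real.exp (-(y / 200))) :=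
          mul_le_mul_of_nonneg_left (hCb 12 (by norm_num) y hy0) (by positivity)
      _ = _ := by ring
  have b2 (j : ℕ) (hj : j < 8) :
      ‖g * (τ ^ j / j.factorial * (expRem u ^ j - expTail j u ^ j))‖
        ≤ 2 ^ j * j * C * (t ^ 4)⁻¹ * Real.exp (-(y / 200)) := by
    rcases Nat.eq_zero_or_pos j with rfl | hj0
    · simp
    have hd : ‖expRem u ^ j - expTail j u ^ j‖ ≤ j * |u| ^ (2 * j + 8) := by
      refine (norm_pow_sub_pow_le (B := |u| ^ 3) ((norm_expRem_le hu).trans ?_)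
        (norm_expTail_le hu hj) j).trans ?_
      · have : 0 ≤ |u| ^ 3 := by positivity
        linarith
      · calc _ ≤ j * |u| ^ (11 - j) * (|u| ^ 3) ^ (j - 1) := by
              gcongr; exact norm_expRem_sub_expTail_le hu hj
          _ = _ := by
              rw [mul_assoc, ← pow_mul, ← pow_add]
              congr 2; omega
    rw [norm_mul, norm_mul, norm_div, norm_pow, Complex.norm_natCast]
    calc _ ≤ Real.exp (-(y / 2)) * ((2 * t) ^ j / 1 * (j * |u| ^ (2 * j + 8))) := by
          gcongr
          exact_mod_cast Nat.succ_le_of_lt j.factorial_pos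
      _ = 2 ^ j * j * (t ^ 4)⁻¹ * (y ^ (j + 4) * Real.exp (-(y / 2))) := by
          rw [hyu]; field_simp; ring
      _ ≤ 2 ^ j * j * (t ^ 4)⁻¹ * (y ^ (j + 4) * Real.exp (-(y / 100))) := by
          gcongr; norm_num
      _ ≤ 2 ^ j * j * (t ^ 4)⁻¹ * (C * Real.exp (-(y / 200))) :=
          mul_le_mul_of_nonneg_left (hCb _ (by omega) y hy0) (by positivity)
      _ = _ := by ring
  rw [e1]
  refine (norm_add_le _ _).trans ?_
  rw [add_mul, add_mul, Finset.sum_mul, Finset.sum_mul]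
  exact add_le_add b1 ((norm_sum_le _ _).trans
    (Finset.sum_le_sum fun j hj => b2 j (Finset.mem_range.mp hj)))

lemma exists_norm_modelApprox_le {b : ℝ} (hb : 0 ≤ b) : ∃ C : ℝ, 0 < C ∧
    ∀ τ : ℂ, 1 ≤ τ.re → |τ.im| ≤ τ.re / 100 → ∀ u : ℝ, 1 ≤ |u| →
      ‖modelApprox b τ u‖ ≤ C * (τ.re ^ 4)⁻¹ * Real.exp (-(τ.re * u ^ 2 / 200)) := by
  obtain ⟨C, hC, hCb⟩ := exists_pow_mul_exp_le
  refine ⟨∑ j ∈ Finset.range 8, 2 ^ j * C, by positivity, fun τ ht hs u hu => ?_⟩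
  set t := τ.re with htdef
  have ht0 : 0 < t := by linarith
  have hτ : ‖τ‖ ≤ 2 * t := (norm_le_of_sector hs).trans (by linarith)
  set y := t * u ^ 2 with hy
  have hy0 : 0 ≤ y := by positivity
  have hyu : y = t * |u| ^ 2 := by rw [sq_abs]
  have hg := norm_gaussian_le hb (τ := τ) (u := u)
  rw [← htdef, ← hy] at hg
  rw [modelApprox, Finset.mul_sum, Finset.sum_mul, Finset.sum_mul]
  refine (norm_sum_le _ _).trans (Finset.sum_le_sum fun j hj => ?_)
  have hj := Finset.mem_range.mp hj
  rw [norm_mul, norm_mul, norm_div, norm_pow, norm_pow, Complex.norm_natCast]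
  calc _ ≤ Real.exp (-(y / 2)) * ((2 * t) ^ j / 1 * (|u| ^ 10) ^ j) := by
        gcongr
        · exact_mod_cast Nat.succ_le_of_lt j.factorial_pos
        · exact norm_expTail_le_of_one_le hu hj
    _ = 2 ^ j * (t ^ 4)⁻¹ * (t ^ (j + 4) * |u| ^ (10 * j) * Real.exp (-(y / 2))) := by
        rw [← pow_mul]; field_simp; ring
    _ ≤ 2 ^ j * (t ^ 4)⁻¹ * (t ^ (5 * j + 4) * |u| ^ (10 * j + 8) * Real.exp (-(y / 100))) := by
        gcongr <;> first | exact ht | omega | norm_num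
    _ = 2 ^ j * (t ^ 4)⁻¹ * (y ^ (5 * j + 4) * Real.exp (-(y / 100))) := by
        rw [hyu]; ring
    _ ≤ 2 ^ j * (t ^ 4)⁻¹ * (C * Real.exp (-(y / 200))) :=
        mul_le_mul_of_nonneg_left (hCb _ (by omega) y hy0) (by positivity)
    _ = _ := by ring

lemma integrable_modelApprox {b : ℝ} (hb : 0 ≤ b) {τ : ℂ} (ht : 0 < τ.re) :
    MeasureTheory.Integrable (modelApprox b τ) := by
  have hc : 0 < (τ + 2 * b).re := by simp; positivity
  refine (MeasureTheory.integrable_finsetSum (Finset.range 8) fun j hj =>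
    (integrable_horner_mul_gaussian hc (tailPowerCoeffs j) (3 * j)).const_mul
      (τ ^ j / j.factorial)).congr (Eventually.of_forall fun u => ?_)
  simp only [modelApprox]
  rw [Finset.mul_sum]
  refine Finset.sum_congr rfl fun j hj => ?_
  rw [expTail_pow_eq (Finset.mem_range.mp hj)]
  ring

lemma integral_modelApprox {b : ℝ} (hb : 0 ≤ b) {τ : ℂ} (ht : 0 < τ.re) :
    ∫ u : ℝ, modelApprox b τ u = (2 * Real.pi / (τ + 2 * b)) ^ (1 / 2 : ℂ) *
      ∑ j ∈ Finset.range 8, τ ^ j / j.factorial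
        * momentSum (τ + 2 * b)⁻¹ (3 * j) (tailPowerCoeffs j) := by
  have hc : 0 < (τ + 2 * b).re := by simp; positivity
  have h : modelApprox b τ = fun u : ℝ => ∑ j ∈ Finset.range 8, τ ^ j / j.factorial *
      ((Complex.I * u) ^ (3 * j) * hornerEval (tailPowerCoeffs j) (Complex.I * u)
        * Complex.exp (-(τ + 2 * b) * u ^ 2 / 2)) := by
    ext u
    rw [modelApprox, Finset.mul_sum]
    refine Finset.sum_congr rfl fun j hj => ?_
    rw [expTail_pow_eq (Finset.mem_range.mp hj)]
    ring
  rw [h, MeasureTheory.integral_finsetSum _ fun j _ =>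
    (integrable_horner_mul_gaussian hc (tailPowerCoeffs j) (3 * j)).const_mul _, Finset.mul_sum]
  refine Finset.sum_congr rfl fun j _ => ?_
  rw [MeasureTheory.integral_const_mul, integral_horner_mul_gaussian hc]
  ring

lemma norm_cpow_half (z : ℂ) : ‖z ^ (1 / 2 : ℂ)‖ = √‖z‖ := by
  have h : (z ^ (1 / 2 : ℂ)) ^ 2 = z := by simp
  rw [← Real.sqrt_sq (norm_nonneg (z ^ (1 / 2 : ℂ))), ← norm_pow, h]

/-- The exact Gaussian mean of the approximation, compared with the truncated expansion. -/
lemma exists_norm_integral_modelApprox_sub_le {b : ℝ} (hb : 0 ≤ b) : ∃ C : ℝ, 0 < C ∧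
    ∀ τ : ℂ, 1 ≤ τ.re → ‖(∫ u : ℝ, modelApprox b τ u)
      - (2 * Real.pi / (τ + 2 * b)) ^ (1 / 2 : ℂ) * truncSeries 3 (b / τ) 0 (1 / τ)‖
        ≤ C * ((τ.re ^ 4)⁻¹ * (√τ.re)⁻¹) := by
  obtain ⟨C, hC⟩ := ((isCompact_closedBall (0 : ℂ) 1).prod
    (isCompact_closedBall (0 : ℂ) 1)).exists_bound_of_continuousOn
    (f := fun p : ℂ × ℂ => momentRemainder p.1 p.2)
    (by unfold momentRemainder; fun_prop)
  have hC0 : 0 ≤ C := (norm_nonneg _).trans (hC (0, 0) (by simp))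
  refine ⟨√(2 * Real.pi) * C + 1, by positivity, fun τ ht => ?_⟩
  have ht0 : 0 < τ.re := by linarith
  have hτ0 : τ ≠ 0 := by rintro rfl; simp at ht0
  have hre : (τ + 2 * b).re = τ.re + 2 * b := by simp
  have hc0 : τ + 2 * b ≠ 0 := fun h => by
    rw [h, Complex.zero_re] at hre; linarith
  have htn : τ.re ≤ ‖τ‖ := Complex.re_le_norm τ
  have htc : τ.re ≤ ‖τ + 2 * b‖ := by
    have := Complex.re_le_norm (τ + 2 * b)
    linarith
  have hcn : ‖τ‖ ≤ ‖τ + 2 * b‖ := by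
    rw [Complex.norm_def, Complex.norm_def]
    refine Real.sqrt_le_sqrt ?_
    rw [Complex.normSq_apply, Complex.normSq_apply, hre]
    have : (τ + 2 * b).im = τ.im := by simp
    rw [this]
    nlinarith
  set d := τ / (τ + 2 * b) with hd
  have hdn : ‖d‖ ≤ 1 := by
    rw [hd, norm_div]; exact div_le_one_of_le₀ hcn (norm_nonneg _)
  have hwn : ‖1 / τ‖ ≤ τ.re⁻¹ := by
    rw [norm_div, norm_one, one_div]; gcongr
  have hw1 : ‖1 / τ‖ ≤ 1 := hwn.trans (inv_le_one_of_one_le₀ ht)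
  have hwd : (τ + 2 * b)⁻¹ = 1 / τ * d := by rw [hd]; field_simp
  have hsum := momentSum_total (w := 1 / τ) (d := d) (a := b / τ) (by simpa using hτ0)
    (by rw [hd]; field_simp)
  rw [integral_modelApprox hb ht0, hwd, ← mul_sub]
  have e1 : ∑ j ∈ Finset.range 8, τ ^ j / j.factorial
        * momentSum (1 / τ * d) (3 * j) (tailPowerCoeffs j) - truncSeries 3 (b / τ) 0 (1 / τ)
      = (1 / τ) ^ 4 * momentRemainder (1 / τ) d := by
    rw [show (1 / τ)⁻¹ = τ by simp] at hsum
    rw [hsum]; ring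
  rw [e1, norm_mul, norm_mul, norm_cpow_half, norm_pow]
  have e2 : √‖2 * Real.pi / (τ + 2 * b)‖ ≤ √(2 * Real.pi) * (√τ.re)⁻¹ := by
    rw [← Real.sqrt_inv, ← Real.sqrt_mul (by positivity)]
    refine Real.sqrt_le_sqrt ?_
    rw [norm_div, ← div_eq_mul_inv]
    have : ‖(2 * Real.pi : ℂ)‖ = 2 * Real.pi := by
      rw [norm_mul, Complex.norm_real, Real.norm_of_nonneg Real.pi_pos.le]; simp
    rw [this]
    gcongr
  calc _ ≤ √(2 * Real.pi) * (√τ.re)⁻¹ * ((τ.re⁻¹) ^ 4 * C) := by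
        gcongr
        exact hC (1 / τ, d) (by simpa using ⟨by simpa using hw1, hdn⟩)
    _ = √(2 * Real.pi) * C * ((τ.re ^ 4)⁻¹ * (√τ.re)⁻¹) := by rw [inv_pow]; ring
    _ ≤ _ := by gcongr; linarith

/-- The model integral over a window of length `2π`, to the order `τ⁻⁴`, uniformly in a sector
around the positive axis. -/
lemma exists_norm_modelIntegral_sub_le {b : ℝ} (hb : 0 ≤ b) : ∃ C : ℝ, 0 < C ∧
    ∀ τ : ℂ, 1 ≤ τ.re → |τ.im| ≤ τ.re / 100 → ∀ ρ : ℝ, |ρ| ≤ 1 →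
      ‖(∫ u in (-Real.pi - ρ)..(Real.pi - ρ), modelKernel b τ u)
        - (2 * Real.pi / (τ + 2 * b)) ^ (1 / 2 : ℂ) * truncSeries 3 (b / τ) 0 (1 / τ)‖
        ≤ C * ((τ.re ^ 4)⁻¹ * (√τ.re)⁻¹) := by
  obtain ⟨C₁, hC₁, h₁⟩ := exists_norm_modelKernel_sub_le hb
  obtain ⟨C₂, hC₂, h₂⟩ := exists_norm_modelApprox_le hb
  obtain ⟨C₃, hC₃, h₃⟩ := exists_norm_integral_modelApprox_sub_le hb
  obtain ⟨C₄, hC₄, h₄⟩ := exists_pow_mul_exp_le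
  set K := C₁ + C₂ + C₄ with hK
  refine ⟨K * √(200 * Real.pi) + C₃, by positivity, fun τ ht hs ρ hρ => ?_⟩
  have ht0 : 0 < τ.re := by linarith
  have hpi := Real.pi_gt_three
  obtain ⟨hρ1, hρ2⟩ := abs_le.mp hρ
  set W := Set.Ioc (-Real.pi - ρ) (Real.pi - ρ) with hW
  have hpt (u : ℝ) : ‖W.indicator (modelKernel b τ) u - modelApprox b τ u‖
      ≤ K * (τ.re ^ 4)⁻¹ * Real.exp (-(τ.re / 200) * u ^ 2) := by
    rw [show -(τ.re / 200) * u ^ 2 = -(τ.re * u ^ 2 / 200) by ring]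
    set X := (τ.re ^ 4)⁻¹ * Real.exp (-(τ.re * u ^ 2 / 200)) with hX
    have hX0 : 0 ≤ X := by positivity
    rcases le_total |u| 1 with hu | hu
    · obtain ⟨hu1, hu2⟩ := abs_le.mp hu
      by_cases hu3 : u ∈ W
      · rw [Set.indicator_of_mem hu3]
        have := h₁ τ ht hs u hu
        rw [mul_assoc, ← hX] at this ⊢
        refine this.trans ?_
        gcongr; linarith
      · exact absurd (by rw [hW]; constructor <;> linarith) hu3
    · have hA := h₂ τ ht hs u hu
      rw [mul_assoc, ← hX] at hA ⊢
      have hk : ‖W.indicator (modelKernel b τ) u‖ ≤ C₄ * X := by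
        by_cases hu3 : u ∈ W
        · rw [Set.indicator_of_mem hu3]
          have hup : |u| ≤ Real.pi + 1 := abs_le.mpr ⟨by linarith [hu3.1], by linarith [hu3.2]⟩
          refine (norm_modelKernel_le hb hs hup).trans ?_
          have h5 := h₄ 4 (by norm_num) (τ.re * u ^ 2) (by positivity)
          have h6 : 1 ≤ u ^ 2 := by rw [← sq_abs]; exact one_le_pow₀ hu
          calc Real.exp (-(τ.re * u ^ 2 / 100))
              ≤ (u ^ 2) ^ 4 * Real.exp (-(τ.re * u ^ 2 / 100)) :=
                le_mul_of_one_le_left (Real.exp_pos _).le (one_le_pow₀ h6)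
            _ = (τ.re ^ 4)⁻¹ * ((τ.re * u ^ 2) ^ 4 * Real.exp (-(τ.re * u ^ 2 / 100))) := by
                field_simp
            _ ≤ (τ.re ^ 4)⁻¹ * (C₄ * Real.exp (-(τ.re * u ^ 2 / 200))) := by gcongr
            _ = _ := by rw [hX]; ring
        · rw [Set.indicator_of_notMem hu3, norm_zero]; positivity
      refine (norm_sub_le _ _).trans ((add_le_add hk hA).trans ?_)
      rw [hK]
      nlinarith [mul_nonneg hC₁.le hX0]
  have hcont : Continuous (modelKernel b τ) := by unfold modelKernel; fun_prop
  have hint : MeasureTheory.Integrable (W.indicator (modelKernel b τ)) :=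
    (hcont.integrableOn_Ioc).integrable_indicator measurableSet_Ioc
  have hG : MeasureTheory.Integrable
      fun u : ℝ => K * (τ.re ^ 4)⁻¹ * Real.exp (-(τ.re / 200) * u ^ 2) :=
    (integrable_exp_neg_mul_sq (by linarith)).const_mul _
  have hI := MeasureTheory.norm_integral_le_of_norm_le hG (Eventually.of_forall hpt)
  rw [MeasureTheory.integral_sub hint (integrable_modelApprox hb ht0),
    MeasureTheory.integral_indicator measurableSet_Ioc, MeasureTheory.integral_const_mul,
    integral_gaussian] at hI
  rw [intervalIntegral.integral_of_le (by linarith)]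
  have e3 : √(Real.pi / (τ.re / 200)) = √(200 * Real.pi) * (√τ.re)⁻¹ := by
    rw [← Real.sqrt_inv, ← Real.sqrt_mul (by positivity)]
    congr 1; field_simp
  rw [e3] at hI
  calc _ ≤ _ := norm_sub_le_norm_sub_add_norm_sub _ (∫ u : ℝ, modelApprox b τ u) _
    _ ≤ _ := add_le_add hI (h₃ τ ht)
    _ = _ := by ring

/-! ### The saddle points -/

/-- The scale `M = 2 n log x`, in which the saddle-point equation reads `λ (M + is) = -is`. -/
def scale (x : ℝ) (n : ℕ) : ℝ := 2 * n * Real.log x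

/-- The logarithmic form of the saddle-point equation after elimination of `λ`: on the strip
`0 < Im s < M` the saddles are the solutions of `saddleMap s = log (i n α) - 2πik`. -/
def saddleMap (x : ℝ) (n : ℕ) (s : ℂ) : ℂ :=
  Complex.log s - Complex.log (1 + Complex.I * s / scale x n) - Complex.I * s

lemma one_add_lam_ne_zero_of_isSaddle {x : ℝ} (hx : 1 < x) {n : ℕ} {s : ℂ}
    (h : IsSaddle x n s) : 1 + lam x s ≠ 0 := by
  -- At a zero of `1 + λ` the value `log 0 = 0` would make `exp ∘ log` of it discontinuous.
  intro h0
  set g : ℂ → ℂ := fun z => 1 + x * Complex.exp (Complex.I * z) with hg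
  have hg0 : g s = 0 := h0
  have hgd : HasDerivAt g (x * (Complex.exp (Complex.I * s) * (Complex.I * 1))) s :=
    ((((hasDerivAt_id s).const_mul Complex.I).cexp).const_mul (x : ℂ)).const_add 1
  have hne : ∀ᶠ z in 𝓝[≠] s, g z ≠ 0 := hgd.eventually_ne (by
    have : (x : ℂ) ≠ 0 := by exact_mod_cast (by linarith : x ≠ 0)
    simp [this, Complex.exp_ne_zero])
  have hlog : ContinuousAt (fun z => Complex.exp (Complex.log (g z))) s := by
    have h1 : ContinuousAt (fun z => z ^ 2 / (4 * n * (Real.log x : ℂ)) - psi x n z) s :=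
      (by fun_prop : ContinuousAt (fun z : ℂ => z ^ 2 / (4 * n * (Real.log x : ℂ))) s).sub
        h.continuousAt
    refine (Complex.continuous_exp.continuousAt.comp h1).congr (Eventually.of_forall fun z => ?_)
    simp only [Function.comp_apply, psi, hg, sub_sub_cancel]
  have e1 : ∀ᶠ z in 𝓝[≠] s, ‖g z‖ < 1 / 2 := by
    have := hgd.continuousAt.norm.tendsto
    rw [hg0, norm_zero] at this
    exact (this.eventually_lt_const (by norm_num)).filter_mono nhdsWithin_le_nhds
  have e2 : ∀ᶠ z in 𝓝[≠] s, ‖Complex.exp (Complex.log (g z)) - 1‖ < 1 / 2 := by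
    have h1 : ContinuousAt (fun z => ‖Complex.exp (Complex.log (g z)) - 1‖) s :=
      (hlog.sub continuousAt_const).norm
    have h2 : ‖Complex.exp (Complex.log (g s)) - 1‖ = 0 := by simp [hg0]
    have this : Tendsto (fun z => ‖Complex.exp (Complex.log (g z)) - 1‖) (𝓝 s) (𝓝 0) := by
      rw [← h2]; exact h1.tendsto
    exact (this.eventually_lt_const (by norm_num)).filter_mono nhdsWithin_le_nhds
  obtain ⟨z, hz, h1, h2⟩ := (hne.and (e1.and e2)).exists
  rw [Complex.exp_log hz] at h2
  have : ‖(1 : ℂ)‖ ≤ ‖g z‖ + ‖g z - 1‖ := by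
    rw [show (1 : ℂ) = g z - (g z - 1) by ring]
    simpa using norm_sub_le (g z) (g z - 1)
  rw [norm_one] at this
  linarith

lemma exp_I_mul_shift (k : ℕ) (σ : ℂ) :
    Complex.exp (Complex.I * shift k σ) = Complex.exp (Complex.I * σ) := by
  rw [shift, show Complex.I * (σ + 2 * Real.pi * k) = Complex.I * σ + k * (2 * Real.pi * Complex.I)
    by ring, Complex.exp_add, Complex.exp_nat_mul_two_pi_mul_I, mul_one]

lemma lam_shift (x : ℝ) (k : ℕ) (σ : ℂ) : lam x (shift k σ) = lam x σ := by
  rw [lam, lam, exp_I_mul_shift]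

lemma norm_lam {x : ℝ} (hx : 0 < x) (s : ℂ) : ‖lam x s‖ = x * Real.exp (-s.im) := by
  rw [lam, norm_mul, Complex.norm_real, Real.norm_of_nonneg hx.le, Complex.norm_exp]
  simp

lemma lam_ne_zero {x : ℝ} (hx : 0 < x) (s : ℂ) : lam x s ≠ 0 :=
  mul_ne_zero (by exact_mod_cast hx.ne') (Complex.exp_ne_zero _)

section

variable {x : ℝ} (hx : 1 < x) {n : ℕ}

include hx

lemma scale_pos (hn : 1 ≤ n) : 0 < scale x n := by
  have := Real.log_pos hx
  have : (1 : ℝ) ≤ n := by exact_mod_cast hn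
  unfold scale; positivity

lemma saddle_constant_ne_zero (hn : 1 ≤ n) :
    Complex.I * n * (2 * x * Real.log x : ℝ) ≠ 0 := by
  have h1 := Real.log_pos hx
  have h2 : (2 * x * Real.log x : ℝ) ≠ 0 := by positivity
  have h3 : (n : ℂ) ≠ 0 := by exact_mod_cast (by omega : n ≠ 0)
  exact mul_ne_zero (mul_ne_zero Complex.I_ne_zero h3) (by exact_mod_cast h2)

lemma lam_mul_eq_of_isSaddleShift (hn : 1 ≤ n) {k : ℕ} {σ : ℂ} (h : IsSaddleShift x n k σ) :
    shift k σ ≠ 0 ∧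
      lam x (shift k σ) * (scale x n + Complex.I * shift k σ) = -Complex.I * shift k σ := by
  obtain ⟨h1, h2⟩ := h
  have hl := one_add_lam_ne_zero_of_isSaddle hx h1
  have hL := Real.log_pos hx
  have hn0 : (0 : ℝ) < n := by exact_mod_cast hn
  have hα : Complex.log (Complex.I * n * (2 * x * Real.log x : ℝ))
      = Real.log (n * (2 * x * Real.log x)) + Real.pi / 2 * Complex.I := by
    rw [show Complex.I * n * (2 * x * Real.log x : ℝ)
      = ((n * (2 * x * Real.log x) : ℝ) : ℂ) * Complex.I by push_cast; ring,
      Complex.log_ofReal_mul (by positivity) Complex.I_ne_zero, Complex.log_I]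
  have hs : shift k σ ≠ 0 := by
    intro hs
    have hlam : lam x σ = x := by rw [← lam_shift x k, hs]; simp [lam]
    have hσ : σ = -(2 * Real.pi * k) := by
      rw [shift] at hs; linear_combination hs
    have h3 : 1 + x * Complex.exp (Complex.I * σ) = ((1 + x : ℝ) : ℂ) := by
      have : x * Complex.exp (Complex.I * σ) = x := hlam
      rw [this]; push_cast; ring
    rw [hs, h3, Complex.log_zero, hα, ← Complex.ofReal_log (by linarith), hσ] at h2
    have h4 := congrArg Complex.im h2
    simp at h4
    -- The imaginary parts are `2πk` and `π/2`.
    have h5 : (4 * k : ℝ) = 1 := by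
      have := Real.pi_pos
      have h6 : Real.pi * (4 * k - 1) = 0 := by linarith
      have := (mul_eq_zero.mp h6).resolve_left this.ne'
      linarith
    have h6 : 4 * k = 1 := by exact_mod_cast h5
    omega
  refine ⟨hs, ?_⟩
  have h3 := congrArg Complex.exp h2
  rw [Complex.exp_add, Complex.exp_sub, Complex.exp_log hs,
    Complex.exp_log (saddle_constant_ne_zero hx hn), ← exp_I_mul_shift k σ,
    Complex.exp_log (by exact hl)] at h3
  set E := Complex.exp (Complex.I * shift k σ) with hE
  have hE0 : E ≠ 0 := Complex.exp_ne_zero _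
  have h4 : lam x (shift k σ) = x * E := rfl
  rw [h4, scale]
  push_cast at h3 ⊢
  field_simp at h3
  linear_combination Complex.I * h3 + (2 * x * n * E * Real.log x) * Complex.I_sq

lemma two_log_lt_scale (hn : 2 ≤ n) : 2 * Real.log x < scale x n := by
  have h1 := Real.log_pos hx
  have h2 : (2 : ℝ) ≤ n := by exact_mod_cast hn
  rw [scale]; nlinarith

/-- Taking absolute values in the saddle-point equation confines every solution to the strip
`log x < Im s < M / 2`. -/
lemma im_bounds_of_lam_mul_eq (hn : 2 ≤ n) {s : ℂ} (hs : s ≠ 0)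
    (h : lam x s * (scale x n + Complex.I * s) = -Complex.I * s) :
    Real.log x < s.im ∧ 2 * s.im < scale x n := by
  have hL := Real.log_pos hx
  have hM := scale_pos hx (n := n) (by omega)
  have hM2 := two_log_lt_scale hx hn
  have hx0 : 0 < x := by linarith
  have h1 := congrArg Complex.normSq h
  rw [Complex.normSq_mul, Complex.normSq_mul, Complex.normSq_neg, Complex.normSq_I, one_mul,
    Complex.normSq_eq_norm_sq, norm_lam hx0, Complex.normSq_apply, Complex.normSq_apply s] at h1
  simp only [Complex.add_re, Complex.ofReal_re, Complex.mul_re, Complex.I_re, zero_mul,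
    Complex.I_im, one_mul, zero_sub, Complex.add_im, Complex.ofReal_im, Complex.mul_im,
    zero_add] at h1
  set ξ := s.re
  set η := s.im
  set M := scale x n
  have hpos : 0 < ξ * ξ + η * η := by
    have := Complex.normSq_pos.mpr hs
    rwa [Complex.normSq_apply] at this
  set q := x * Real.exp (-η) with hq
  have hq0 : 0 < q := by positivity
  have hq1 : q < 1 ↔ Real.log x < η := by
    rw [hq, ← Real.exp_log hx0, ← Real.exp_add, Real.exp_lt_one_iff, Real.log_exp]
    constructor <;> intro h <;> linarith
  have h2 : q ^ 2 * (M * (M - 2 * η)) = (1 - q ^ 2) * (ξ * ξ + η * η) := by linarith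
  have hη : Real.log x < η := by
    by_contra hcon
    have hq2 : 1 ≤ q := not_lt.mp (fun h => hcon (hq1.mp h))
    have h3 : 0 < M * (M - 2 * η) := mul_pos hM (by linarith [not_lt.mp hcon])
    have h4 : 0 < q ^ 2 * (M * (M - 2 * η)) := by positivity
    have h5 : (1 - q ^ 2) * (ξ * ξ + η * η) ≤ 0 :=
      mul_nonpos_of_nonpos_of_nonneg (by nlinarith) hpos.le
    linarith
  refine ⟨hη, ?_⟩
  have hq2 := hq1.mpr hη
  have h3 : 0 < (1 - q ^ 2) * (ξ * ξ + η * η) := mul_pos (by nlinarith) hpos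
  rw [← h2] at h3
  have h4 := (pos_iff_pos_of_mul_pos (pos_of_mul_pos_right h3 (by positivity) |> fun h => h)).mp hM
  linarith

omit hx in
lemma re_one_add_pos {s : ℂ} (hM : 0 < scale x n) (hs : s.im < scale x n) :
    0 < (1 + Complex.I * s / scale x n).re := by
  rw [Complex.add_re, Complex.div_ofReal_re]
  have : (Complex.I * s).re = -s.im := by simp
  rw [this, Complex.one_re, neg_div]
  have := (div_lt_one hM).mpr hs
  linarith

omit hx in
lemma ne_zero_of_im_pos {s : ℂ} (hs : 0 < s.im) : s ≠ 0 := by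
  rintro rfl; simp at hs

lemma one_add_lam_eq (hn : 1 ≤ n) {s : ℂ} (hs : s.im < scale x n)
    (h : lam x s * (scale x n + Complex.I * s) = -Complex.I * s) :
    1 + lam x s = (1 + Complex.I * s / scale x n)⁻¹ := by
  have hM := scale_pos hx hn
  have h1 := re_one_add_pos hM hs
  have h2 : (1 + Complex.I * s / scale x n) ≠ 0 := fun h0 => by rw [h0] at h1; simp at h1
  have hMc : (scale x n : ℂ) ≠ 0 := by exact_mod_cast hM.ne'
  refine eq_inv_of_mul_eq_one_left ?_
  field_simp
  linear_combination h

lemma log_one_add_lam (hn : 1 ≤ n) {s : ℂ} (hs : s.im < scale x n)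
    (h : lam x s * (scale x n + Complex.I * s) = -Complex.I * s) :
    Complex.log (1 + lam x s) = -Complex.log (1 + Complex.I * s / scale x n) := by
  rw [one_add_lam_eq hx hn hs h, Complex.log_inv]
  intro harg
  have h1 := re_one_add_pos (scale_pos hx hn) hs
  have := (Complex.abs_arg_le_pi_div_two_iff (z := 1 + Complex.I * s / scale x n)).mpr h1.le
  rw [harg, abs_of_pos Real.pi_pos] at this
  linarith [Real.pi_pos]

/-- The points `s_k` are the solutions in a strip of an equation between holomorphic functions. -/
lemma isSaddleShift_iff (hn : 2 ≤ n) {k : ℕ} {σ : ℂ} :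
    IsSaddleShift x n k σ ↔
      0 < (shift k σ).im ∧ (shift k σ).im < scale x n ∧
        lam x (shift k σ) * (scale x n + Complex.I * shift k σ) = -Complex.I * shift k σ ∧
        saddleMap x n (shift k σ) =
          Complex.log (Complex.I * n * (2 * x * Real.log x : ℝ)) - 2 * Real.pi * k * Complex.I := by
  have hL := Real.log_pos hx
  have hM := scale_pos hx (n := n) (by omega)
  have hsh : Complex.I * shift k σ = Complex.I * σ + 2 * Real.pi * k * Complex.I := by
    rw [shift]; ring
  constructor
  · intro h
    obtain ⟨hs, h1⟩ := lam_mul_eq_of_isSaddleShift hx (by omega) h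
    obtain ⟨h2, h3⟩ := im_bounds_of_lam_mul_eq hx hn hs h1
    refine ⟨by linarith, by linarith, h1, ?_⟩
    have h4 := log_one_add_lam hx (by omega) (by linarith) h1
    have h5 := h.2
    rw [show (1 + x * Complex.exp (Complex.I * σ) : ℂ) = 1 + lam x (shift k σ) by
      rw [lam_shift, lam], h4] at h5
    rw [saddleMap, ← h5, hsh]; ring
  · rintro ⟨h1, h2, h3, h4⟩
    set s := shift k σ with hs
    have hs0 := ne_zero_of_im_pos h1
    have h5 := one_add_lam_eq hx (by omega) h2 h3
    have h6 := re_one_add_pos hM h2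
    have hslit : 1 + lam x s ∈ Complex.slitPlane := by
      rw [h5]
      refine Or.inl ?_
      rw [Complex.inv_re]
      exact div_pos h6 (Complex.normSq_pos.mpr fun h0 => by rw [h0] at h6; simp at h6)
    constructor
    · have hd : HasDerivAt (psi x n) (2 * s / (4 * n * (Real.log x : ℂ))
          - x * (Complex.exp (Complex.I * s) * (Complex.I * 1))
            / (1 + x * Complex.exp (Complex.I * s))) s := by
        have d1 : HasDerivAt (fun z : ℂ => z ^ 2 / (4 * n * (Real.log x : ℂ)))
            (2 * s / (4 * n * (Real.log x : ℂ))) s := by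
          simpa using (hasDerivAt_pow 2 s).div_const (4 * n * (Real.log x : ℂ))
        exact d1.sub ((((((hasDerivAt_id s).const_mul Complex.I).cexp).const_mul (x : ℂ)).const_add
          1).clog hslit)
      refine hd.congr_deriv ?_
      have hne : 1 + lam x s ≠ 0 := Complex.slitPlane_ne_zero hslit
      have hn0 : (n : ℂ) ≠ 0 := by exact_mod_cast (by omega : n ≠ 0)
      have hL0 : (Real.log x : ℂ) ≠ 0 := by exact_mod_cast hL.ne'
      have e1 : x * (Complex.exp (Complex.I * s) * (Complex.I * 1)) = Complex.I * lam x s := by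
        rw [lam]; ring
      have e2 : (1 + x * Complex.exp (Complex.I * s) : ℂ) = 1 + lam x s := by rw [lam]
      rw [e1, e2]
      rw [scale] at h3
      push_cast at h3
      field_simp
      linear_combination (-2 * Complex.I) * h3 + (2 * s * (1 + lam x s)) * Complex.I_sq
    · have h7 := log_one_add_lam hx (by omega) h2 h3
      have e2 : (1 + x * Complex.exp (Complex.I * σ) : ℂ) = 1 + lam x s := by
        rw [hs, lam_shift, lam]
      rw [e2, h7]
      rw [saddleMap] at h4
      linear_combination h4 + hsh

/-- A solution of the logarithmic equation in the strip satisfies the saddle-point equation. -/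
lemma lam_mul_eq_of_saddleMap_eq (hn : 2 ≤ n) {k : ℕ} {s : ℂ} (h1 : 0 < s.im)
    (h2 : s.im < scale x n) (h : saddleMap x n s =
      Complex.log (Complex.I * n * (2 * x * Real.log x : ℝ)) - 2 * Real.pi * k * Complex.I) :
    lam x s * (scale x n + Complex.I * s) = -Complex.I * s := by
  have hM := scale_pos hx (n := n) (by omega)
  have h6 := re_one_add_pos hM h2
  have h60 : (1 + Complex.I * s / scale x n) ≠ 0 := fun h0 => by rw [h0] at h6; simp at h6
  have h3 := congrArg Complex.exp h
  rw [saddleMap, Complex.exp_sub, Complex.exp_sub, Complex.exp_log (ne_zero_of_im_pos h1),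
    Complex.exp_log h60, Complex.exp_sub,
    Complex.exp_log (saddle_constant_ne_zero hx (by omega)),
    show (2 * Real.pi * k * Complex.I : ℂ) = k * (2 * Real.pi * Complex.I) by ring,
    Complex.exp_nat_mul_two_pi_mul_I, div_one] at h3
  have hE := Complex.exp_ne_zero (Complex.I * s)
  have hMc : (scale x n : ℂ) ≠ 0 := by exact_mod_cast hM.ne'
  have h4 : (scale x n : ℂ) + Complex.I * s ≠ 0 := fun h0 => h60 (by
    field_simp; simpa using h0)
  have h5 : 1 + Complex.I * s / scale x n = (scale x n + Complex.I * s) / scale x n := by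
    field_simp
  rw [h5] at h3
  have h7 : (scale x n : ℂ) = 2 * n * Real.log x := by rw [scale]; push_cast; ring
  have h8 : s * scale x n = Complex.I * x * scale x n
      * ((scale x n + Complex.I * s) * Complex.exp (Complex.I * s)) := by
    rw [div_div, div_eq_iff (mul_ne_zero (div_ne_zero h4 hMc) hE)] at h3
    have h9 : (scale x n + Complex.I * s) / scale x n * scale x n
        = scale x n + Complex.I * s := div_mul_cancel₀ _ hMc
    push_cast at h3
    linear_combination (scale x n : ℂ) * h3
      + Complex.I * n * (2 * x * Real.log x) * Complex.exp (Complex.I * s) * h9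
      + (-Complex.I * x * ((scale x n + Complex.I * s) * Complex.exp (Complex.I * s))) * h7
  refine mul_left_cancel₀ hMc ?_
  rw [lam]
  linear_combination Complex.I * h8 + (x * scale x n * ((scale x n + Complex.I * s)
      * Complex.exp (Complex.I * s))) * Complex.I_sq

lemma hasDerivAt_saddleMap (hn : 1 ≤ n) {s : ℂ} (h1 : 0 < s.im) (h2 : s.im < scale x n) :
    HasDerivAt (saddleMap x n)
      (s⁻¹ - Complex.I / (scale x n + Complex.I * s) - Complex.I) s := by
  have hM := scale_pos hx hn
  have h6 := re_one_add_pos hM h2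
  have h60 : (1 + Complex.I * s / scale x n) ≠ 0 := fun h0 => by rw [h0] at h6; simp at h6
  have hMc : (scale x n : ℂ) ≠ 0 := by exact_mod_cast hM.ne'
  have d1 := Complex.hasDerivAt_log (z := s) (Or.inr h1.ne')
  have d2 : HasDerivAt (fun z : ℂ => Complex.I * z) Complex.I s := by
    simpa using (hasDerivAt_id s).const_mul Complex.I
  have d3 := ((d2.div_const (scale x n : ℂ)).const_add 1).clog (Or.inl h6)
  refine ((d1.sub d3).sub d2).congr_deriv ?_
  congr 2
  field_simp

omit hx in
lemma scale_add_ne_zero {s : ℂ} (h2 : s.im < scale x n) :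
    (scale x n : ℂ) + Complex.I * s ≠ 0 := fun h => by
  have := congrArg Complex.re h
  simp at this
  linarith

/-- The real part of `i` times the derivative of `saddleMap` is at least one on the strip, so
that `saddleMap` is injective there. -/
lemma saddleMap_injOn (hn : 1 ≤ n) {s t : ℂ} (hs1 : 0 < s.im) (hs2 : s.im < scale x n)
    (ht1 : 0 < t.im) (ht2 : t.im < scale x n) (h : saddleMap x n s = saddleMap x n t) :
    s = t := by
  by_contra hne
  have hM := scale_pos hx hn
  set δ := t - s with hδ
  have hδ0 : δ ≠ 0 := sub_ne_zero.mpr (Ne.symm hne)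
  set p : ℝ → ℂ := fun v => s + v * δ with hp
  have him (v : ℝ) : (p v).im = (1 - v) * s.im + v * t.im := by
    simp [hp, hδ]; ring
  have hp1 (v : ℝ) (hv : v ∈ Set.Icc (0 : ℝ) 1) : 0 < (p v).im := by
    rw [him]
    rcases eq_or_lt_of_le hv.1 with h0 | h0
    · rw [← h0]; simpa using hs1
    · have := mul_pos h0 ht1
      have := mul_nonneg (sub_nonneg.mpr hv.2) hs1.le
      linarith
  have hp2 (v : ℝ) (hv : v ∈ Set.Icc (0 : ℝ) 1) : (p v).im < scale x n := by
    rw [him]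
    rcases eq_or_lt_of_le hv.1 with h0 | h0
    · rw [← h0]; simpa using hs2
    · have := mul_lt_mul_of_pos_left ht2 h0
      have := mul_le_mul_of_nonneg_left hs2.le (sub_nonneg.mpr hv.2)
      linarith
  set f : ℝ → ℝ := fun v => (saddleMap x n (p v) * (Complex.I * (starRingEnd ℂ) δ)).re with hf
  have hderiv (v : ℝ) (hv : v ∈ Set.Icc (0 : ℝ) 1) : HasDerivAt f
      ((((p v)⁻¹ - Complex.I / (scale x n + Complex.I * p v) - Complex.I) * δ
        * (Complex.I * (starRingEnd ℂ) δ)).re) v := by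
    have d1 : HasDerivAt p δ v := by
      simpa [hp] using ((Complex.ofRealCLM.hasDerivAt (x := v)).mul_const δ).const_add s
    have d2 := ((hasDerivAt_saddleMap hx hn (hp1 v hv) (hp2 v hv)).comp v d1).mul_const
      (Complex.I * (starRingEnd ℂ) δ)
    exact (Complex.reCLM.hasFDerivAt.comp_hasDerivAt v d2)
  have hpos (v : ℝ) (hv : v ∈ Set.Icc (0 : ℝ) 1) : 0 <
      (((p v)⁻¹ - Complex.I / (scale x n + Complex.I * p v) - Complex.I) * δ
        * (Complex.I * (starRingEnd ℂ) δ)).re := by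
    have e1 : ((p v)⁻¹ - Complex.I / (scale x n + Complex.I * p v) - Complex.I) * δ
        * (Complex.I * (starRingEnd ℂ) δ)
        = (Complex.normSq δ : ℝ) *
          (Complex.I * (p v)⁻¹ + (scale x n + Complex.I * p v)⁻¹ + 1) := by
      rw [Complex.normSq_eq_conj_mul_self, div_eq_mul_inv]
      linear_combination (-(δ * (starRingEnd ℂ) δ)
        * ((scale x n + Complex.I * p v)⁻¹ + 1)) * Complex.I_sq
    rw [e1, Complex.re_ofReal_mul]
    refine mul_pos (Complex.normSq_pos.mpr hδ0) ?_
    have e2 : (Complex.I * (p v)⁻¹).re = (p v).im / Complex.normSq (p v) := by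
      simp [Complex.inv_im]; ring
    have e3 : ((scale x n : ℂ) + Complex.I * p v).re = scale x n - (p v).im := by
      simp; ring
    rw [Complex.add_re, Complex.add_re, e2, Complex.inv_re, e3, Complex.one_re]
    have := div_nonneg (hp1 v hv).le (Complex.normSq_nonneg (p v))
    have := div_nonneg (sub_nonneg.mpr (hp2 v hv).le)
      (Complex.normSq_nonneg (scale x n + Complex.I * p v))
    linarith
  have hmono : StrictMonoOn f (Set.Icc 0 1) := by
    refine strictMonoOn_of_deriv_pos (convex_Icc 0 1)
      (fun v hv => (hderiv v hv).continuousAt.continuousWithinAt) fun v hv => ?_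
    rw [interior_Icc] at hv
    rw [(hderiv v ⟨hv.1.le, hv.2.le⟩).deriv]
    exact hpos v ⟨hv.1.le, hv.2.le⟩
  have h01 := hmono (Set.left_mem_Icc.mpr zero_le_one) (Set.right_mem_Icc.mpr zero_le_one)
    zero_lt_one
  have ep0 : p 0 = s := by simp [hp]
  have ep1 : p 1 = t := by simp [hp, hδ]
  simp only [hf, ep0, ep1, h] at h01
  exact lt_irrefl _ h01

lemma isSaddleShift_unique (hn : 2 ≤ n) {k : ℕ} {σ σ' : ℂ} (h : IsSaddleShift x n k σ)
    (h' : IsSaddleShift x n k σ') : σ = σ' := by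
  obtain ⟨h1, h2, -, h3⟩ := (isSaddleShift_iff hx hn).mp h
  obtain ⟨h1', h2', -, h3'⟩ := (isSaddleShift_iff hx hn).mp h'
  have := saddleMap_injOn hx (by omega) h1 h2 h1' h2' (h3.trans h3'.symm)
  exact add_right_cancel this

lemma isSaddleShift_of_saddleMap_eq (hn : 2 ≤ n) {k : ℕ} {s : ℂ} (h1 : 0 < s.im)
    (h2 : s.im < scale x n) (h : saddleMap x n s =
      Complex.log (Complex.I * n * (2 * x * Real.log x : ℝ)) - 2 * Real.pi * k * Complex.I) :
    IsSaddleShift x n k (s - 2 * Real.pi * k) := by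
  have e : shift k (s - 2 * Real.pi * k) = s := by rw [shift]; ring
  rw [isSaddleShift_iff hx hn, e]
  exact ⟨h1, h2, lam_mul_eq_of_saddleMap_eq hx hn h1 h2 h, h⟩

lemma log_saddle_constant (hn : 1 ≤ n) :
    Complex.log (Complex.I * n * (2 * x * Real.log x : ℝ))
      = Real.log (x * scale x n) + Real.pi / 2 * Complex.I := by
  have hM := scale_pos hx hn
  rw [show Complex.I * n * (2 * x * Real.log x : ℝ)
    = ((x * scale x n : ℝ) : ℂ) * Complex.I by rw [scale]; push_cast; ring,
    Complex.log_ofReal_mul (by positivity) Complex.I_ne_zero, Complex.log_I]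

omit hx in
lemma isPosRoot_iff (hx0 : 0 < x) {t : ℝ} :
    IsPosRoot (x ^ 2) n t ↔ 0 < t ∧ t * (Real.exp t + x) = x * scale x n := by
  rw [IsPosRoot, Real.sqrt_sq hx0.le, Real.log_pow, scale]
  push_cast
  rw [show (n : ℝ) * x * (2 * Real.log x) = x * (2 * n * Real.log x) by ring]

lemma existsUnique_isPosRoot (hn : 1 ≤ n) : ∃! t : ℝ, IsPosRoot (x ^ 2) n t := by
  have hx0 : 0 < x := by linarith
  have hM := scale_pos hx hn
  simp_rw [isPosRoot_iff hx0]
  set f : ℝ → ℝ := fun t => t * (Real.exp t + x) with hf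
  have hmono : ∀ t u : ℝ, 0 < t → t < u → f t < f u := by
    intro t u ht htu
    simp only [hf]
    have : Real.exp t < Real.exp u := Real.exp_lt_exp.mpr htu
    have h0 := Real.exp_pos t
    nlinarith
  have hc : ContinuousOn f (Set.Icc 0 (x * scale x n)) := by
    simp only [hf]; fun_prop
  have hv : x * scale x n ∈ Set.Icc (f 0) (f (x * scale x n)) := by
    simp only [hf, zero_mul]
    refine ⟨by positivity, le_mul_of_one_le_right (by positivity) ?_⟩
    have := Real.exp_pos (x * scale x n)
    linarith
  obtain ⟨t, ht, hft⟩ := intermediate_value_Icc (by positivity) hc hv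
  have ht0 : 0 < t := by
    rcases eq_or_lt_of_le ht.1 with h0 | h0
    · rw [← h0] at hft
      simp only [hf, zero_mul] at hft
      have : 0 < x * scale x n := by positivity
      linarith
    · exact h0
  refine ⟨t, ⟨ht0, hft⟩, fun u ⟨hu0, hu⟩ => ?_⟩
  rcases lt_trichotomy u t with h | h | h
  · have := hmono u t hu0 h
    simp only [hf] at this hft; linarith
  · exact h
  · have := hmono t u ht0 h
    simp only [hf] at this hft; linarith

lemma root_lt_scale {t : ℝ} (ht : IsPosRoot (x ^ 2) n t) : t < scale x n := by
  have hx0 : 0 < x := by linarith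
  obtain ⟨h1, h2⟩ := (isPosRoot_iff hx0).mp ht
  have := mul_pos h1 (Real.exp_pos t)
  have h3 : x * t < x * scale x n := by nlinarith
  exact lt_of_mul_lt_mul_left h3 hx0.le

lemma isSaddleShift_zero (hn : 2 ≤ n) {t : ℝ} (ht : IsPosRoot (x ^ 2) n t) :
    IsSaddleShift x n 0 (Complex.I * t) := by
  have hx0 : 0 < x := by linarith
  have hM := scale_pos hx (n := n) (by omega)
  have htM := root_lt_scale hx ht
  obtain ⟨h1, h2⟩ := (isPosRoot_iff hx0).mp ht
  have key := isSaddleShift_of_saddleMap_eq hx hn (k := 0) (s := Complex.I * t)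
    (by simpa using h1) (by simpa using htM) ?_
  · simpa using key
  rw [log_saddle_constant hx (by omega), saddleMap]
  have e1 : 1 + Complex.I * (Complex.I * t) / scale x n = ((1 - t / scale x n : ℝ) : ℂ) := by
    push_cast
    linear_combination (t / scale x n : ℂ) * Complex.I_sq
  have e2 : 0 < 1 - t / scale x n := by
    have := (div_lt_one hM).mpr htM
    linarith
  rw [e1, mul_comm Complex.I (t : ℂ), Complex.log_ofReal_mul h1 Complex.I_ne_zero, Complex.log_I,
    ← Complex.ofReal_log e2.le]
  have e3 : Real.log (x * scale x n) = Real.log t - Real.log (1 - t / scale x n) + t := by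
    have h3 : x * scale x n = t / (1 - t / scale x n) * Real.exp t := by
      have : scale x n - t ≠ 0 := by linarith
      rw [show 1 - t / scale x n = (scale x n - t) / scale x n by field_simp]
      field_simp
      linear_combination -h2
    rw [h3, Real.log_mul (by positivity) (Real.exp_pos t).ne', Real.log_div h1.ne' e2.ne',
      Real.log_exp]
  rw [e3]
  push_cast
  linear_combination (-(t : ℂ)) * Complex.I_sq

end

/-! ### Existence and location of the saddle points -/

lemma abs_arg_le_of_re_pos {z : ℂ} (hz : 0 < z.re) : |z.arg| ≤ |z.im| / z.re := by
  have h1 : |z.arg| < Real.pi / 2 := Complex.abs_arg_lt_pi_div_two_iff.mpr (Or.inl hz)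
  refine (Real.le_tan (abs_nonneg _) h1).trans (le_of_eq ?_)
  rw [show |z.im| / z.re = |z.im / z.re| by rw [abs_div, abs_of_pos hz], ← Complex.tan_arg]
  have h2 := abs_lt.mp h1
  rcases le_total 0 z.arg with h | h
  · rw [abs_of_nonneg h, abs_of_nonneg (Real.tan_nonneg_of_nonneg_of_le_pi_div_two h h2.2.le)]
  · rw [abs_of_nonpos h, Real.tan_neg,
      abs_of_nonpos (Real.tan_nonpos_of_nonpos_of_neg_pi_div_two_le h h2.1.le)]

lemma pi_div_two_sub_arg_le {z : ℂ} (hre : 0 < z.re) (him : 0 < z.im) :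
    Real.pi / 2 - z.arg ≤ z.re / z.im := by
  have h1 := abs_lt.mp (Complex.abs_arg_lt_pi_div_two_iff.mpr (Or.inl hre))
  have h0 : 0 < z.arg := by
    rcases eq_or_lt_of_le (Complex.arg_nonneg_iff.mpr him.le) with h | h
    · exact absurd (Complex.arg_eq_zero_iff.mp h.symm).2 him.ne'
    · exact h
  have h2 := Real.le_tan (x := Real.pi / 2 - z.arg) (by linarith) (by linarith)
  rwa [Real.tan_pi_div_two_sub, Complex.tan_arg, inv_div] at h2

lemma scale_add_re (x : ℝ) (n : ℕ) (s : ℂ) :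
    ((scale x n : ℂ) + Complex.I * s).re = scale x n - s.im := by
  simp; ring

lemma norm_scale_add_ge (x : ℝ) (n : ℕ) (s : ℂ) :
    scale x n - s.im ≤ ‖(scale x n : ℂ) + Complex.I * s‖ := by
  rw [← scale_add_re]; exact Complex.re_le_norm _

lemma norm_sq_scale_add (x : ℝ) (n : ℕ) (s : ℂ) :
    ‖(scale x n : ℂ) + Complex.I * s‖ ^ 2
      = scale x n * (scale x n - 2 * s.im) + ‖s‖ ^ 2 := by
  rw [← Complex.normSq_eq_norm_sq, ← Complex.normSq_eq_norm_sq, Complex.normSq_apply,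
    Complex.normSq_apply]
  simp
  ring

lemma norm_le_norm_scale_add {x : ℝ} {n : ℕ} {s : ℂ} (hM : 0 < scale x n)
    (h : 2 * s.im ≤ scale x n) : ‖s‖ ≤ ‖(scale x n : ℂ) + Complex.I * s‖ := by
  refine le_of_sq_le_sq ?_ (norm_nonneg _)
  rw [norm_sq_scale_add]
  have := mul_nonneg hM.le (sub_nonneg.mpr h)
  linarith

lemma norm_scale_add_le {x : ℝ} {n : ℕ} {s : ℂ} (hM : 0 < scale x n) :
    ‖(scale x n : ℂ) + Complex.I * s‖ ≤ scale x n + ‖s‖ := by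
  refine (norm_add_le _ _).trans ?_
  rw [norm_mul, Complex.norm_I, one_mul, Complex.norm_real, Real.norm_of_nonneg hM.le]

section

variable {x : ℝ} (hx : 1 < x) {n : ℕ}

include hx

lemma log_one_add_re (hn : 1 ≤ n) (s : ℂ) :
    (Complex.log s - Complex.log (1 + Complex.I * s / scale x n)).re
      = Real.log ‖s‖ - Real.log (‖(scale x n : ℂ) + Complex.I * s‖ / scale x n) := by
  have hM := scale_pos hx hn
  have hMc : (scale x n : ℂ) ≠ 0 := by exact_mod_cast hM.ne'
  rw [Complex.sub_re, Complex.log_re, Complex.log_re,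
    show 1 + Complex.I * s / scale x n = (scale x n + Complex.I * s) / scale x n by field_simp,
    norm_div, Complex.norm_real, Real.norm_of_nonneg hM.le]

/-- For `k ≥ 1` the equation for the saddle is a fixed-point equation for a contraction. -/
lemma exists_isSaddleShift_of_pos (hn : 2 ≤ n) (hL : 10 * Real.log x ≤ scale x n)
    (hlog : Real.log (x * (scale x n / Real.pi + 1)) ≤ scale x n / 10) {k : ℕ} (hk : 1 ≤ k) :
    ∃ σ : ℂ, IsSaddleShift x n k σ := by
  have hx0 : 0 < x := by linarith
  have hM := scale_pos hx (n := n) (by omega)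
  have hL0 := Real.log_pos hx
  have hpi := Real.pi_pos
  have hpi3 := Real.pi_gt_three
  set M := scale x n with hMdef
  have hMc : (M : ℂ) ≠ 0 := by exact_mod_cast hM.ne'
  have hk1 : (1 : ℝ) ≤ k := by exact_mod_cast hk
  set R : Set ℂ := {s | 2 * Real.pi * k - Real.pi ≤ s.re} ∩
    ({s | Real.log x ≤ s.im} ∩ {s | s.im ≤ M / 10}) with hR
  have hRre : ∀ s ∈ R, Real.pi ≤ s.re := fun s hs => by
    have : 2 * Real.pi * k - Real.pi ≤ s.re := hs.1
    nlinarith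
  have hRn : ∀ s ∈ R, Real.pi ≤ ‖s‖ := fun s hs => (hRre s hs).trans (Complex.re_le_norm s)
  have hconv : Convex ℝ R :=
    (convex_halfSpace_re_ge _).inter ((convex_halfSpace_im_ge _).inter (convex_halfSpace_im_le _))
  have hclosed : IsClosed R :=
    (isClosed_le continuous_const Complex.continuous_re).inter
      ((isClosed_le continuous_const Complex.continuous_im).inter
        (isClosed_le Complex.continuous_im continuous_const))
  set c := Complex.log (Complex.I * n * (2 * x * Real.log x : ℝ)) - 2 * Real.pi * k * Complex.I
    with hc
  have hcre : c.re = Real.log (x * M) := by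
    rw [hc, log_saddle_constant hx (by omega)]; simp [hMdef]
  have hcim : c.im = Real.pi / 2 - 2 * Real.pi * k := by
    rw [hc, log_saddle_constant hx (by omega)]; simp
  set Φ : ℂ → ℂ := fun s => Complex.I * (c - (saddleMap x n s + Complex.I * s)) with hΦ
  have hΦ' (s : ℂ) : Φ s = Complex.I *
      (c - (Complex.log s - Complex.log (1 + Complex.I * s / M))) := by
    simp only [hΦ, saddleMap, ← hMdef, sub_add_cancel]
  have hmaps : Set.MapsTo Φ R R := by
    rintro s hs
    have hs1 := hRre s hs
    have hs2 : Real.log x ≤ s.im := hs.2.1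
    have hs3 : s.im ≤ M / 10 := hs.2.2
    have hsn := hRn s hs
    have hs0 : 0 < ‖s‖ := by linarith
    have hre : (Φ s).re = -(c.im - (s.arg - (1 + Complex.I * s / M).arg)) := by
      rw [hΦ']; simp [Complex.log_im]
    have him : (Φ s).im = Real.log (x * ‖(M : ℂ) + Complex.I * s‖ / ‖s‖) := by
      have e : (Φ s).im = c.re - (Complex.log s - Complex.log (1 + Complex.I * s / M)).re := by
        rw [hΦ']; simp
      have hA : 0 < ‖(M : ℂ) + Complex.I * s‖ := by
        have := norm_scale_add_ge x n s
        linarith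
      rw [e, hcre, log_one_add_re hx (by omega), ← hMdef,
        Real.log_mul hx0.ne' hM.ne', Real.log_div hA.ne' hM.ne',
        Real.log_div (by positivity) hs0.ne', Real.log_mul hx0.ne' hA.ne']
      ring
    refine ⟨?_, ?_, ?_⟩
    · change _ ≤ (Φ s).re
      rw [hre, hcim]
      have h1 : 0 ≤ s.arg := Complex.arg_nonneg_iff.mpr (by linarith)
      have h2 := (abs_le.mp (Complex.abs_arg_le_pi_div_two_iff.mpr
        (re_one_add_pos hM (s := s) (by linarith)).le)).2
      rw [← hMdef] at h2
      linarith
    · change _ ≤ (Φ s).im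
      rw [him]
      refine Real.log_le_log hx0 ?_
      rw [le_div_iff₀ hs0]
      exact mul_le_mul_of_nonneg_left (norm_le_norm_scale_add hM (by linarith)) hx0.le
    · change (Φ s).im ≤ _
      rw [him]
      refine le_trans (Real.log_le_log ?_ ?_) hlog
      · have : 0 < ‖(M : ℂ) + Complex.I * s‖ := by
          have := norm_scale_add_ge x n s
          linarith
        positivity
      · rw [mul_div_assoc]
        refine mul_le_mul_of_nonneg_left ?_ hx0.le
        rw [div_le_iff₀ hs0, add_mul, one_mul]
        refine (norm_scale_add_le hM).trans (add_le_add ?_ le_rfl)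
        rw [div_mul_eq_mul_div, le_div_iff₀ hpi]
        gcongr
  have hderiv (s : ℂ) (hs : s ∈ R) : HasDerivWithinAt Φ
      (Complex.I * (-(s⁻¹ - Complex.I / (M + Complex.I * s)))) R s := by
    have hs2 : Real.log x ≤ s.im := hs.2.1
    have hs3 : s.im ≤ M / 10 := hs.2.2
    have d1 := hasDerivAt_saddleMap hx (n := n) (by omega) (s := s) (by linarith) (by linarith)
    have d2 : HasDerivAt (fun z : ℂ => Complex.I * z) Complex.I s := by
      simpa using (hasDerivAt_id s).const_mul Complex.I
    have d3 := ((d1.add d2).const_sub c).const_mul Complex.I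
    refine (d3.congr_deriv ?_).hasDerivWithinAt
    ring
  have hbound (s : ℂ) (hs : s ∈ R) :
      ‖Complex.I * (-(s⁻¹ - Complex.I / (M + Complex.I * s)))‖₊ ≤ (1 / 2 : NNReal) := by
    have hs3 : s.im ≤ M / 10 := hs.2.2
    have hsn := hRn s hs
    have hs0 : s ≠ 0 := norm_pos_iff.mp (by linarith)
    have hA := norm_scale_add_ge x n s
    have hA0 : (M : ℂ) + Complex.I * s ≠ 0 := norm_pos_iff.mp (by linarith)
    rw [← NNReal.coe_le_coe, coe_nnnorm]
    have e : s⁻¹ - Complex.I / (M + Complex.I * s) = M / (s * (M + Complex.I * s)) := by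
      rw [inv_eq_one_div, div_sub_div _ _ hs0 hA0]
      congr 1; ring
    rw [e, norm_mul, Complex.norm_I, one_mul, norm_neg, norm_div, norm_mul, Complex.norm_real,
      Real.norm_of_nonneg hM.le]
    have h1 : 2 * M ≤ ‖s‖ * ‖(M : ℂ) + Complex.I * s‖ := by
      calc 2 * M ≤ 3 * (M - M / 10) := by linarith
        _ ≤ _ := by gcongr <;> linarith
    rw [div_le_iff₀ (by linarith)]
    push_cast
    linarith
  have hlip := hconv.lipschitzOnWith_of_nnnorm_hasDerivWithin_le hderiv hbound
  have hcontr : ContractingWith (1 / 2 : NNReal) (hmaps.restrict Φ R R) :=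
    ⟨by rw [← NNReal.coe_lt_coe]; norm_num, hlip.mapsToRestrict hmaps⟩
  have hmem : (⟨2 * Real.pi * k, Real.log x⟩ : ℂ) ∈ R :=
    ⟨by change _ ≤ 2 * Real.pi * k; linarith, le_refl (Real.log x),
      by change Real.log x ≤ M / 10; linarith⟩
  obtain ⟨s, hsR, hfix, -⟩ := hcontr.exists_fixedPoint' hclosed.isComplete hmaps hmem
    (edist_ne_top _ _)
  have hs2 : Real.log x ≤ s.im := hsR.2.1
  have hs3 : s.im ≤ M / 10 := hsR.2.2
  have hfix' : Φ s = s := hfix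
  refine ⟨_, isSaddleShift_of_saddleMap_eq hx hn (k := k) (s := s) (by linarith) (by linarith) ?_⟩
  rw [← hc]
  simp only [hΦ] at hfix'
  linear_combination Complex.I * hfix' + (saddleMap x n s + Complex.I * s - c) * Complex.I_sq

variable {k : ℕ} {σ : ℂ}

lemma im_bounds (hn : 2 ≤ n) (h : IsSaddleShift x n k σ) :
    Real.log x < (shift k σ).im ∧ 2 * (shift k σ).im < scale x n := by
  obtain ⟨h1, h2⟩ := lam_mul_eq_of_isSaddleShift hx (by omega) h
  exact im_bounds_of_lam_mul_eq hx hn h1 h2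

lemma norm_mul_exp_im (hn : 2 ≤ n) (h : IsSaddleShift x n k σ) :
    ‖shift k σ‖ * Real.exp (shift k σ).im
      = x * ‖(scale x n : ℂ) + Complex.I * shift k σ‖ := by
  have h1 := congrArg norm (lam_mul_eq_of_isSaddleShift hx (by omega) h).2
  rw [norm_mul, norm_mul, norm_neg, Complex.norm_I, one_mul, norm_lam (by linarith),
    Real.exp_neg] at h1
  rw [← h1]
  field_simp

lemma re_eq (hn : 2 ≤ n) (h : IsSaddleShift x n k σ) :
    (shift k σ).re = 2 * Real.pi * k - Real.pi / 2 + (shift k σ).arg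
      - (1 + Complex.I * shift k σ / scale x n).arg := by
  obtain ⟨-, -, -, h1⟩ := (isSaddleShift_iff hx hn).mp h
  rw [log_saddle_constant hx (by omega), saddleMap] at h1
  have h2 := congrArg Complex.im h1
  simp [Complex.log_im] at h2
  linarith

lemma re_bounds (hn : 2 ≤ n) (hk : 1 ≤ k) (h : IsSaddleShift x n k σ) :
    2 * Real.pi * k - Real.pi ≤ (shift k σ).re ∧ (shift k σ).re ≤ 2 * Real.pi * k ∧
      2 * Real.pi * k - (shift k σ).re ≤ 2 * ((shift k σ).re / (shift k σ).im) := by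
  have hM := scale_pos hx (n := n) (by omega)
  have hL0 := Real.log_pos hx
  have hpi := Real.pi_pos
  have hk1 : (1 : ℝ) ≤ k := by exact_mod_cast hk
  obtain ⟨h1, h2⟩ := im_bounds hx hn h
  have h3 := re_eq hx hn h
  set s := shift k σ
  have h4 : 0 < (1 + Complex.I * s / scale x n).re := re_one_add_pos hM (by linarith)
  have h5 := abs_le.mp (Complex.abs_arg_le_pi_div_two_iff.mpr h4.le)
  have h6 : 0 ≤ s.arg := Complex.arg_nonneg_iff.mpr (by linarith)
  have h7 : 2 * Real.pi * k - Real.pi ≤ s.re := by linarith [h5.2]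
  have h8 : 0 < s.re := by nlinarith
  have h9 := abs_le.mp (Complex.abs_arg_le_pi_div_two_iff.mpr h8.le)
  have e1 : (1 + Complex.I * s / scale x n).im = s.re / scale x n := by
    rw [Complex.add_im, Complex.div_ofReal_im]; simp
  have e2 : (1 + Complex.I * s / scale x n).re = (scale x n - s.im) / scale x n := by
    rw [Complex.add_re, Complex.div_ofReal_re]
    simp; field_simp; ring
  have h10 : 0 ≤ (1 + Complex.I * s / scale x n).arg := by
    rw [Complex.arg_nonneg_iff, e1]; positivity
  refine ⟨h7, by linarith [h9.2], ?_⟩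
  have h11 := pi_div_two_sub_arg_le h8 (show 0 < s.im by linarith)
  have h12 := (le_abs_self _).trans (abs_arg_le_of_re_pos h4)
  rw [e1, e2, abs_of_pos (by positivity), div_div_div_cancel_right₀ hM.ne'] at h12
  have h13 : s.re / (scale x n - s.im) ≤ s.re / s.im := by
    gcongr <;> linarith
  linarith

/-- The imaginary part of every `s_k` is at most that of `s_0`. -/
lemma im_le_root (hn : 2 ≤ n) (h : IsSaddleShift x n k σ) {t : ℝ}
    (ht : IsPosRoot (x ^ 2) n t) : (shift k σ).im ≤ t := by
  have hx0 : 0 < x := by linarith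
  have hM := scale_pos hx (n := n) (by omega)
  have hL0 := Real.log_pos hx
  obtain ⟨h1, h2⟩ := im_bounds hx hn h
  obtain ⟨ht0, ht1⟩ := (isPosRoot_iff hx0).mp ht
  have h3 := norm_mul_exp_im hx hn h
  set s := shift k σ
  set η := s.im
  set M := scale x n
  have hη : 0 < η := by linarith
  have hn1 : η ≤ ‖s‖ := Complex.im_le_norm s
  have h4 := congrArg (· ^ 2) h3
  simp only [mul_pow] at h4
  rw [norm_sq_scale_add] at h4
  have h5 : (η * Real.exp η) ^ 2 ≤ (x * (M - η)) ^ 2 := by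
    have hs : 0 < ‖s‖ ^ 2 := pow_pos (hη.trans_le hn1) 2
    have e : ‖s‖ ^ 2 * ((Real.exp η) ^ 2 - x ^ 2) = x ^ 2 * (M * (M - 2 * η)) := by
      linear_combination h4
    have h6 : 0 ≤ x ^ 2 * (M * (M - 2 * η)) := by
      have : 0 ≤ M - 2 * η := by linarith
      positivity
    have h7 : 0 ≤ (Real.exp η) ^ 2 - x ^ 2 := by
      rw [← e] at h6
      exact nonneg_of_mul_nonneg_right h6 hs
    have h8 : η ^ 2 * ((Real.exp η) ^ 2 - x ^ 2) ≤ x ^ 2 * (M * (M - 2 * η)) := by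
      rw [← e]; gcongr
    nlinarith
  have h6 : η * Real.exp η ≤ x * (M - η) :=
    le_of_sq_le_sq h5 (mul_nonneg hx0.le (by linarith))
  by_contra hcon
  push Not at hcon
  have h7 : Real.exp t < Real.exp η := Real.exp_lt_exp.mpr hcon
  nlinarith [Real.exp_pos t]

lemma lam_eq_div (hn : 2 ≤ n) (h : IsSaddleShift x n k σ) : lam x (shift k σ)
    = -Complex.I * shift k σ / (scale x n + Complex.I * shift k σ) := by
  have hM := scale_pos hx (n := n) (by omega)
  have hL0 := Real.log_pos hx
  obtain ⟨h1, h2⟩ := im_bounds hx hn h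
  rw [eq_div_iff (scale_add_ne_zero (by linarith))]
  exact (lam_mul_eq_of_isSaddleShift hx (by omega) h).2

lemma one_add_lam_eq_div (hn : 2 ≤ n) (h : IsSaddleShift x n k σ) : 1 + lam x (shift k σ)
    = scale x n / (scale x n + Complex.I * shift k σ) := by
  have hM := scale_pos hx (n := n) (by omega)
  have hL0 := Real.log_pos hx
  obtain ⟨h1, h2⟩ := im_bounds hx hn h
  have := scale_add_ne_zero (x := x) (n := n) (s := shift k σ) (by linarith)
  rw [lam_eq_div hx hn h]
  field_simp
  ring

lemma omega_eq (hn : 2 ≤ n) (h : IsSaddleShift x n k σ) : omega x n (shift k σ)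
    = -Complex.I * shift k σ * (1 + Complex.I * shift k σ / scale x n) := by
  have hM := scale_pos hx (n := n) (by omega)
  have hMc : (scale x n : ℂ) ≠ 0 := by exact_mod_cast hM.ne'
  have hL0 := Real.log_pos hx
  obtain ⟨h1, h2⟩ := im_bounds hx hn h
  have := scale_add_ne_zero (x := x) (n := n) (s := shift k σ) (by linarith)
  have e : 2 * n * lam x (shift k σ) * (Real.log x : ℂ) = scale x n * lam x (shift k σ) := by
    rw [scale]; push_cast; ring
  rw [omega, e, one_add_lam_eq_div hx hn h, lam_eq_div hx hn h]
  field_simp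

lemma omega_re_ge (hn : 2 ≤ n) (h : IsSaddleShift x n k σ) :
    (shift k σ).im * (1 - (shift k σ).im / scale x n) ≤ (omega x n (shift k σ)).re := by
  have hM := scale_pos hx (n := n) (by omega)
  rw [omega_eq hx hn h]
  set s := shift k σ
  have e : (-Complex.I * s * (1 + Complex.I * s / scale x n)).re
      = s.im * (1 - s.im / scale x n) + s.re ^ 2 / scale x n := by
    rw [show -Complex.I * s * (1 + Complex.I * s / scale x n)
      = -Complex.I * s + (s * s) / scale x n by
        linear_combination (-(s * s) / scale x n) * Complex.I_sq,
      Complex.add_re, Complex.div_ofReal_re]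
    simp
    ring
  rw [e]
  have : 0 ≤ s.re ^ 2 / scale x n := by positivity
  linarith

lemma omega_re_ge_half (hn : 2 ≤ n) (h : IsSaddleShift x n k σ) :
    (shift k σ).im / 2 ≤ (omega x n (shift k σ)).re := by
  have hM := scale_pos hx (n := n) (by omega)
  have hL0 := Real.log_pos hx
  obtain ⟨h1, h2⟩ := im_bounds hx hn h
  refine le_trans ?_ (omega_re_ge hx hn h)
  have : (shift k σ).im / scale x n ≤ 1 / 2 := by
    rw [div_le_iff₀ hM]; linarith
  nlinarith

omit hx in
lemma aCoef_eq (x : ℝ) (n : ℕ) (s : ℂ) : aCoef x n s = 1 / (2 * omega x n s) := by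
  rw [aCoef, omega]
  rw [one_div, mul_div_assoc', inv_div]
  congr 1
  ring

end

/-! ### The contributions of the saddles in terms of the integrand -/

/-- The integrand `e^{-s²/(4 log x)} (1 + x e^{is})^n = e^{-nψ(s)}`. -/
def integrand (x : ℝ) (n : ℕ) (s : ℂ) : ℂ :=
  Complex.exp (-s ^ 2 / (4 * Real.log x)) * (1 + lam x s) ^ n

lemma coeff_eq (x : ℝ) (n : ℕ) (s : ℂ) (j : ℕ) :
    coeff x n s j = reducedCoeff (aCoef x n s) (lam x s) j * chi x n s ^ j := by
  match j with
  | 0 => simp [coeff, reducedCoeff]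
  | 1 => simp only [coeff, reducedCoeff]; ring
  | 2 => simp only [coeff, reducedCoeff]; ring
  | 3 => simp only [coeff, reducedCoeff]; ring
  | j + 4 => simp [coeff, reducedCoeff]

lemma saddleSeries_sum_eq {x : ℝ} {n : ℕ} (hn : 2 ≤ n) (s : ℂ) (N : ℕ) :
    ∑ j ∈ Finset.range (N + 1),
      (ascPochhammer ℂ j).eval (1 / 2 : ℂ) * coeff x n s j / (Real.log n : ℂ) ^ j
      = truncSeries N (aCoef x n s) (lam x s) (1 / (n * lam x s)) := by
  have hl : Real.log n ≠ 0 :=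
    (Real.log_pos (by exact_mod_cast (by omega : 1 < n))).ne'
  have hlc : (Real.log n : ℂ) ≠ 0 := by exact_mod_cast hl
  refine Finset.sum_congr rfl fun j _ => ?_
  rw [coeff_eq, chi, div_pow, div_pow, one_pow]
  field_simp

section

variable {x : ℝ} (hx : 1 < x) {n : ℕ}

include hx

variable {k : ℕ} {σ : ℂ}

lemma one_add_lam_ne_zero (h : IsSaddleShift x n k σ) :
    1 + lam x (shift k σ) ≠ 0 :=
  one_add_lam_ne_zero_of_isSaddle hx h.1

lemma weight_mul_exp (hn : 2 ≤ n) (h : IsSaddleShift x n k σ) :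
    Complex.exp (-((Real.pi : ℂ) ^ 2 * k ^ 2 + Real.pi * k * σ) / (Real.log x : ℂ))
      * Complex.exp (-(n * psi x n σ)) = integrand x n (shift k σ) := by
  have hL : (Real.log x : ℂ) ≠ 0 := by exact_mod_cast (Real.log_pos hx).ne'
  have hn0 : (n : ℂ) ≠ 0 := by exact_mod_cast (by omega : n ≠ 0)
  have h1 := one_add_lam_ne_zero hx h
  have e : (1 + x * Complex.exp (Complex.I * σ) : ℂ) = 1 + lam x (shift k σ) := by
    rw [lam_shift, lam]
  rw [psi, e, integrand]
  conv_rhs => rw [← Complex.exp_log h1, ← Complex.exp_nat_mul]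
  rw [← Complex.exp_add, ← Complex.exp_add]
  congr 1
  rw [shift]
  field_simp
  ring

lemma contribution_eq (hn : 2 ≤ n) (h : IsSaddleShift x n k σ) (N : ℕ) :
    contribution N x n k σ = integrand x n (shift k σ)
      / (1 + omega x n (shift k σ)) ^ (1 / 2 : ℂ)
      * truncSeries N (aCoef x n (shift k σ)) (lam x (shift k σ))
          (1 / (n * lam x (shift k σ))) := by
  rw [contribution, saddleSeries, prefactor, saddleSeries_sum_eq hn, ← weight_mul_exp hx hn h]
  ring

omit hx in
lemma saddleSeries_zero (x : ℝ) (n N : ℕ) (σ : ℂ) :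
    saddleSeries N x n 0 σ = contribution N x n 0 σ := by
  simp [contribution]

lemma prefactor_zero_eq (hn : 2 ≤ n) (h : IsSaddleShift x n 0 σ) : prefactor x n 0 σ =
    integrand x n (shift 0 σ) / (1 + omega x n (shift 0 σ)) ^ (1 / 2 : ℂ) := by
  rw [prefactor, ← weight_mul_exp hx hn h]
  simp

/-- The size of the integrand at the saddle `s_0 = i t`. -/
def peak (x : ℝ) (n : ℕ) (t : ℝ) : ℝ :=
  Real.exp (t ^ 2 / (4 * Real.log x)) * (1 + x * Real.exp (-t)) ^ n

lemma peak_pos (n : ℕ) (t : ℝ) : 0 < peak x n t := by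
  have : 0 < x := by linarith
  unfold peak; positivity

omit hx in
lemma lam_I_mul (x t : ℝ) : lam x (Complex.I * t) = ((x * Real.exp (-t) : ℝ) : ℂ) := by
  rw [lam, ← mul_assoc, Complex.I_mul_I]
  push_cast
  rw [neg_one_mul]

omit hx in
lemma integrand_I_mul (x : ℝ) (n : ℕ) (t : ℝ) : integrand x n (Complex.I * t) = peak x n t := by
  rw [integrand, lam_I_mul, peak, mul_pow, Complex.I_sq]
  push_cast
  congr 2
  ring

omit hx in
lemma norm_exp_gauss (x : ℝ) (s : ℂ) : ‖Complex.exp (-s ^ 2 / (4 * Real.log x))‖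
    = Real.exp (s.im ^ 2 / (4 * Real.log x)) * Real.exp (-(s.re ^ 2 / (4 * Real.log x))) := by
  rw [Complex.norm_exp, ← Real.exp_add]
  congr 1
  rw [show (4 * Real.log x : ℂ) = ((4 * Real.log x : ℝ) : ℂ) by push_cast; ring,
    Complex.div_ofReal_re]
  have : (-s ^ 2).re = s.im ^ 2 - s.re ^ 2 := by rw [sq s]; simp; ring
  rw [this]
  ring

lemma one_add_lam_root {t : ℝ} (ht : IsPosRoot (x ^ 2) n t) :
    1 + x * Real.exp (-t) = scale x n / (scale x n - t) := by
  have hx0 : 0 < x := by linarith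
  have h1 := root_lt_scale hx ht
  obtain ⟨h2, h3⟩ := (isPosRoot_iff hx0).mp ht
  have h4 : scale x n - t ≠ 0 := by linarith
  rw [eq_div_iff h4, Real.exp_neg]
  have := Real.exp_pos t
  field_simp
  linear_combination -h3

/-- At every saddle the integrand is bounded by its value at `s_0` times a Gaussian in `Re s_k`. -/
lemma norm_integrand_le (hn : 2 ≤ n) (h : IsSaddleShift x n k σ) {t : ℝ}
    (ht : IsPosRoot (x ^ 2) n t) : ‖integrand x n (shift k σ)‖
      ≤ Real.exp (-((shift k σ).re ^ 2 / (4 * Real.log x))) * peak x n t := by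
  have hx0 : 0 < x := by linarith
  have hM := scale_pos hx (n := n) (by omega)
  have hL0 := Real.log_pos hx
  obtain ⟨h1, h2⟩ := im_bounds hx hn h
  have h3 := im_le_root hx hn h ht
  have h4 := root_lt_scale hx ht
  rw [integrand, norm_mul, norm_exp_gauss, norm_pow, one_add_lam_eq_div hx hn h, norm_div,
    Complex.norm_real, Real.norm_of_nonneg hM.le, peak, one_add_lam_root hx ht]
  have h5 := norm_scale_add_ge x n (shift k σ)
  calc _ ≤ Real.exp (t ^ 2 / (4 * Real.log x))
        * Real.exp (-((shift k σ).re ^ 2 / (4 * Real.log x)))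
        * (scale x n / (scale x n - t)) ^ n := by
        have h6 : 0 < scale x n - t := by linarith
        have h7 : 0 < ‖(scale x n : ℂ) + Complex.I * shift k σ‖ := by linarith
        gcongr
        · linarith
        · linarith
    _ = _ := by ring

omit hx in
lemma norm_le_norm_one_add {z : ℂ} (hz : 0 ≤ z.re) : ‖z‖ ≤ ‖1 + z‖ := by
  rw [Complex.norm_def, Complex.norm_def]
  refine Real.sqrt_le_sqrt ?_
  rw [Complex.normSq_apply, Complex.normSq_apply]
  simp
  nlinarith

lemma omega_re_pos (hn : 2 ≤ n) (h : IsSaddleShift x n k σ) :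
    0 < (omega x n (shift k σ)).re := by
  have := omega_re_ge_half hx hn h
  have := im_bounds hx hn h
  linarith [Real.log_pos hx]

lemma norm_lam_le_one (hn : 2 ≤ n) (h : IsSaddleShift x n k σ) : ‖lam x (shift k σ)‖ ≤ 1 := by
  have hM := scale_pos hx (n := n) (by omega)
  obtain ⟨h1, h2⟩ := im_bounds hx hn h
  rw [lam_eq_div hx hn h, norm_div, norm_mul, norm_neg, Complex.norm_I, one_mul]
  exact div_le_one_of_le₀ (norm_le_norm_scale_add hM h2.le) (norm_nonneg _)

lemma norm_lam_le (hn : 2 ≤ n) (h : IsSaddleShift x n k σ) :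
    ‖lam x (shift k σ)‖ ≤ 2 * ‖shift k σ‖ / scale x n := by
  have hM := scale_pos hx (n := n) (by omega)
  obtain ⟨h1, h2⟩ := im_bounds hx hn h
  have h3 := norm_scale_add_ge x n (shift k σ)
  rw [lam_eq_div hx hn h, norm_div, norm_mul, norm_neg, Complex.norm_I, one_mul,
    div_le_div_iff₀ (by linarith) hM]
  have := norm_nonneg (shift k σ)
  nlinarith

lemma norm_aCoef_le (hn : 2 ≤ n) (h : IsSaddleShift x n k σ) :
    ‖aCoef x n (shift k σ)‖ ≤ 1 / Real.log x := by
  have hL0 := Real.log_pos hx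
  have h1 := omega_re_ge_half hx hn h
  have h2 := (im_bounds hx hn h).1
  have h3 := Complex.re_le_norm (omega x n (shift k σ))
  rw [aCoef_eq, norm_div, norm_one, norm_mul, Complex.norm_two]
  gcongr
  linarith

lemma one_le_norm_one_add_two_aCoef (hn : 2 ≤ n) (h : IsSaddleShift x n k σ) :
    1 ≤ ‖1 + 2 * aCoef x n (shift k σ)‖ := by
  have h1 := omega_re_pos hx hn h
  have h2 : omega x n (shift k σ) ≠ 0 := fun h0 => by rw [h0] at h1; simp at h1
  rw [aCoef_eq, show 1 + 2 * (1 / (2 * omega x n (shift k σ)))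
    = (1 + omega x n (shift k σ)) / omega x n (shift k σ) by field_simp; ring, norm_div,
    one_le_div (norm_pos_iff.mpr h2)]
  exact norm_le_norm_one_add h1.le

lemma norm_inv_nat_mul_lam_le (hn : 2 ≤ n) (h : IsSaddleShift x n k σ) :
    ‖1 / (n * lam x (shift k σ))‖ ≤ 2 * Real.log x / ‖shift k σ‖ + 1 / n := by
  have hM := scale_pos hx (n := n) (by omega)
  have hL0 := Real.log_pos hx
  have hn0 : (0 : ℝ) < n := by exact_mod_cast (by omega : 0 < n)
  obtain ⟨h1, h2⟩ := im_bounds hx hn h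
  have hs : 0 < ‖shift k σ‖ := by
    have := Complex.im_le_norm (shift k σ); linarith
  have h3 := norm_scale_add_ge x n (shift k σ)
  have h4 := norm_scale_add_le (s := shift k σ) hM
  rw [norm_div, norm_one, norm_mul, Complex.norm_natCast, lam_eq_div hx hn h, norm_div, norm_mul,
    norm_neg, Complex.norm_I, one_mul, mul_div_assoc', one_div_div]
  calc _ ≤ (scale x n + ‖shift k σ‖) / (n * ‖shift k σ‖) := by gcongr
    _ = _ := by rw [scale]; field_simp

lemma norm_inv_nat_mul_lam_le_three (hn : 2 ≤ n) (h : IsSaddleShift x n k σ) :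
    ‖1 / (n * lam x (shift k σ))‖ ≤ 3 := by
  have hL0 := Real.log_pos hx
  have hn1 : (1 : ℝ) ≤ n := by exact_mod_cast (by omega : 1 ≤ n)
  obtain ⟨h1, h2⟩ := im_bounds hx hn h
  refine (norm_inv_nat_mul_lam_le hx hn h).trans ?_
  have h5 : Real.log x ≤ ‖shift k σ‖ := by
    have := Complex.im_le_norm (shift k σ); linarith
  have h6 : 2 * Real.log x / ‖shift k σ‖ ≤ 2 := by
    rw [div_le_iff₀ (by linarith)]; linarith
  have h7 : 1 / (n : ℝ) ≤ 1 := by rw [div_le_one (by linarith)]; exact hn1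
  linarith

lemma one_le_norm_one_add_omega (hn : 2 ≤ n) (h : IsSaddleShift x n k σ) :
    1 ≤ ‖1 + omega x n (shift k σ)‖ := by
  refine le_trans ?_ (Complex.re_le_norm _)
  have := omega_re_pos hx hn h
  simp; linarith

omit hx in
/-- The coefficients are bounded as long as `a` and `λ` are and `1 + 2a` stays away from zero. -/
lemma exists_norm_reducedCoeff_le (A : ℝ) : ∃ C : ℝ, 0 < C ∧ ∀ a ξ : ℂ, ‖a‖ ≤ A → ‖ξ‖ ≤ 1 →
    1 ≤ ‖1 + 2 * a‖ → ∀ j, ‖reducedCoeff a ξ j‖ ≤ C := by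
  have hK := (isCompact_closedBall (0 : ℂ) A).prod (isCompact_closedBall (0 : ℂ) 1)
  obtain ⟨C₁, h₁⟩ := hK.exists_bound_of_continuousOn (f := fun p : ℂ × ℂ => Q1 p.1 p.2)
    (by simp only [Q1, P11, P12]; fun_prop)
  obtain ⟨C₂, h₂⟩ := hK.exists_bound_of_continuousOn (f := fun p : ℂ × ℂ => Q2 p.1 p.2)
    (by simp only [Q2, P21, P22, P23, P24]; fun_prop)
  obtain ⟨C₃, h₃⟩ := hK.exists_bound_of_continuousOn (f := fun p : ℂ × ℂ => Q3 p.1 p.2)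
    (by simp only [Q3, P31, P32, P33, P34, P35, P36]; fun_prop)
  refine ⟨|C₁| + |C₂| + |C₃| + 1, by positivity, fun a ξ ha hξ hd j => ?_⟩
  have hmem : (a, ξ) ∈ Metric.closedBall (0 : ℂ) A ×ˢ Metric.closedBall (0 : ℂ) 1 := by
    simpa using ⟨ha, hξ⟩
  have g₁ := h₁ _ hmem
  have g₂ := h₂ _ hmem
  have g₃ := h₃ _ hmem
  have a1 := abs_nonneg C₁
  have a2 := abs_nonneg C₂
  have a3 := abs_nonneg C₃
  have l1 := le_abs_self C₁
  have l2 := le_abs_self C₂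
  have l3 := le_abs_self C₃
  have key : ∀ (q : ℂ) (c : ℝ) (m : ℕ), 1 ≤ c → ‖q / ((c : ℂ) * (1 + 2 * a) ^ m)‖ ≤ ‖q‖ := by
    intro q c m hc
    rw [norm_div, norm_mul, norm_pow, Complex.norm_real, Real.norm_of_nonneg (by linarith)]
    refine div_le_self (norm_nonneg _) ?_
    have := one_le_pow₀ hd (n := m)
    nlinarith
  match j with
  | 0 => simp only [reducedCoeff, norm_one]; linarith
  | 1 =>
    have := key (-(Q1 a ξ)) 6 3 (by norm_num)
    rw [norm_neg] at this
    push_cast at this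
    simp only [reducedCoeff]
    linarith
  | 2 =>
    have := key (Q2 a ξ) 216 6 (by norm_num)
    push_cast at this
    simp only [reducedCoeff]
    linarith
  | 3 =>
    have := key (Q3 a ξ) 97200 9 (by norm_num)
    push_cast at this
    simp only [reducedCoeff]
    linarith
  | j + 4 => simp only [reducedCoeff, norm_zero]; linarith

omit hx in
lemma exists_norm_truncSeries_sub_le (A : ℝ) : ∃ C : ℝ, 0 < C ∧ ∀ a ξ w : ℂ, ‖a‖ ≤ A → ‖ξ‖ ≤ 1 →
    1 ≤ ‖1 + 2 * a‖ → ‖w‖ ≤ 3 → ∀ N N' : ℕ, N ≤ N' → N' ≤ 3 →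
      ‖truncSeries N' a ξ w - truncSeries N a ξ w‖ ≤ C * ‖w‖ ^ (N + 1) := by
  obtain ⟨C, hC, h⟩ := exists_norm_reducedCoeff_le A
  set D : ℝ := ∑ j ∈ Finset.range 4, ‖(ascPochhammer ℂ j).eval (1 / 2 : ℂ)‖ with hD
  have hD0 : 0 ≤ D := by positivity
  refine ⟨(D + 1) * C * 27, by positivity, fun a ξ w ha hξ hd hw N N' hN hN' => ?_⟩
  rw [truncSeries, truncSeries, ← Finset.sum_Ico_eq_sub _ (by omega)]
  have hterm : ∀ j ∈ Finset.Ico (N + 1) (N' + 1),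
      ‖(ascPochhammer ℂ j).eval (1 / 2 : ℂ) * reducedCoeff a ξ j * w ^ j‖
        ≤ ‖(ascPochhammer ℂ j).eval (1 / 2 : ℂ)‖ * (C * 27 * ‖w‖ ^ (N + 1)) := by
    intro j hj
    obtain ⟨hj1, hj2⟩ := Finset.mem_Ico.mp hj
    rw [norm_mul, norm_mul, norm_pow, mul_assoc]
    refine mul_le_mul_of_nonneg_left ?_ (norm_nonneg _)
    have e : ‖w‖ ^ j ≤ 27 * ‖w‖ ^ (N + 1) := by
      obtain ⟨i, rfl⟩ : ∃ i, j = i + (N + 1) := ⟨j - (N + 1), by omega⟩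
      rw [pow_add]
      refine mul_le_mul_of_nonneg_right ?_ (by positivity)
      calc ‖w‖ ^ i ≤ 3 ^ i := by gcongr
        _ ≤ 3 ^ 3 := pow_le_pow_right₀ (by norm_num) (by omega)
        _ = 27 := by norm_num
    calc _ ≤ C * (27 * ‖w‖ ^ (N + 1)) := by gcongr; exact h a ξ ha hξ hd j
      _ = _ := by ring
  refine (norm_sum_le_of_le _ hterm).trans ?_
  rw [← Finset.sum_mul]
  have hle : ∑ j ∈ Finset.Ico (N + 1) (N' + 1), ‖(ascPochhammer ℂ j).eval (1 / 2 : ℂ)‖ ≤ D := by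
    refine Finset.sum_le_sum_of_subset_of_nonneg (fun j hj => ?_) fun _ _ _ => norm_nonneg _
    rw [Finset.mem_Ico] at hj
    exact Finset.mem_range.mpr (by omega)
  calc _ ≤ (D + 1) * (C * 27 * ‖w‖ ^ (N + 1)) := by gcongr; linarith
    _ = _ := by ring

omit hx in
lemma truncSeries_zero (a ξ w : ℂ) : truncSeries 0 a ξ w = 1 := by
  simp [truncSeries, reducedCoeff]

/-- A bound for all saddles at once, which controls the tail of the series in `k`. -/
lemma exists_norm_contribution_le : ∃ C : ℝ, 0 < C ∧ ∀ n : ℕ, 2 ≤ n → ∀ (k : ℕ) (σ : ℂ) (t : ℝ),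
    IsSaddleShift x n k σ → IsPosRoot (x ^ 2) n t → ∀ N ≤ 3, ‖contribution N x n k σ‖
      ≤ C * Real.exp (-((shift k σ).re ^ 2 / (4 * Real.log x))) * peak x n t := by
  obtain ⟨C, hC, hb⟩ := exists_norm_truncSeries_sub_le (1 / Real.log x)
  refine ⟨3 * C + 1, by positivity, fun n hn k σ t h ht N hN => ?_⟩
  rw [contribution_eq hx hn h, norm_mul, norm_div, norm_cpow_half]
  have h1 := hb _ _ _ (norm_aCoef_le hx hn h) (norm_lam_le_one hx hn h)
    (one_le_norm_one_add_two_aCoef hx hn h) (norm_inv_nat_mul_lam_le_three hx hn h) 0 N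
    (Nat.zero_le _) hN
  rw [truncSeries_zero, zero_add, pow_one] at h1
  have h2 := norm_inv_nat_mul_lam_le_three hx hn h
  set T := truncSeries N (aCoef x n (shift k σ)) (lam x (shift k σ))
    (1 / (n * lam x (shift k σ)))
  have h3 : ‖T‖ ≤ 3 * C + 1 := by
    have h4 : ‖T‖ ≤ ‖T - 1‖ + ‖(1 : ℂ)‖ := by simpa using norm_add_le (T - 1) 1
    rw [norm_one] at h4
    nlinarith
  have h5 := norm_integrand_le hx hn h ht
  have h6 : 1 ≤ √‖1 + omega x n (shift k σ)‖ := by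
    rw [Real.one_le_sqrt]; exact one_le_norm_one_add_omega hx hn h
  calc _ ≤ ‖integrand x n (shift k σ)‖ * (3 * C + 1) := by
        gcongr; exact div_le_self (norm_nonneg _) h6
    _ ≤ _ := by
        calc _ ≤ Real.exp (-((shift k σ).re ^ 2 / (4 * Real.log x))) * peak x n t
              * (3 * C + 1) := by gcongr
          _ = _ := by ring

end

/-! ### The central saddles, `k² ≤ log n` -/

/-- The position of a saddle `s = s_k` with `k² ≤ log n`, for `n` large. -/
structure IsCentral (n k : ℕ) (s : ℂ) : Prop where
  half_log_le : Real.log n / 2 ≤ s.im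
  im_le : s.im ≤ 2 * Real.log n
  norm_le : ‖s‖ ≤ 9 * Real.log n
  abs_re_le : |s.re| ≤ s.im / 100
  abs_re_sub_le : |s.re - 2 * Real.pi * k| ≤ 1

lemma tendsto_log_nat : Tendsto (fun n : ℕ => Real.log n) atTop atTop :=
  Real.tendsto_log_atTop.comp tendsto_natCast_atTop_atTop

/-- Every power of `log n` is eventually below a multiple of a positive power of `n`. -/
lemma eventually_log_pow_le (m : ℕ) {c r : ℝ} (hc : 0 < c) (hr : 0 < r) :
    ∀ᶠ n : ℕ in atTop, Real.log n ^ m ≤ c * (n : ℝ) ^ r := by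
  have h := (isLittleO_log_rpow_rpow_atTop (m : ℝ) hr).bound hc
  filter_upwards [tendsto_natCast_atTop_atTop.eventually h, eventually_ge_atTop 1] with n hn hn1
  have h1 : 0 ≤ Real.log n := Real.log_nonneg (by exact_mod_cast hn1)
  rw [Real.norm_of_nonneg (by positivity), Real.norm_of_nonneg (by positivity),
    Real.rpow_natCast] at hn
  exact hn

lemma eventually_log_pow_le_nat (m : ℕ) {c : ℝ} (hc : 0 < c) :
    ∀ᶠ n : ℕ in atTop, Real.log n ^ m ≤ c * n := by
  filter_upwards [eventually_log_pow_le m hc zero_lt_one] with n hn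
  simpa using hn

section

variable {x : ℝ} (hx : 1 < x)

include hx

lemma eq_root_of_zero {n : ℕ} (hn : 2 ≤ n) {σ : ℂ} (h : IsSaddleShift x n 0 σ) {t : ℝ}
    (ht : IsPosRoot (x ^ 2) n t) : σ = Complex.I * t :=
  isSaddleShift_unique hx hn h (isSaddleShift_zero hx hn ht)

lemma eventually_im_le : ∀ᶠ n : ℕ in atTop, ∀ (k : ℕ) (σ : ℂ), IsSaddleShift x n k σ →
    (shift k σ).im ≤ 2 * Real.log n := by
  have hL0 := Real.log_pos hx
  have hx0 : 0 < x := by linarith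
  filter_upwards [eventually_ge_atTop 2, eventually_ge_atTop ⌈3 * x⌉₊] with n hn hn2 k σ h
  have hM := scale_pos hx (n := n) (by omega)
  have hn0 : (1 : ℝ) ≤ n := by exact_mod_cast (by omega : 1 ≤ n)
  obtain ⟨h1, h2⟩ := im_bounds hx hn h
  have hs : Real.log x ≤ ‖shift k σ‖ := by
    have := Complex.im_le_norm (shift k σ); linarith
  have hs0 : 0 < ‖shift k σ‖ := by linarith
  have h3 := norm_mul_exp_im hx hn h
  have h4 := norm_scale_add_le (s := shift k σ) hM
  have h5 : Real.exp (shift k σ).im ≤ x * (2 * n + 1) := by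
    have h6 : scale x n ≤ 2 * n * ‖shift k σ‖ := by rw [scale]; gcongr
    have h7 : ‖shift k σ‖ * Real.exp (shift k σ).im ≤ ‖shift k σ‖ * (x * (2 * n + 1)) := by
      rw [h3]
      nlinarith
    exact le_of_mul_le_mul_left h7 hs0
  have h8 : x * (2 * n + 1) ≤ (n : ℝ) ^ 2 := by
    have : 3 * x ≤ n := Nat.ceil_le.mp hn2
    nlinarith
  have h9 := Real.log_le_log (Real.exp_pos _) (h5.trans h8)
  rw [Real.log_exp, Real.log_pow] at h9
  exact_mod_cast h9

lemma eventually_isCentral : ∀ᶠ n : ℕ in atTop, ∀ (k : ℕ) (σ : ℂ), (k : ℝ) ^ 2 ≤ Real.log n →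
    IsSaddleShift x n k σ → IsCentral n k (shift k σ) := by
  have hL0 := Real.log_pos hx
  have hx0 : 0 < x := by linarith
  have hc : 0 < x * Real.log x / 9 := by positivity
  filter_upwards [eventually_ge_atTop 2, eventually_im_le hx,
    eventually_log_pow_le 1 hc (show (0 : ℝ) < 1 / 2 by norm_num),
    tendsto_log_nat.eventually_ge_atTop ((200 * (2 * Real.pi)) ^ 2)]
    with n hn him hlog hbig k σ hk h
  have hM := scale_pos hx (n := n) (by omega)
  have hn0 : (1 : ℝ) ≤ n := by exact_mod_cast (by omega : 1 ≤ n)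
  have hpi := Real.pi_pos
  have hpi2 := Real.pi_lt_d2
  obtain ⟨h1, h2⟩ := im_bounds hx hn h
  have hη2 := him k σ h
  have hl0 : 0 < Real.log n := lt_of_lt_of_le (by positivity) hbig
  have hs : Real.log x ≤ ‖shift k σ‖ := by
    have := Complex.im_le_norm (shift k σ); linarith
  have hs0 : 0 < ‖shift k σ‖ := by linarith
  have h3 := norm_mul_exp_im hx hn h
  have h4 := norm_scale_add_ge x n (shift k σ)
  have hkk : (k : ℝ) ≤ (k : ℝ) ^ 2 := by
    exact_mod_cast Nat.le_self_pow two_ne_zero k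
  have hre : 0 ≤ (shift k σ).re ∧ (shift k σ).re ≤ 2 * Real.pi * k ∧
      2 * Real.pi * k - (shift k σ).re ≤ 2 * ((shift k σ).re / (shift k σ).im) := by
    rcases Nat.eq_zero_or_pos k with rfl | hk0
    · obtain ⟨t, ht, -⟩ := existsUnique_isPosRoot hx (n := n) (by omega)
      rw [eq_root_of_zero hx hn h ht]
      simp [shift]
    · obtain ⟨g1, g2, g3⟩ := re_bounds hx hn hk0 h
      have : (1 : ℝ) ≤ k := by exact_mod_cast hk0
      exact ⟨by nlinarith, g2, g3⟩
  obtain ⟨g1, g2, g3⟩ := hre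
  have hnorm : ‖shift k σ‖ ≤ 9 * Real.log n := by
    have h5 := Complex.norm_le_abs_re_add_abs_im (shift k σ)
    rw [abs_of_nonneg g1, abs_of_nonneg (by linarith : 0 ≤ (shift k σ).im)] at h5
    have h6 : 2 * Real.pi * k ≤ 2 * Real.pi * Real.log n := by gcongr; linarith
    nlinarith
  have hhalf : Real.log n / 2 ≤ (shift k σ).im := by
    rw [← Real.log_sqrt (by linarith), ← Real.log_exp (shift k σ).im]
    refine Real.log_le_log (by positivity) ?_
    rw [pow_one, ← Real.sqrt_eq_rpow] at hlog
    have h5 : √(n : ℝ) * √n = n := Real.mul_self_sqrt (by linarith)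
    have h6 : x * (n * Real.log x) ≤ 9 * Real.log n * Real.exp (shift k σ).im := by
      calc x * (n * Real.log x) ≤ x * ‖(scale x n : ℂ) + Complex.I * shift k σ‖ := by
            gcongr
            rw [scale] at h2 h4 ⊢
            linarith
        _ = ‖shift k σ‖ * Real.exp (shift k σ).im := h3.symm
        _ ≤ _ := by gcongr
    have h7 : 9 * Real.log n * √n ≤ 9 * Real.log n * Real.exp (shift k σ).im := by
      refine le_trans ?_ h6
      calc 9 * Real.log n * √n ≤ 9 * (x * Real.log x / 9 * √n) * √n := by gcongr
        _ = x * Real.log x * (√n * √n) := by ring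
        _ = _ := by rw [h5]; ring
    exact le_of_mul_le_mul_left h7 (by positivity)
  have hη0 : 0 < (shift k σ).im := by linarith
  have h100 : (shift k σ).re ≤ (shift k σ).im / 100 := by
    have h5 : 200 * (2 * Real.pi) * k ≤ Real.log n := by
      refine le_of_sq_le_sq ?_ hl0.le
      calc (200 * (2 * Real.pi) * k) ^ 2 = (200 * (2 * Real.pi)) ^ 2 * (k : ℝ) ^ 2 := by ring
        _ ≤ Real.log n * Real.log n := by gcongr
        _ = _ := by ring
    linarith
  refine ⟨hhalf, hη2, hnorm, by rwa [abs_of_nonneg g1], ?_⟩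
  have h6 : (shift k σ).re / (shift k σ).im ≤ 1 / 100 := by
    rw [div_le_iff₀ hη0]; linarith
  rw [abs_le]
  constructor <;> linarith

lemma eventually_root_bounds : ∀ᶠ n : ℕ in atTop, ∀ t : ℝ, IsPosRoot (x ^ 2) n t →
    Real.log n / 2 ≤ t ∧ t ≤ 2 * Real.log n := by
  filter_upwards [eventually_isCentral hx, eventually_ge_atTop 2] with n hn hn2 t ht
  have hl : 0 ≤ Real.log n := Real.log_natCast_nonneg n
  have h := hn 0 _ (by simpa using hl) (isSaddleShift_zero hx hn2 ht)
  have e : shift 0 (Complex.I * t) = Complex.I * t := by simp [shift]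
  rw [e] at h
  exact ⟨by simpa using h.half_log_le, by simpa using h.im_le⟩

lemma eventually_root_sub_im_le : ∀ᶠ n : ℕ in atTop, ∀ (k : ℕ) (σ : ℂ) (t : ℝ),
    (k : ℝ) ^ 2 ≤ Real.log n → IsSaddleShift x n k σ → IsPosRoot (x ^ 2) n t →
      t - (shift k σ).im ≤ 4 := by
  have hL0 := Real.log_pos hx
  have hx0 : 0 < x := by linarith
  filter_upwards [eventually_isCentral hx, eventually_root_bounds hx, eventually_ge_atTop 2,
    tendsto_log_nat.eventually_ge_atTop 1] with n hc hr hn hlog k σ t hk h ht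
  have hM := scale_pos hx (n := n) (by omega)
  have hC := hc k σ hk h
  obtain ⟨r1, r2⟩ := hr t ht
  obtain ⟨h1, h2⟩ := im_bounds hx hn h
  obtain ⟨ht0, ht1⟩ := (isPosRoot_iff hx0).mp ht
  have h3 := norm_mul_exp_im hx hn h
  have h4 := norm_scale_add_ge x n (shift k σ)
  have htM := root_lt_scale hx ht
  set s := shift k σ
  have e1 : t * Real.exp t ≤ x * scale x n := by nlinarith
  have e2 : x * scale x n ≤ 2 * (‖s‖ * Real.exp s.im) := by rw [h3]; nlinarith
  have e3 : t * Real.exp t ≤ t * (36 * Real.exp s.im) := by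
    have : ‖s‖ ≤ 18 * t := by linarith [hC.norm_le]
    have := mul_le_mul_of_nonneg_right this (Real.exp_pos s.im).le
    linarith
  have e4 : Real.exp t ≤ 36 * Real.exp s.im := le_of_mul_le_mul_left e3 ht0
  have e5 : Real.exp (t - s.im) ≤ Real.exp 4 := by
    rw [Real.exp_sub, div_le_iff₀ (Real.exp_pos _)]
    refine e4.trans ?_
    gcongr
    have : (2.7 : ℝ) ≤ Real.exp 1 := by linarith [Real.exp_one_gt_d9]
    have h44 : Real.exp 4 = Real.exp 1 ^ 4 := by rw [← Real.exp_nat_mul]; norm_num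
    rw [h44]
    calc (36 : ℝ) ≤ 2.7 ^ 4 := by norm_num
      _ ≤ _ := by gcongr
  exact Real.exp_le_exp.mp e5

lemma tendsto_scale : Tendsto (fun n : ℕ => scale x n) atTop atTop := by
  have hL0 := Real.log_pos hx
  have : (fun n : ℕ => scale x n) = fun n : ℕ => (2 * Real.log x) * (n : ℝ) := by
    ext n; rw [scale]; ring
  rw [this]
  exact tendsto_natCast_atTop_atTop.const_mul_atTop (by positivity)

lemma eventually_existsUnique_isSaddleShift :
    ∀ᶠ n : ℕ in atTop, ∀ k : ℕ, ∃! σ : ℂ, IsSaddleShift x n k σ := by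
  have hL0 := Real.log_pos hx
  have hx0 : 0 < x := by linarith
  have hpi := Real.pi_pos
  have hlog := Real.isLittleO_log_id_atTop.bound (show 0 < Real.pi / (20 * x) by positivity)
  have hz : Tendsto (fun n : ℕ => x * (scale x n / Real.pi + 1)) atTop atTop :=
    (((tendsto_scale hx).atTop_div_const hpi).atTop_add tendsto_const_nhds).const_mul_atTop hx0
  filter_upwards [eventually_ge_atTop 2, hz.eventually hlog,
    (tendsto_scale hx).eventually_ge_atTop Real.pi,
    (tendsto_scale hx).eventually_ge_atTop (10 * Real.log x)] with n hn h1 h2 h3 k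
  have key : ∃ σ : ℂ, IsSaddleShift x n k σ := by
    rcases Nat.eq_zero_or_pos k with rfl | hk
    · obtain ⟨t, ht, -⟩ := existsUnique_isPosRoot hx (n := n) (by omega)
      exact ⟨_, isSaddleShift_zero hx hn ht⟩
    · refine exists_isSaddleShift_of_pos hx hn h3 ?_ hk
      have hM := scale_pos hx (n := n) (by omega)
      rw [id, Real.norm_of_nonneg (r := x * _) (by positivity)] at h1
      refine (le_abs_self _).trans (h1.trans ?_)
      have e : Real.pi / (20 * x) * (x * (scale x n / Real.pi + 1))
          = (scale x n + Real.pi) / 20 := by field_simp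
      rw [e]
      linarith
  obtain ⟨σ, hσ⟩ := key
  exact ⟨σ, hσ, fun σ' h' => isSaddleShift_unique hx hn h' hσ⟩

end

/-! ### The integral over the window of a central saddle -/

/-- `τ = -is / (2 log x)`, which at a saddle equals `nλ / (1 + λ)`. -/
def tau (x : ℝ) (s : ℂ) : ℂ := -Complex.I * s / (2 * Real.log x)

lemma tau_eq (x : ℝ) (s : ℂ) :
    tau x s = ((1 / (2 * Real.log x) : ℝ) : ℂ) * (-Complex.I * s) := by
  rw [tau]; push_cast; ring

lemma tau_re (x : ℝ) (s : ℂ) : (tau x s).re = s.im / (2 * Real.log x) := by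
  rw [tau_eq, Complex.re_ofReal_mul]; simp; ring

lemma tau_im (x : ℝ) (s : ℂ) : (tau x s).im = -s.re / (2 * Real.log x) := by
  rw [tau_eq, Complex.im_ofReal_mul]; simp; ring

lemma norm_tau {x : ℝ} (hx : 1 < x) (s : ℂ) : ‖tau x s‖ = ‖s‖ / (2 * Real.log x) := by
  have := Real.log_pos hx
  rw [tau_eq, norm_mul, norm_mul, norm_neg, Complex.norm_I, one_mul, Complex.norm_real,
    Real.norm_of_nonneg (by positivity)]
  ring

lemma norm_one_add_div_pow_sub_exp_le {n : ℕ} (hn : 1 ≤ n) {z : ℂ} (h1 : ‖z‖ ≤ n / 2)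
    (h2 : ‖z‖ ^ 2 ≤ n) :
    ‖(1 + z / n) ^ n - Complex.exp z‖ ≤ 2 * ‖Complex.exp z‖ * (‖z‖ ^ 2 / n) := by
  have hn0 : (0 : ℝ) < n := by exact_mod_cast hn
  have hnc : (n : ℂ) ≠ 0 := by exact_mod_cast hn0.ne'
  have hz : ‖z / n‖ ≤ 1 / 2 := by
    rw [norm_div, Complex.norm_natCast, div_le_iff₀ hn0]; linarith
  have hne : 1 + z / n ≠ 0 := by
    intro h0
    have : ‖z / n‖ = 1 := by
      rw [show z / n = -1 by linear_combination h0]; simp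
    linarith
  set δ := n * (Complex.log (1 + z / n) - z / n) with hδ
  have hδn : ‖δ‖ ≤ ‖z‖ ^ 2 / n := by
    have h3 := Complex.norm_log_one_add_sub_self_le (z := z / n) (by linarith)
    rw [hδ, norm_mul, Complex.norm_natCast]
    calc (n : ℝ) * ‖Complex.log (1 + z / n) - z / n‖
        ≤ n * (‖z / n‖ ^ 2 * (1 - ‖z / n‖)⁻¹ / 2) := by gcongr
      _ ≤ n * (‖z / n‖ ^ 2 * (1 - 1 / 2)⁻¹ / 2) := by gcongr
      _ = ‖z‖ ^ 2 / n := by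
          rw [norm_div, Complex.norm_natCast]; field_simp; norm_num
  have hδ1 : ‖δ‖ ≤ 1 := hδn.trans (by rw [div_le_one hn0]; exact h2)
  have e : (1 + z / n) ^ n = Complex.exp z * Complex.exp δ := by
    rw [← Complex.exp_add, ← Complex.exp_log hne, ← Complex.exp_nat_mul, hδ]
    congr 1
    field_simp
    ring
  rw [e, show Complex.exp z * Complex.exp δ - Complex.exp z
    = Complex.exp z * (Complex.exp δ - 1) by ring, norm_mul]
  calc _ ≤ ‖Complex.exp z‖ * (2 * ‖δ‖) := by gcongr; exact Complex.norm_exp_sub_one_le hδ1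
    _ ≤ ‖Complex.exp z‖ * (2 * (‖z‖ ^ 2 / n)) := by gcongr
    _ = _ := by ring

lemma one_le_re_cpow_half {z : ℂ} (hz : 1 ≤ z.re) : 1 ≤ (z ^ (1 / 2 : ℂ)).re := by
  have hz0 : z ≠ 0 := by rintro rfl; simp at hz; linarith
  set p := z ^ (1 / 2 : ℂ) with hp
  have hsq : p ^ 2 = z := by simp [hp]
  have h0 : 0 ≤ p.re := by
    rw [hp, Complex.cpow_def_of_ne_zero hz0, Complex.exp_re]
    refine mul_nonneg (Real.exp_pos _).le (Real.cos_nonneg_of_mem_Icc ?_)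
    have e : (Complex.log z * (1 / 2)).im = z.arg / 2 := by
      rw [show Complex.log z * (1 / 2) = Complex.log z / (2 : ℝ) by push_cast; ring,
        Complex.div_ofReal_im, Complex.log_im]
    rw [e]
    constructor <;> linarith [Complex.neg_pi_lt_arg z, Complex.arg_le_pi z]
  have h1 : p.re ^ 2 - p.im ^ 2 = z.re := by
    rw [← hsq, sq p, Complex.mul_re]; ring
  nlinarith [sq_nonneg p.im]

lemma norm_inv_cpow_half_sub_le {z w : ℂ} (hz : 1 ≤ z.re) (hw : 1 ≤ w.re) :
    ‖1 / z ^ (1 / 2 : ℂ) - 1 / w ^ (1 / 2 : ℂ)‖ ≤ ‖z - w‖ := by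
  have h1 := one_le_re_cpow_half hz
  have h2 := one_le_re_cpow_half hw
  have s1 : (z ^ (1 / 2 : ℂ)) ^ 2 = z := by simp
  have s2 : (w ^ (1 / 2 : ℂ)) ^ 2 = w := by simp
  set p := z ^ (1 / 2 : ℂ)
  set q := w ^ (1 / 2 : ℂ)
  have n1 : 1 ≤ ‖p‖ := h1.trans (Complex.re_le_norm p)
  have n2 : 1 ≤ ‖q‖ := h2.trans (Complex.re_le_norm q)
  have n3 : 1 ≤ ‖p + q‖ := by
    have := Complex.re_le_norm (p + q)
    rw [Complex.add_re] at this
    linarith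
  have p0 : p ≠ 0 := norm_pos_iff.mp (by linarith)
  have q0 : q ≠ 0 := norm_pos_iff.mp (by linarith)
  have pq0 : p + q ≠ 0 := norm_pos_iff.mp (by linarith)
  have e : 1 / p - 1 / q = -(z - w) / (p * q * (p + q)) := by
    rw [← s1, ← s2]; field_simp; ring
  rw [e, norm_div, norm_neg, norm_mul, norm_mul]
  refine div_le_self (norm_nonneg _) ?_
  have := one_le_mul_of_one_le_of_one_le n1 n2
  exact one_le_mul_of_one_le_of_one_le this n3

lemma exists_norm_truncSeries_sub_le_of_small : ∃ ε : ℝ, 0 < ε ∧ ∃ K : ℝ, 0 < K ∧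
    ∀ a ξ w a' ξ' w' : ℂ, ‖a‖ < ε → ‖ξ‖ < ε → ‖w‖ < ε → ‖a'‖ < ε → ‖ξ'‖ < ε → ‖w'‖ < ε →
      ‖truncSeries 3 a ξ w - truncSeries 3 a' ξ' w'‖
        ≤ K * (‖a - a'‖ + ‖ξ - ξ'‖ + ‖w - w'‖) := by
  have hsm : ContDiffAt ℂ 1 (fun p : ℂ × ℂ × ℂ => truncSeries 3 p.1 p.2.1 p.2.2) 0 := by
    simp only [truncSeries, Finset.sum_range_succ, Finset.sum_range_zero, reducedCoeff, Q1, Q2, Q3,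
      P11, P12, P21, P22, P23, P24, P31, P32, P33, P34, P35, P36]
    fun_prop (disch := simp)
  obtain ⟨K, U, hU, hlip⟩ := hsm.exists_lipschitzOnWith
  obtain ⟨ε, hε, hball⟩ := Metric.mem_nhds_iff.mp hU
  refine ⟨ε, hε, K + 1, by positivity, fun a ξ w a' ξ' w' ha hξ hw ha' hξ' hw' => ?_⟩
  have m1 : ((a, ξ, w) : ℂ × ℂ × ℂ) ∈ U := hball (by
    rw [mem_ball_zero_iff, Prod.norm_def, Prod.norm_def]; simp [ha, hξ, hw])
  have m2 : ((a', ξ', w') : ℂ × ℂ × ℂ) ∈ U := hball (by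
    rw [mem_ball_zero_iff, Prod.norm_def, Prod.norm_def]; simp [ha', hξ', hw'])
  have h := hlip.norm_sub_le m1 m2
  refine h.trans ?_
  have hn : ‖((a, ξ, w) : ℂ × ℂ × ℂ) - (a', ξ', w')‖ ≤ ‖a - a'‖ + ‖ξ - ξ'‖ + ‖w - w'‖ := by
    rw [Prod.norm_def, Prod.norm_def]
    have := norm_nonneg (a - a')
    have := norm_nonneg (ξ - ξ')
    have := norm_nonneg (w - w')
    simp only [Prod.fst_sub, Prod.snd_sub]
    refine max_le (by linarith) (max_le (by linarith) (by linarith))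
  calc _ ≤ (K : ℝ) * (‖a - a'‖ + ‖ξ - ξ'‖ + ‖w - w'‖) := by gcongr
    _ ≤ _ := by gcongr; linarith

section

variable {x : ℝ} (hx : 1 < x) {n : ℕ}

include hx

variable {k : ℕ} {σ : ℂ}

lemma tau_ne_zero {s : ℂ} (hs : s ≠ 0) : tau x s ≠ 0 := by
  have hL : (Real.log x : ℂ) ≠ 0 := by exact_mod_cast (Real.log_pos hx).ne'
  rw [tau]
  exact div_ne_zero (mul_ne_zero (neg_ne_zero.mpr Complex.I_ne_zero) hs)
    (mul_ne_zero two_ne_zero hL)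

lemma nat_mul_lam_eq (hn : 2 ≤ n) (h : IsSaddleShift x n k σ) :
    n * lam x (shift k σ) = tau x (shift k σ) * (1 + lam x (shift k σ)) := by
  have hL : (Real.log x : ℂ) ≠ 0 := by exact_mod_cast (Real.log_pos hx).ne'
  have h1 := (lam_mul_eq_of_isSaddleShift hx (by omega) h).2
  rw [scale] at h1
  push_cast at h1
  rw [tau]
  field_simp
  linear_combination h1

lemma aCoef_eq_tau (hn : 2 ≤ n) (h : IsSaddleShift x n k σ) : aCoef x n (shift k σ)
    = ((1 / (4 * Real.log x) : ℝ) : ℂ) / tau x (shift k σ) * (1 + lam x (shift k σ)) := by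
  have hL : (Real.log x : ℂ) ≠ 0 := by exact_mod_cast (Real.log_pos hx).ne'
  have hl := lam_ne_zero (show 0 < x by linarith) (shift k σ)
  have hn0 : (n : ℂ) ≠ 0 := by exact_mod_cast (by omega : n ≠ 0)
  have hτ := tau_ne_zero hx (lam_mul_eq_of_isSaddleShift hx (by omega) h).1
  have e := nat_mul_lam_eq hx hn h
  rw [aCoef]
  push_cast
  field_simp
  linear_combination -(1 + lam x (shift k σ)) * e

lemma integrand_add (hn : 2 ≤ n) (h : IsSaddleShift x n k σ) (u : ℝ) :
    integrand x n (shift k σ + u) = integrand x n (shift k σ) *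
      (Complex.exp (-((1 / (4 * Real.log x) : ℝ) : ℂ) * u ^ 2
          - tau x (shift k σ) * (Complex.I * u))
        * (1 + tau x (shift k σ) * (Complex.exp (Complex.I * u) - 1) / n) ^ n) := by
  have hL : (Real.log x : ℂ) ≠ 0 := by exact_mod_cast (Real.log_pos hx).ne'
  have hn0 : (n : ℂ) ≠ 0 := by exact_mod_cast (by omega : n ≠ 0)
  have e1 : lam x (shift k σ + u) = lam x (shift k σ) * Complex.exp (Complex.I * u) := by
    rw [lam, lam, mul_add, Complex.exp_add]; ring
  have e2 : 1 + lam x (shift k σ + u) = (1 + lam x (shift k σ))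
      * (1 + tau x (shift k σ) * (Complex.exp (Complex.I * u) - 1) / n) := by
    rw [e1]
    have := nat_mul_lam_eq hx hn h
    field_simp
    linear_combination (Complex.exp (Complex.I * u) - 1) * this
  have e3 : Complex.exp (-(shift k σ + u) ^ 2 / (4 * Real.log x))
      = Complex.exp (-(shift k σ) ^ 2 / (4 * Real.log x))
        * Complex.exp (-((1 / (4 * Real.log x) : ℝ) : ℂ) * u ^ 2
          - tau x (shift k σ) * (Complex.I * u)) := by
    rw [← Complex.exp_add, tau]
    congr 1
    push_cast
    field_simp
    linear_combination (-4 * shift k σ * u) * Complex.I_sq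
  rw [integrand, integrand, e2, mul_pow, e3]
  ring

lemma sqrt_gauss_factor {s : ℂ} (hs : 0 < s.im) :
    (2 * Real.pi / (tau x s + 2 * ((1 / (4 * Real.log x) : ℝ) : ℂ))) ^ (1 / 2 : ℂ)
      = (√(4 * Real.pi * Real.log x) : ℝ) * (1 / (1 - Complex.I * s) ^ (1 / 2 : ℂ)) := by
  have hL0 := Real.log_pos hx
  have hL : (Real.log x : ℂ) ≠ 0 := by exact_mod_cast hL0.ne'
  have hre : 0 < (1 - Complex.I * s).re := by simp; linarith
  have h0 : 1 - Complex.I * s ≠ 0 := fun h => by rw [h] at hre; simp at hre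
  have harg : (1 - Complex.I * s).arg ≠ Real.pi := by
    intro h
    have := Complex.abs_arg_le_pi_div_two_iff.mpr hre.le
    rw [h, abs_of_pos Real.pi_pos] at this
    linarith [Real.pi_pos]
  have hp : 0 < 4 * Real.pi * Real.log x := by have := Real.pi_pos; positivity
  have e : 2 * Real.pi / (tau x s + 2 * ((1 / (4 * Real.log x) : ℝ) : ℂ))
      = ((4 * Real.pi * Real.log x : ℝ) : ℂ) * (1 - Complex.I * s)⁻¹ := by
    have e2 : tau x s + 2 * ((1 / (4 * Real.log x) : ℝ) : ℂ)
        = (1 - Complex.I * s) / (2 * Real.log x) := by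
      rw [tau]; push_cast; field_simp; ring
    rw [e2]
    push_cast
    field_simp
    ring
  have hp0 : ((4 * Real.pi * Real.log x : ℝ) : ℂ) ≠ 0 := by exact_mod_cast hp.ne'
  rw [e, Complex.cpow_def_of_ne_zero (mul_ne_zero hp0 (inv_ne_zero h0)),
    Complex.log_ofReal_mul hp (inv_ne_zero h0), add_mul, Complex.exp_add,
    ← Complex.cpow_def_of_ne_zero (inv_ne_zero h0), Complex.inv_cpow _ _ harg, Real.sqrt_eq_rpow,
    Complex.ofReal_cpow hp.le, Complex.cpow_def_of_ne_zero hp0, ← Complex.ofReal_log hp.le, one_div]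
  push_cast
  ring_nf

end

section

variable {x : ℝ} (hx : 1 < x)

include hx

lemma IsCentral.abs_tau_im_le {n k : ℕ} {s : ℂ} (h : IsCentral n k s) :
    |(tau x s).im| ≤ (tau x s).re / 100 := by
  have hL0 := Real.log_pos hx
  rw [tau_re, tau_im, abs_div, abs_neg, abs_of_pos (by positivity : 0 < 2 * Real.log x),
    div_right_comm]
  have := h.abs_re_le
  gcongr

lemma IsCentral.tau_re_ge {n k : ℕ} {s : ℂ} (h : IsCentral n k s) :
    Real.log n / (4 * Real.log x) ≤ (tau x s).re := by
  have hL0 := Real.log_pos hx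
  have := h.half_log_le
  rw [tau_re, div_le_div_iff₀ (by positivity) (by positivity)]
  nlinarith

/-- Laplace's method for the window of a central saddle: on the horizontal line through the saddle
the integrand is a perturbation of the model integrand. -/
lemma exists_norm_window_sub_le : ∃ C : ℝ, 0 < C ∧ ∀ᶠ n : ℕ in atTop, ∀ (k : ℕ) (σ : ℂ),
    (k : ℝ) ^ 2 ≤ Real.log n → IsSaddleShift x n k σ →
      ‖(∫ u in (-Real.pi - ((shift k σ).re - 2 * Real.pi * k))..(Real.pi
            - ((shift k σ).re - 2 * Real.pi * k)), integrand x n (shift k σ + u))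
        - integrand x n (shift k σ) * ((√(4 * Real.pi * Real.log x) : ℝ)
          * (1 / (1 - Complex.I * shift k σ) ^ (1 / 2 : ℂ))
          * truncSeries 3 (((1 / (4 * Real.log x) : ℝ) : ℂ) / tau x (shift k σ)) 0
            (1 / tau x (shift k σ)))‖
        ≤ C * ‖integrand x n (shift k σ)‖ * (Real.log n ^ 4 * √(Real.log n))⁻¹ := by
  have hL0 := Real.log_pos hx
  have hpi := Real.pi_pos
  set L := Real.log x with hLdef
  have hb : 0 ≤ 1 / (4 * L) := by positivity
  obtain ⟨C, hC, hmodel⟩ := exists_norm_modelIntegral_sub_le hb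
  set D : ℝ := (9 / L) ^ 2 with hD
  have hD0 : 0 < D := by positivity
  refine ⟨C * ((4 * L) ^ 4 * √(4 * L)) + 4 * Real.pi * D, by positivity, ?_⟩
  filter_upwards [eventually_ge_atTop 2, eventually_isCentral hx,
    tendsto_log_nat.eventually_ge_atTop (4 * L), tendsto_log_nat.eventually_ge_atTop 1,
    eventually_log_pow_le_nat 1 (show 0 < 1 / (2 * (9 / L)) by positivity),
    eventually_log_pow_le_nat 2 (show 0 < 1 / D by positivity),
    eventually_log_pow_le_nat 7 one_pos] with n hn hcen hl4 hl1 hp1 hp2 hp7 k σ hk h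
  have hc := hcen k σ hk h
  have hn0 : (0 : ℝ) < n := by exact_mod_cast (by omega : 0 < n)
  set s := shift k σ with hs
  set τ := tau x s with hτ
  set ρ := s.re - 2 * Real.pi * k with hρ
  set ℓ := Real.log n with hℓ
  have hℓ0 : 0 < ℓ := by linarith
  have hρ1 : |ρ| ≤ 1 := hc.abs_re_sub_le
  have him : 0 < s.im := by linarith [hc.half_log_le]
  have hsec := hc.abs_tau_im_le hx
  have htre := hc.tau_re_ge hx
  rw [← hℓ, ← hLdef] at htre
  rw [← hτ] at hsec htre
  have ht1 : 1 ≤ τ.re := le_trans ((one_le_div (by positivity)).mpr hl4) htre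
  have h1 := hmodel τ ht1 hsec ρ hρ1
  rw [hτ, sqrt_gauss_factor hx him, ← hτ] at h1
  set P : ℂ := (√(4 * Real.pi * Real.log x) : ℝ) * (1 / (1 - Complex.I * s) ^ (1 / 2 : ℂ))
    * truncSeries 3 (((1 / (4 * L) : ℝ) : ℂ) / τ) 0 (1 / τ) with hP
  set G : ℝ → ℂ := fun u => Complex.exp (-((1 / (4 * L) : ℝ) : ℂ) * u ^ 2 - τ * (Complex.I * u))
    * (1 + τ * (Complex.exp (Complex.I * u) - 1) / n) ^ n with hG
  have e1 : (∫ u in (-Real.pi - ρ)..(Real.pi - ρ), integrand x n (s + u))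
      = integrand x n s * ∫ u in (-Real.pi - ρ)..(Real.pi - ρ), G u := by
    rw [← intervalIntegral.integral_const_mul]
    refine intervalIntegral.integral_congr fun u _ => ?_
    exact integrand_add hx hn h u
  have hτn : ‖τ‖ ≤ 9 * ℓ / (2 * L) := by
    rw [hτ, norm_tau hx]
    have := hc.norm_le
    gcongr
  have hpt : ∀ u ∈ Set.uIoc (-Real.pi - ρ) (Real.pi - ρ),
      ‖G u - modelKernel (1 / (4 * L)) τ u‖ ≤ 2 * (D * ℓ ^ 2 / n) := by
    intro u hu
    rw [Set.uIoc_of_le (by linarith)] at hu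
    obtain ⟨r1, r2⟩ := abs_le.mp hρ1
    have hu' : |u| ≤ Real.pi + 1 := abs_le.mpr ⟨by linarith [hu.1], by linarith [hu.2]⟩
    set z := τ * (Complex.exp (Complex.I * u) - 1) with hz
    have hzn : ‖z‖ ≤ 9 / L * ℓ := by
      rw [hz, norm_mul]
      have : ‖Complex.exp (Complex.I * u) - 1‖ ≤ 2 := by
        refine (norm_sub_le _ _).trans ?_
        rw [mul_comm, Complex.norm_exp_ofReal_mul_I, norm_one]; norm_num
      calc _ ≤ 9 * ℓ / (2 * L) * 2 := by gcongr
        _ = _ := by field_simp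
    have hz2 : ‖z‖ ^ 2 ≤ D * ℓ ^ 2 := by
      rw [hD, ← mul_pow]; gcongr
    have hk1 : modelKernel (1 / (4 * L)) τ u
        = Complex.exp (-((1 / (4 * L) : ℝ) : ℂ) * u ^ 2 - τ * (Complex.I * u))
          * Complex.exp z := by
      rw [modelKernel, ← Complex.exp_add, hz]; congr 1; ring
    have hkn := norm_modelKernel_le hb hsec hu'
    have hk2 : ‖modelKernel (1 / (4 * L)) τ u‖ ≤ 1 := by
      refine hkn.trans (Real.exp_le_one_iff.mpr ?_)
      have : 0 ≤ τ.re * u ^ 2 := by positivity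
      linarith
    have hp := norm_one_add_div_pow_sub_exp_le (n := n) (by omega) (z := z) (by
        rw [pow_one] at hp1
        calc ‖z‖ ≤ 9 / L * ℓ := hzn
          _ ≤ 9 / L * (1 / (2 * (9 / L)) * n) := by gcongr
          _ = n / 2 := by field_simp) (by
        calc ‖z‖ ^ 2 ≤ D * ℓ ^ 2 := hz2
          _ ≤ D * (1 / D * n) := by gcongr
          _ = n := by field_simp)
    have e : G u - modelKernel (1 / (4 * L)) τ u
        = Complex.exp (-((1 / (4 * L) : ℝ) : ℂ) * u ^ 2 - τ * (Complex.I * u))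
          * ((1 + z / n) ^ n - Complex.exp z) := by
      rw [hk1]; simp only [hG]; rw [← hz]; ring
    have hk3 : ‖modelKernel (1 / (4 * L)) τ u‖
        = ‖Complex.exp (-((1 / (4 * L) : ℝ) : ℂ) * u ^ 2 - τ * (Complex.I * u))‖
          * ‖Complex.exp z‖ := by
      rw [hk1]; exact norm_mul _ _
    rw [e, norm_mul]
    calc _ ≤ ‖Complex.exp (-((1 / (4 * L) : ℝ) : ℂ) * u ^ 2 - τ * (Complex.I * u))‖
          * (2 * ‖Complex.exp z‖ * (‖z‖ ^ 2 / n)) := by gcongr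
      _ = 2 * (‖modelKernel (1 / (4 * L)) τ u‖ * (‖z‖ ^ 2 / n)) := by
          rw [hk3]; ring
      _ ≤ 2 * (1 * (D * ℓ ^ 2 / n)) := by gcongr
      _ = _ := by ring
  have hGc : Continuous G := by simp only [hG]; fun_prop
  have hKc : Continuous (modelKernel (1 / (4 * L)) τ) := by unfold modelKernel; fun_prop
  have h2 : ‖(∫ u in (-Real.pi - ρ)..(Real.pi - ρ), G u)
      - ∫ u in (-Real.pi - ρ)..(Real.pi - ρ), modelKernel (1 / (4 * L)) τ u‖
      ≤ 4 * Real.pi * D * (ℓ ^ 2 / n) := by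
    rw [← intervalIntegral.integral_sub (hGc.intervalIntegrable _ _)
      (hKc.intervalIntegrable _ _)]
    refine (intervalIntegral.norm_integral_le_of_norm_le_const hpt).trans (le_of_eq ?_)
    rw [show Real.pi - ρ - (-Real.pi - ρ) = 2 * Real.pi by ring, abs_of_pos (by positivity)]
    ring
  have h3 : ℓ ^ 2 / n ≤ (ℓ ^ 4 * √ℓ)⁻¹ := by
    rw [div_le_iff₀ hn0, ← div_eq_inv_mul, le_div_iff₀ (by positivity)]
    rw [one_mul] at hp7
    refine le_trans ?_ hp7
    have : √ℓ ≤ ℓ := by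
      rw [Real.sqrt_le_left (by linarith)]; nlinarith
    calc ℓ ^ 2 * (ℓ ^ 4 * √ℓ) ≤ ℓ ^ 2 * (ℓ ^ 4 * ℓ) := by gcongr
      _ = ℓ ^ 7 := by ring
  have h4 : (τ.re ^ 4)⁻¹ * (√τ.re)⁻¹ ≤ (4 * L) ^ 4 * √(4 * L) * (ℓ ^ 4 * √ℓ)⁻¹ := by
    have : ((ℓ / (4 * L)) ^ 4)⁻¹ * (√(ℓ / (4 * L)))⁻¹
        = (4 * L) ^ 4 * √(4 * L) * (ℓ ^ 4 * √ℓ)⁻¹ := by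
      rw [Real.sqrt_div hℓ0.le, div_pow, inv_div, inv_div, mul_inv]
      ring
    rw [← this]
    gcongr
  rw [e1, ← mul_sub, norm_mul]
  calc _ ≤ ‖integrand x n s‖ * (4 * Real.pi * D * (ℓ ^ 4 * √ℓ)⁻¹
        + C * ((4 * L) ^ 4 * √(4 * L) * (ℓ ^ 4 * √ℓ)⁻¹)) := by
        gcongr
        refine (norm_sub_le_norm_sub_add_norm_sub _
          (∫ u in (-Real.pi - ρ)..(Real.pi - ρ), modelKernel (1 / (4 * L)) τ u) _).trans ?_
        refine add_le_add (h2.trans (by gcongr)) (h1.trans (by gcongr))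
    _ = _ := by ring

omit hx in
lemma one_le_norm_one_add_of_re_nonneg {z : ℂ} (hz : 0 ≤ z.re) : 1 ≤ ‖1 + z‖ := by
  refine le_trans ?_ (Complex.re_le_norm _)
  simpa using hz

set_option maxHeartbeats 1000000 in
/-- The leading factor and the expansion of the model integral agree, to the order needed, with
those attached to the saddle. -/
lemma exists_norm_expansion_sub_le : ∃ C : ℝ, 0 < C ∧ ∀ᶠ n : ℕ in atTop, ∀ (k : ℕ) (σ : ℂ),
    (k : ℝ) ^ 2 ≤ Real.log n → IsSaddleShift x n k σ → ∀ N ≤ 3,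
      ‖1 / (1 - Complex.I * shift k σ) ^ (1 / 2 : ℂ)
          * truncSeries 3 (((1 / (4 * Real.log x) : ℝ) : ℂ) / tau x (shift k σ)) 0
            (1 / tau x (shift k σ))
        - 1 / (1 + omega x n (shift k σ)) ^ (1 / 2 : ℂ)
          * truncSeries N (aCoef x n (shift k σ)) (lam x (shift k σ))
            (1 / (n * lam x (shift k σ)))‖
        ≤ C * (Real.log n ^ (N + 1) * √(Real.log n))⁻¹ := by
  have hL0 := Real.log_pos hx
  set L := Real.log x with hLdef
  obtain ⟨C₁, hC₁, hb⟩ := exists_norm_truncSeries_sub_le (1 / L)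
  obtain ⟨ε, hε, K, hK, hlip⟩ := exists_norm_truncSeries_sub_le_of_small
  set B : ℝ := 4 * L + 1 with hB
  have hB0 : 0 < B := by positivity
  refine ⟨81 / (2 * L) * (3 * C₁ + 1) + 2 * (3 * K * (9 / L) + C₁ * B ^ 4), by positivity, ?_⟩
  filter_upwards [eventually_ge_atTop 2, eventually_isCentral hx,
    tendsto_log_nat.eventually_ge_atTop 1, tendsto_log_nat.eventually_ge_atTop (8 * L),
    tendsto_log_nat.eventually_ge_atTop (8 * B / ε), tendsto_log_nat.eventually_ge_atTop (4 / ε),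
    eventually_log_pow_le_nat 1 (show 0 < 1 / (9 / L) * (1 / 2) by positivity),
    eventually_log_pow_le_nat 1 (show 0 < 1 / (9 / L) * (ε / 2) by positivity),
    eventually_log_pow_le_nat 7 one_pos] with n hn hcen hl1 hl4 hlε hlε2 hp1 hp2 hp7 k σ hk h N hN
  have hc := hcen k σ hk h
  have hM := scale_pos hx (n := n) (by omega)
  have hn0 : (0 : ℝ) < n := by exact_mod_cast (by omega : 0 < n)
  obtain ⟨him1, him2⟩ := im_bounds hx hn h
  have hs0 := (lam_mul_eq_of_isSaddleShift hx (by omega) h).1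
  have hτ0 := tau_ne_zero hx hs0
  have hωre := omega_re_ge_half hx hn h
  have hω := omega_eq hx hn h
  have ha := aCoef_eq_tau hx hn h
  have hw := nat_mul_lam_eq hx hn h
  have hlam1 := norm_lam_le_one hx hn h
  have hlam := norm_lam_le hx hn h
  have g1 := one_le_norm_one_add_two_aCoef hx hn h
  have g2 := norm_aCoef_le hx hn h
  have g3 := norm_inv_nat_mul_lam_le_three hx hn h
  have g4 := norm_inv_nat_mul_lam_le hx hn h
  have g5 := one_add_lam_ne_zero hx h
  have htre := hc.tau_re_ge hx
  rw [← hLdef] at htre g2 g4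
  set s := shift k σ with hs
  set τ := tau x s with hτ
  set ℓ := Real.log n with hℓ
  set a := aCoef x n s
  set w := 1 / (n * lam x s) with hwdef
  set ξ := lam x s with hξ
  set a' : ℂ := ((1 / (4 * L) : ℝ) : ℂ) / τ with ha'
  set w' := 1 / τ with hw'
  have hℓ0 : 0 < ℓ := by linarith
  have hsn : ℓ / 2 ≤ ‖s‖ := hc.half_log_le.trans (Complex.im_le_norm s)
  have hsn0 : 0 < ‖s‖ := by linarith
  have hτn : ℓ / (4 * L) ≤ ‖τ‖ := htre.trans (Complex.re_le_norm τ)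
  have hτn0 : 0 < ‖τ‖ := norm_pos_iff.mpr hτ0
  have hMn : scale x n = 2 * n * L := rfl
  -- sizes of the parameters
  have hξn : ‖ξ‖ ≤ 9 / L * (ℓ / n) := by
    refine hlam.trans ?_
    rw [hMn, div_le_iff₀ (by positivity)]
    calc 2 * ‖s‖ ≤ 2 * (9 * ℓ) := by gcongr; exact hc.norm_le
      _ = _ := by field_simp
  have hξhalf : ‖ξ‖ ≤ 1 / 2 := by
    refine hξn.trans ?_
    rw [pow_one] at hp1
    calc 9 / L * (ℓ / n) ≤ 9 / L * (1 / (9 / L) * (1 / 2) * n / n) := by gcongr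
      _ = 1 / 2 := by field_simp
  have hξε : ‖ξ‖ < ε := by
    refine hξn.trans_lt ?_
    rw [pow_one] at hp2
    calc 9 / L * (ℓ / n) ≤ 9 / L * (1 / (9 / L) * (ε / 2) * n / n) := by gcongr
      _ = ε / 2 := by field_simp
      _ < ε := by linarith
  have h1ξ : 1 / 2 ≤ ‖1 + ξ‖ := by
    have : ‖(1 : ℂ)‖ ≤ ‖1 + ξ‖ + ‖ξ‖ := by simpa using norm_sub_le (1 + ξ) ξ
    rw [norm_one] at this
    linarith
  have h1ξ2 : ‖1 + ξ‖ ≤ 2 := by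
    refine (norm_add_le _ _).trans ?_
    rw [norm_one]; linarith
  have hw'n : ‖w'‖ ≤ 4 * L / ℓ := by
    rw [hw', norm_div, norm_one, one_div, ← inv_div]; gcongr
  have hw'n2 : ‖w'‖ ≤ 1 / 2 := hw'n.trans (by rw [div_le_iff₀ hℓ0]; linarith)
  have ha'n : ‖a'‖ ≤ 1 / ℓ := by
    rw [ha', norm_div, Complex.norm_real, Real.norm_of_nonneg (by positivity)]
    calc 1 / (4 * L) / ‖τ‖ ≤ 1 / (4 * L) / (ℓ / (4 * L)) := by gcongr
      _ = 1 / ℓ := by field_simp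
  have ha'1 : ‖a'‖ ≤ 1 := ha'n.trans (by rw [div_le_one hℓ0]; exact hl1)
  have haa : a = a' * (1 + ξ) := ha
  have hww : w = w' / (1 + ξ) := by
    rw [hwdef, hw, hw', div_div]
  have hwB : ‖w‖ ≤ B / ℓ := by
    refine g4.trans ?_
    have i1 : 2 * L / ‖s‖ ≤ 4 * L / ℓ := by
      rw [div_le_div_iff₀ hsn0 hℓ0]; nlinarith
    have i2 : 1 / (n : ℝ) ≤ 1 / ℓ := by
      have : ℓ ≤ n := by
        have := Real.log_le_sub_one_of_pos hn0
        linarith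
      gcongr
    rw [hB, add_div]
    exact add_le_add i1 i2
  have hBε : B / ℓ < ε := by
    rw [div_le_iff₀ hε] at hlε
    rw [div_lt_iff₀ hℓ0]; linarith
  have hℓε : 2 * (1 / ℓ) < ε := by
    rw [div_le_iff₀ hε] at hlε2
    rw [mul_one_div, div_lt_iff₀ hℓ0]; linarith
  have hw'ε : ‖w'‖ < ε := by
    refine lt_of_le_of_lt (hw'n.trans ?_) hBε
    rw [hB]; gcongr; linarith
  have ha'ε : ‖a'‖ < ε := by
    have : 0 < 1 / ℓ := by positivity
    linarith
  have haε : ‖a‖ < ε := by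
    rw [haa, norm_mul]
    calc ‖a'‖ * ‖1 + ξ‖ ≤ 1 / ℓ * 2 := by gcongr
      _ < ε := by linarith
  -- the two expansions
  have hT : ‖truncSeries 3 a' 0 w' - truncSeries 3 a ξ w‖ ≤ 3 * K * ‖ξ‖ := by
    refine (hlip a' 0 w' a ξ w ha'ε (by simpa using hε) hw'ε haε hξε
      (hwB.trans_lt hBε)).trans ?_
    have d1 : ‖a' - a‖ ≤ ‖ξ‖ := by
      rw [haa, show a' - a' * (1 + ξ) = -(a' * ξ) by ring, norm_neg, norm_mul]
      exact mul_le_of_le_one_left (norm_nonneg _) ha'1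
    have d2 : ‖w' - w‖ ≤ ‖ξ‖ := by
      rw [hww, show w' - w' / (1 + ξ) = w' * ξ / (1 + ξ) by field_simp; ring, norm_div, norm_mul,
        div_le_iff₀ (by linarith)]
      have := norm_nonneg ξ
      nlinarith
    have d3 : ‖(0 : ℂ) - ξ‖ = ‖ξ‖ := by rw [zero_sub, norm_neg]
    rw [d3, mul_comm 3 K, mul_assoc]
    gcongr
    linarith
  have hTN : ‖truncSeries 3 a ξ w - truncSeries N a ξ w‖ ≤ C₁ * (B / ℓ) ^ (N + 1) :=
    (hb a ξ w g2 hlam1 g1 g3 N 3 hN le_rfl).trans (by gcongr)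
  have hT0 : ‖truncSeries 3 a' 0 w'‖ ≤ 3 * C₁ + 1 := by
    have hL1 : ‖a'‖ ≤ 1 / L := ha'n.trans (by gcongr; linarith)
    have hre : 0 ≤ (2 * a').re := by
      have : 2 * a' = ((1 / (2 * L) : ℝ) : ℂ) * τ⁻¹ := by
        rw [ha']; push_cast; field_simp; norm_num
      rw [this, Complex.re_ofReal_mul, Complex.inv_re]
      have : 0 ≤ τ.re := le_trans (by positivity) htre
      have := Complex.normSq_nonneg τ
      positivity
    have i1 := hb a' 0 w' hL1 (by simp) (one_le_norm_one_add_of_re_nonneg hre) (by linarith) 0 3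
      (by norm_num) le_rfl
    rw [truncSeries_zero, zero_add, pow_one] at i1
    have i2 : ‖truncSeries 3 a' 0 w'‖ ≤ ‖truncSeries 3 a' 0 w' - 1‖ + ‖(1 : ℂ)‖ := by
      simpa using norm_add_le (truncSeries 3 a' 0 w' - 1) 1
    rw [norm_one] at i2
    have i3 : C₁ * ‖w'‖ ≤ C₁ * (1 / 2) := by gcongr
    linarith
  -- the two leading factors
  have hPQ : ‖1 / (1 - Complex.I * s) ^ (1 / 2 : ℂ) - 1 / (1 + omega x n s) ^ (1 / 2 : ℂ)‖
      ≤ 81 / (2 * L) * (ℓ ^ 2 / n) := by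
    refine (norm_inv_cpow_half_sub_le (by simp; linarith) (by simp; linarith)).trans ?_
    have e : 1 - Complex.I * s - (1 + omega x n s) = -(s ^ 2 / scale x n) := by
      rw [hω]
      linear_combination (s ^ 2 / scale x n) * Complex.I_sq
    rw [e, norm_neg, norm_div, norm_pow, Complex.norm_real, Real.norm_of_nonneg hM.le, hMn]
    calc ‖s‖ ^ 2 / (2 * n * L) ≤ (9 * ℓ) ^ 2 / (2 * n * L) := by gcongr; exact hc.norm_le
      _ = _ := by field_simp; norm_num
  have hQ : ‖1 / (1 + omega x n s) ^ (1 / 2 : ℂ)‖ ≤ 2 * (√ℓ)⁻¹ := by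
    have i1 : ℓ / 4 ≤ ‖1 + omega x n s‖ := by
      refine le_trans ?_ (Complex.re_le_norm _)
      have := hc.half_log_le
      simp
      linarith
    rw [norm_div, norm_one, norm_cpow_half, one_div]
    have i2 : √ℓ / 2 ≤ √‖1 + omega x n s‖ := by
      refine le_trans (le_of_eq ?_) (Real.sqrt_le_sqrt i1)
      rw [Real.sqrt_div hℓ0.le]
      congr 1
      rw [show (4 : ℝ) = 2 ^ 2 by norm_num, Real.sqrt_sq (by norm_num)]
    calc (√‖1 + omega x n s‖)⁻¹ ≤ (√ℓ / 2)⁻¹ := by gcongr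
      _ = _ := by rw [inv_div]; ring
  -- everything is of the required order
  have hsq : √ℓ ≤ ℓ := by
    rw [Real.sqrt_le_left (by linarith)]; nlinarith
  have hsq0 : 0 < √ℓ := by positivity
  have o1 : ℓ ^ 2 / n ≤ (ℓ ^ (N + 1) * √ℓ)⁻¹ := by
    rw [div_le_iff₀ hn0, ← div_eq_inv_mul, le_div_iff₀ (by positivity)]
    rw [one_mul] at hp7
    refine le_trans ?_ hp7
    calc ℓ ^ 2 * (ℓ ^ (N + 1) * √ℓ) ≤ ℓ ^ 2 * (ℓ ^ 4 * ℓ) := by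
          gcongr
          omega
      _ = ℓ ^ 7 := by ring
  have o2 : (√ℓ)⁻¹ * (ℓ / n) ≤ (ℓ ^ (N + 1) * √ℓ)⁻¹ := by
    refine le_trans ?_ o1
    have : (√ℓ)⁻¹ ≤ 1 := inv_le_one_of_one_le₀ (by rw [Real.one_le_sqrt]; exact hl1)
    calc (√ℓ)⁻¹ * (ℓ / n) ≤ 1 * (ℓ * ℓ / n) := by
          gcongr
          exact le_mul_of_one_le_left hℓ0.le hl1
      _ = _ := by ring
  have o3 : (√ℓ)⁻¹ * (B / ℓ) ^ (N + 1) ≤ B ^ 4 * (ℓ ^ (N + 1) * √ℓ)⁻¹ := by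
    have : B ^ (N + 1) ≤ B ^ 4 := pow_le_pow_right₀ (by rw [hB]; linarith) (by omega)
    calc (√ℓ)⁻¹ * (B / ℓ) ^ (N + 1) = B ^ (N + 1) * (ℓ ^ (N + 1) * √ℓ)⁻¹ := by
          rw [div_pow, mul_inv]; ring
      _ ≤ _ := by gcongr
  set P := 1 / (1 - Complex.I * s) ^ (1 / 2 : ℂ)
  set Q := 1 / (1 + omega x n s) ^ (1 / 2 : ℂ)
  set T0 := truncSeries 3 a' 0 w'
  set T := truncSeries 3 a ξ w
  set TN := truncSeries N a ξ w
  have split : P * T0 - Q * TN = (P - Q) * T0 + Q * ((T0 - T) + (T - TN)) := by ring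
  rw [split]
  calc _ ≤ ‖P - Q‖ * ‖T0‖ + ‖Q‖ * (‖T0 - T‖ + ‖T - TN‖) := by
        refine (norm_add_le _ _).trans ?_
        rw [norm_mul, norm_mul]
        gcongr
        exact norm_add_le _ _
    _ ≤ 81 / (2 * L) * (ℓ ^ 2 / n) * (3 * C₁ + 1)
        + 2 * (√ℓ)⁻¹ * (3 * K * (9 / L * (ℓ / n)) + C₁ * (B / ℓ) ^ (N + 1)) := by
        gcongr
        exact hT.trans (by gcongr)
    _ = 81 / (2 * L) * (3 * C₁ + 1) * (ℓ ^ 2 / n)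
        + 2 * (3 * K * (9 / L) * ((√ℓ)⁻¹ * (ℓ / n)) + C₁ * ((√ℓ)⁻¹ * (B / ℓ) ^ (N + 1))) := by
        ring
    _ ≤ 81 / (2 * L) * (3 * C₁ + 1) * (ℓ ^ (N + 1) * √ℓ)⁻¹
        + 2 * (3 * K * (9 / L) * (ℓ ^ (N + 1) * √ℓ)⁻¹
          + C₁ * (B ^ 4 * (ℓ ^ (N + 1) * √ℓ)⁻¹)) := by
        gcongr
    _ = _ := by ring

end

/-! ### The integral representation -/

/-- The integral of the integrand over `[2πk - π, 2πk + π]` at height `t`. -/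
def window (x : ℝ) (n : ℕ) (t : ℝ) (k : ℤ) : ℂ :=
  ∫ v in (2 * Real.pi * k - Real.pi)..(2 * Real.pi * k + Real.pi),
    integrand x n (v + t * Complex.I)

section

variable {x : ℝ} (hx : 1 < x)

include hx

lemma integrand_eq_sum (n : ℕ) (t v : ℝ) : integrand x n (v + t * Complex.I) =
    ∑ j ∈ Finset.range (n + 1), ((n.choose j : ℂ) * x ^ j) *
      Complex.exp ((-1 / (4 * Real.log x) : ℂ) * v ^ 2
        + (Complex.I * (j - t / (2 * Real.log x))) * v
        + (t ^ 2 / (4 * Real.log x) - j * t)) := by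
  have hL : (Real.log x : ℂ) ≠ 0 := by exact_mod_cast (Real.log_pos hx).ne'
  rw [integrand, add_comm (1 : ℂ) (lam x _), add_pow (lam x _), Finset.mul_sum]
  refine Finset.sum_congr rfl fun j _ => ?_
  have e : Complex.exp ((-1 / (4 * Real.log x) : ℂ) * v ^ 2
        + (Complex.I * (j - t / (2 * Real.log x))) * v
        + (t ^ 2 / (4 * Real.log x) - j * t))
      = Complex.exp (-(v + t * Complex.I) ^ 2 / (4 * Real.log x))
        * Complex.exp (j * (Complex.I * (v + t * Complex.I))) := by
    rw [← Complex.exp_add]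
    congr 1
    field_simp
    linear_combination (2 : ℂ) * (t ^ 2 - 4 * Real.log x * j * t : ℂ) * Complex.I_sq
  rw [e, Complex.exp_nat_mul, lam, mul_pow, one_pow]
  ring

lemma neg_quadratic_re : (-1 / (4 * Real.log x) : ℂ).re < 0 := by
  have hL0 := Real.log_pos hx
  have : (-1 / (4 * Real.log x) : ℂ) = ((-1 / (4 * Real.log x) : ℝ) : ℂ) := by push_cast; ring
  rw [this, Complex.ofReal_re]
  exact div_neg_of_neg_of_pos (by norm_num) (by positivity)

lemma integrable_integrand (n : ℕ) (t : ℝ) :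
    MeasureTheory.Integrable fun v : ℝ => integrand x n (v + t * Complex.I) := by
  simp_rw [integrand_eq_sum hx]
  exact MeasureTheory.integrable_finsetSum _ fun j _ =>
    (integrable_cexp_quadratic' (neg_quadratic_re hx) _ _).const_mul _

lemma pow_mul_exp_eq (j : ℕ) :
    x ^ j * Real.exp (-(Real.log x * j ^ 2)) = (x ^ (-2 : ℤ)) ^ (j * (j - 1) / 2) := by
  have hx0 : 0 < x := by linarith
  have h1 : Real.exp (-(Real.log x * j ^ 2)) = (x ^ (j ^ 2))⁻¹ := by
    rw [Real.exp_neg, ← Real.exp_log (pow_pos hx0 (j ^ 2)), Real.log_pow]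
    push_cast
    rw [mul_comm]
  have h2 : 2 * (j * (j - 1) / 2) = j * (j - 1) :=
    Nat.two_mul_div_two_of_even (Nat.even_mul_pred_self j)
  have h3 : j ^ 2 = j + 2 * (j * (j - 1) / 2) := by
    rw [h2]
    rcases j with _ | j
    · rfl
    · simp only [Nat.add_sub_cancel]; ring
  rw [h1, h3, pow_add, pow_mul x 2]
  have : (x ^ (-2 : ℤ)) = (x ^ 2)⁻¹ := by rw [zpow_neg]; norm_cast
  rw [this, inv_pow]
  field_simp

/-- The polynomial as a Gaussian average of `(1 + x e^{is})^n` along a horizontal line. -/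
lemma integral_integrand (n : ℕ) (t : ℝ) : ∫ v : ℝ, integrand x n (v + t * Complex.I)
    = ((√(4 * Real.pi * Real.log x) * wp n (x ^ (-2 : ℤ)) : ℝ) : ℂ) := by
  have hL0 := Real.log_pos hx
  have hL : (Real.log x : ℂ) ≠ 0 := by exact_mod_cast hL0.ne'
  simp_rw [integrand_eq_sum hx]
  rw [MeasureTheory.integral_finsetSum _ fun j _ =>
    (integrable_cexp_quadratic' (neg_quadratic_re hx) _ _).const_mul _, wp, Finset.mul_sum]
  push_cast
  refine Finset.sum_congr rfl fun j _ => ?_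
  rw [MeasureTheory.integral_const_mul, integral_cexp_quadratic (neg_quadratic_re hx)]
  have e1 : ((Real.pi : ℂ) / -(-1 / (4 * Real.log x))) ^ (1 / 2 : ℂ)
      = (√(4 * Real.pi * Real.log x) : ℝ) := by
    have hp : 0 ≤ 4 * Real.pi * Real.log x := by have := Real.pi_pos; positivity
    rw [Real.sqrt_eq_rpow, Complex.ofReal_cpow hp]
    push_cast
    congr 1
    field_simp
  have e2 : Complex.exp ((t ^ 2 / (4 * Real.log x) - j * t)
      - (Complex.I * (j - t / (2 * Real.log x))) ^ 2 / (4 * (-1 / (4 * Real.log x))))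
      = (Real.exp (-(Real.log x * j ^ 2)) : ℝ) := by
    push_cast
    congr 1
    field_simp
    linear_combination ((4 : ℂ) * (2 * Real.log x * j - t) ^ 2) * Complex.I_sq
  rw [e1, e2]
  have e3 := congrArg (fun r : ℝ => (r : ℂ)) (pow_mul_exp_eq hx j)
  push_cast at e3
  rw [← e3]
  push_cast
  ring

omit hx in
lemma integrand_neg_conj (x : ℝ) (n : ℕ) (s : ℂ) :
    integrand x n (-(starRingEnd ℂ) s) = (starRingEnd ℂ) (integrand x n s) := by
  rw [integrand, integrand, lam, lam, map_mul, map_pow, map_add, map_one, map_mul,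
    ← Complex.exp_conj, ← Complex.exp_conj, map_div₀, map_neg, map_pow, map_mul, map_mul,
    Complex.conj_I, Complex.conj_ofReal, Complex.conj_ofReal]
  have : (starRingEnd ℂ) 4 = 4 := Complex.conj_ofNat 4
  rw [this]
  ring_nf

omit hx in
lemma window_neg (x : ℝ) (n : ℕ) (t : ℝ) (k : ℤ) :
    window x n t (-k) = (starRingEnd ℂ) (window x n t k) := by
  rw [window, window, ← intervalIntegral.intervalIntegral_conj]
  have := intervalIntegral.integral_comp_neg
    (a := 2 * Real.pi * ((-k : ℤ) : ℝ) - Real.pi) (b := 2 * Real.pi * ((-k : ℤ) : ℝ) + Real.pi)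
    (fun v : ℝ => (starRingEnd ℂ) (integrand x n (v + t * Complex.I)))
  rw [show -(2 * Real.pi * ((-k : ℤ) : ℝ) + Real.pi) = 2 * Real.pi * k - Real.pi by
    push_cast; ring, show -(2 * Real.pi * ((-k : ℤ) : ℝ) - Real.pi) = 2 * Real.pi * k + Real.pi by
    push_cast; ring] at this
  rw [← this]
  refine intervalIntegral.integral_congr fun v _ => ?_
  rw [← integrand_neg_conj]
  congr 1
  simp [add_comm]

lemma hasSum_window (n : ℕ) (t : ℝ) : HasSum (fun k : ℤ => window x n t k)
    (∫ v : ℝ, integrand x n (v + t * Complex.I)) := by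
  have hpi := Real.two_pi_pos
  have h := MeasureTheory.hasSum_integral_iUnion (μ := MeasureTheory.volume)
    (f := fun v : ℝ => integrand x n (v + t * Complex.I))
    (s := fun k : ℤ => Set.Ioc (-Real.pi + k • (2 * Real.pi)) (-Real.pi + (k + 1) • (2 * Real.pi)))
    (fun k => measurableSet_Ioc) (Set.pairwise_disjoint_Ioc_add_zsmul _ _)
    (by rw [iUnion_Ioc_add_zsmul hpi]; exact (integrable_integrand hx n t).integrableOn)
  rw [iUnion_Ioc_add_zsmul hpi, MeasureTheory.setIntegral_univ] at h
  have e : (fun k : ℤ => window x n t k) = fun k : ℤ => ∫ v in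
      Set.Ioc (-Real.pi + k • (2 * Real.pi)) (-Real.pi + (k + 1) • (2 * Real.pi)),
      integrand x n (v + t * Complex.I) := by
    funext k
    rw [window, intervalIntegral.integral_of_le (by linarith)]
    simp only [zsmul_eq_mul]
    congr 2
    push_cast
    congr 1 <;> ring
  rw [e]
  exact h

/-- The polynomial as the sum of the windows with nonnegative index. -/
lemma hasSum_window_nat (n : ℕ) (t : ℝ) :
    Summable (fun k : ℕ => window x n t (k + 1 : ℕ)) ∧
    ((√(4 * Real.pi * Real.log x) * wp n (x ^ (-2 : ℤ)) : ℝ) : ℂ)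
      = window x n t 0 + ((2 * (∑' k : ℕ, window x n t (k + 1 : ℕ)).re : ℝ) : ℂ) := by
  have h := hasSum_window hx n t
  have hs : Summable (fun k : ℕ => window x n t (k + 1 : ℕ)) := by
    have h1 := h.summable.comp_injective (i := fun k : ℕ => ((k + 1 : ℕ) : ℤ))
      (fun a b hab => by simpa using hab)
    exact h1
  refine ⟨hs, ?_⟩
  have h2 := h.nat_add_neg
  have h3 := (hasSum_nat_add_iff' 1).mpr h2
  rw [Finset.sum_range_one] at h3
  simp only [window_neg] at h3
  have h4 := hs.hasSum.add ((Complex.hasSum_conj'.mpr hs.hasSum : HasSum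
    (fun k : ℕ => (starRingEnd ℂ) (window x n t (k + 1 : ℕ))) _))
  have h5 := h3.unique h4
  rw [integral_integrand hx] at h5
  have h6 := Complex.add_conj (∑' k : ℕ, window x n t (k + 1 : ℕ))
  have h7 := window_neg x n t 0
  simp only [neg_zero, Nat.cast_zero] at h7 h5
  linear_combination h5 + h6 - h7

end

/-! ### Contour shift and comparison of each window with its saddle -/

/-- The factor `e^{-π²k²/(4 log x)}` bounding the Gaussian on the `k`-th window. -/
def gaussDecay (x : ℝ) (k : ℕ) : ℝ := Real.exp (-(Real.pi ^ 2 * k ^ 2 / (4 * Real.log x)))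

lemma gaussDecay_pos (x : ℝ) (k : ℕ) : 0 < gaussDecay x k := Real.exp_pos _

lemma eventually_log_mul_exp_le {c : ℝ} (hc : 0 < c) : ∀ᶠ n : ℕ in atTop,
    Real.log n * Real.exp (-(c * Real.log n)) ≤ (Real.log n ^ 4 * √(Real.log n))⁻¹ := by
  have h := (Real.tendsto_pow_mul_exp_neg_atTop_nhds_zero 6).comp
    (tendsto_log_nat.const_mul_atTop hc)
  have hc6 : 0 < c ^ 6 := by positivity
  filter_upwards [h.eventually (gt_mem_nhds hc6), tendsto_log_nat.eventually_ge_atTop 1]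
    with n hn hl
  simp only [Function.comp] at hn
  rw [mul_pow, mul_assoc, mul_lt_iff_lt_one_right hc6] at hn
  have hl0 : 0 < Real.log n := by linarith
  have hs : √(Real.log n) ≤ Real.log n := Real.sqrt_le_iff.mpr ⟨hl0.le, by nlinarith⟩
  have hs0 : 0 < √(Real.log n) := Real.sqrt_pos.mpr hl0
  rw [← one_div, le_div_iff₀ (by positivity)]
  calc _ ≤ Real.log n * Real.exp (-(c * Real.log n)) * (Real.log n ^ 4 * Real.log n) := by
        gcongr
    _ = Real.log n ^ 6 * Real.exp (-(c * Real.log n)) := by ring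
    _ ≤ 1 := hn.le

lemma one_add_lam_norm_le {x : ℝ} (hx : 0 < x) (s : ℂ) :
    ‖1 + lam x s‖ ≤ 1 + x * Real.exp (-s.im) := by
  refine (norm_add_le _ _).trans ?_
  rw [norm_one, norm_lam hx]

section

variable {x : ℝ} (hx : 1 < x)

include hx

omit hx in
lemma norm_exp_gauss_line (x v y : ℝ) :
    ‖Complex.exp (-(v + y * Complex.I : ℂ) ^ 2 / (4 * Real.log x))‖
      = Real.exp (y ^ 2 / (4 * Real.log x)) * Real.exp (-(v ^ 2 / (4 * Real.log x))) := by
  have := norm_exp_gauss x (v + y * Complex.I)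
  simpa using this

lemma norm_integrand_line_le (n : ℕ) (v y : ℝ) : ‖integrand x n (v + y * Complex.I)‖
    ≤ Real.exp (-(v ^ 2 / (4 * Real.log x))) * peak x n y := by
  have h := one_add_lam_norm_le (by linarith : 0 < x) (v + y * Complex.I)
  have e : (v + y * Complex.I : ℂ).im = y := by simp
  rw [e] at h
  rw [integrand, norm_mul, norm_exp_gauss_line x, norm_pow, peak]
  calc _ ≤ Real.exp (y ^ 2 / (4 * Real.log x)) * Real.exp (-(v ^ 2 / (4 * Real.log x)))
        * (1 + x * Real.exp (-y)) ^ n := by gcongr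
    _ = _ := by ring

lemma exp_neg_sq_le_gaussDecay {k : ℕ} {v : ℝ} (hv : Real.pi * k ≤ v) :
    Real.exp (-(v ^ 2 / (4 * Real.log x))) ≤ gaussDecay x k := by
  have hL0 := Real.log_pos hx
  have hpi := Real.pi_pos
  rw [gaussDecay, ← mul_pow]
  gcongr

lemma norm_window_le (n : ℕ) (t : ℝ) {k : ℕ} (hk : 1 ≤ k) :
    ‖window x n t k‖ ≤ 2 * Real.pi * (gaussDecay x k * peak x n t) := by
  have hpi := Real.pi_pos
  have hp := (peak_pos hx n t).le
  have hk1 : (1 : ℝ) ≤ k := by exact_mod_cast hk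
  have h := intervalIntegral.norm_integral_le_of_norm_le_const
    (a := 2 * Real.pi * ((k : ℤ) : ℝ) - Real.pi) (b := 2 * Real.pi * ((k : ℤ) : ℝ) + Real.pi)
    (f := fun v : ℝ => integrand x n (v + t * Complex.I))
    (C := gaussDecay x k * peak x n t) fun v hv => by
      rw [Set.uIoc_of_le (by linarith)] at hv
      have h1 := hv.1.le
      push_cast at h1
      refine (norm_integrand_line_le hx n v t).trans ?_
      gcongr
      exact exp_neg_sq_le_gaussDecay hx (by nlinarith)
  rw [window]
  refine h.trans (le_of_eq ?_)
  rw [show (2 * Real.pi * ((k : ℤ) : ℝ) + Real.pi - (2 * Real.pi * ((k : ℤ) : ℝ) - Real.pi))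
    = 2 * Real.pi by ring, abs_of_pos (by positivity)]
  ring

/-- The peak beats the Gaussian alone by a power of `n`, which makes the vertical sides of the
contour negligible. -/
lemma exp_le_peak {n : ℕ} (hn : 2 ≤ n) {t : ℝ} (ht : IsPosRoot (x ^ 2) n t) :
    Real.exp (t ^ 2 / (4 * Real.log x))
      ≤ Real.exp (-(t / (2 * Real.log x))) * peak x n t := by
  have hL0 := Real.log_pos hx
  have hM := scale_pos hx (n := n) (by omega)
  have htM := root_lt_scale hx ht
  have hn0 : (0 : ℝ) < n := by exact_mod_cast (by omega : 0 < n)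
  have h1 : Real.exp (t / scale x n) ≤ 1 + x * Real.exp (-t) := by
    rw [one_add_lam_root hx ht, le_div_iff₀ (by linarith)]
    have h2 := Real.add_one_le_exp (-(t / scale x n))
    have h3 : scale x n - t ≤ scale x n * Real.exp (-(t / scale x n)) := by
      calc scale x n - t = scale x n * (-(t / scale x n) + 1) := by field_simp; ring
        _ ≤ _ := by gcongr
    calc Real.exp (t / scale x n) * (scale x n - t)
        ≤ Real.exp (t / scale x n) * (scale x n * Real.exp (-(t / scale x n))) := by gcongr
      _ = scale x n * (Real.exp (t / scale x n) * Real.exp (-(t / scale x n))) := by ring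
      _ = scale x n := by rw [← Real.exp_add]; simp
  have h4 : Real.exp (t / (2 * Real.log x)) ≤ (1 + x * Real.exp (-t)) ^ n := by
    calc Real.exp (t / (2 * Real.log x)) = Real.exp (t / scale x n) ^ n := by
          rw [← Real.exp_nat_mul]; congr 1; rw [scale]; field_simp
      _ ≤ _ := by gcongr
  rw [peak]
  calc Real.exp (t ^ 2 / (4 * Real.log x))
      = Real.exp (t ^ 2 / (4 * Real.log x)) * (Real.exp (-(t / (2 * Real.log x)))
        * Real.exp (t / (2 * Real.log x))) := by rw [← Real.exp_add]; simp
    _ ≤ Real.exp (t ^ 2 / (4 * Real.log x)) * (Real.exp (-(t / (2 * Real.log x)))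
        * (1 + x * Real.exp (-t)) ^ n) := by gcongr
    _ = _ := by ring

/-- On the vertical sides `λ` is negative of modulus below one, so that `|1 + λ| ≤ 1` there. -/
lemma norm_integrand_side_le (n : ℕ) {v y : ℝ} (hv : Complex.exp (Complex.I * v) = -1)
    (hy : Real.log x ≤ y) : ‖integrand x n (v + y * Complex.I)‖
      ≤ Real.exp (y ^ 2 / (4 * Real.log x)) * Real.exp (-(v ^ 2 / (4 * Real.log x))) := by
  have hx0 : 0 < x := by linarith
  have e : lam x (v + y * Complex.I) = ((-(x * Real.exp (-y)) : ℝ) : ℂ) := by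
    rw [lam, mul_add, Complex.exp_add, hv,
      show Complex.I * (y * Complex.I) = ((-y : ℝ) : ℂ) by
        push_cast; linear_combination (y : ℂ) * Complex.I_sq]
    push_cast
    ring
  have h1 : x * Real.exp (-y) ≤ 1 := by
    rw [Real.exp_neg, ← div_eq_mul_inv, div_le_one (Real.exp_pos _)]
    rwa [← Real.log_le_iff_le_exp hx0]
  have h2 : ‖1 + lam x (v + y * Complex.I)‖ ≤ 1 := by
    rw [e, ← Complex.ofReal_one, ← Complex.ofReal_add, Complex.norm_real, Real.norm_eq_abs, abs_le]
    have := Real.exp_pos (-y)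
    constructor <;> nlinarith [mul_pos hx0 this]
  rw [integrand, norm_mul, norm_exp_gauss_line x, norm_pow]
  exact mul_le_of_le_one_right (by positivity) (pow_le_one₀ (norm_nonneg _) h2)

omit hx in
lemma differentiable_integrand (x : ℝ) (n : ℕ) : Differentiable ℂ (integrand x n) := by
  unfold integrand lam
  fun_prop

/-- Moving the window from the height of the root down to the height of its own saddle. -/
lemma norm_window_sub_window_le {n : ℕ} (hn : 2 ≤ n) {k : ℕ} {σ : ℂ} (h : IsSaddleShift x n k σ)
    {t : ℝ} (ht : IsPosRoot (x ^ 2) n t) :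
    ‖window x n t k - window x n (shift k σ).im k‖
      ≤ 2 * (t * (gaussDecay x k * (Real.exp (-(t / (2 * Real.log x))) * peak x n t))) := by
  have hL0 := Real.log_pos hx
  have hpi := Real.pi_pos
  have hp := (peak_pos hx n t).le
  have ht0 := ht.1
  have hG := gaussDecay_pos x k
  rcases Nat.eq_zero_or_pos k with rfl | hk
  · have e : shift 0 σ = Complex.I * t := by
      rw [eq_root_of_zero hx hn h ht]; simp [shift]
    have e2 : (Complex.I * (t : ℂ)).im = t := by simp
    rw [e, e2, sub_self, norm_zero]
    positivity
  · set η := (shift k σ).im with hη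
    have h1 : Real.log x < η := (im_bounds hx hn h).1
    have h2 : η ≤ t := im_le_root hx hn h ht
    have hk1 : (1 : ℝ) ≤ k := by exact_mod_cast hk
    set B := gaussDecay x k * (Real.exp (-(t / (2 * Real.log x))) * peak x n t) with hB
    have side : ∀ v : ℝ, Complex.exp (Complex.I * v) = -1 → Real.pi * k ≤ v →
        ‖∫ y in η..t, integrand x n (v + y * Complex.I)‖ ≤ t * B := by
      intro v hv hkv
      have := intervalIntegral.norm_integral_le_of_norm_le_const (a := η) (b := t)
        (f := fun y : ℝ => integrand x n (v + y * Complex.I)) (C := B) fun y hy => by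
          rw [Set.uIoc_of_le h2] at hy
          refine (norm_integrand_side_le hx n hv (h1.le.trans hy.1.le)).trans ?_
          rw [hB, mul_comm]
          have := exp_neg_sq_le_gaussDecay hx hkv
          have h3 : Real.exp (y ^ 2 / (4 * Real.log x)) ≤ Real.exp (t ^ 2 / (4 * Real.log x)) := by
            have h4 := hy.1
            have h5 := hy.2
            gcongr
            linarith
          have := h3.trans (exp_le_peak hx hn ht)
          gcongr
      refine this.trans ?_
      rw [abs_of_nonneg (by linarith), mul_comm]
      gcongr
      linarith
    have hper : ∀ ε : ℝ, Complex.exp (Complex.I * ((ε * Real.pi : ℝ) : ℂ)) = -1 →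
        Complex.exp (Complex.I * ((2 * Real.pi * k + ε * Real.pi : ℝ) : ℂ)) = -1 := by
      intro ε hε
      have : Complex.I * ((2 * Real.pi * k + ε * Real.pi : ℝ) : ℂ)
          = Complex.I * ((ε * Real.pi : ℝ) : ℂ) + k * (2 * Real.pi * Complex.I) := by
        push_cast; ring
      rw [this, Complex.exp_add, Complex.exp_nat_mul_two_pi_mul_I, mul_one, hε]
    have hp1 := hper 1 (by
      rw [show Complex.I * ((1 * Real.pi : ℝ) : ℂ) = Real.pi * Complex.I by push_cast; ring,
        Complex.exp_pi_mul_I])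
    have hp2 := hper (-1) (by
      rw [show Complex.I * ((-1 * Real.pi : ℝ) : ℂ) = -(Real.pi * Complex.I) by push_cast; ring,
        Complex.exp_neg, Complex.exp_pi_mul_I]; norm_num)
    have s1 := side _ hp1 (by nlinarith)
    have s2 := side _ hp2 (by nlinarith)
    have hrect := Complex.integral_boundary_rect_eq_zero_of_differentiableOn (integrand x n)
      (⟨2 * Real.pi * k + -1 * Real.pi, η⟩ : ℂ) (⟨2 * Real.pi * k + 1 * Real.pi, t⟩ : ℂ)
      (differentiable_integrand x n).differentiableOn
    simp only at hrect
    have e : ∀ y : ℝ, window x n y k = ∫ v in (2 * Real.pi * k + -1 * Real.pi)..(2 * Real.pi * k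
        + 1 * Real.pi), integrand x n (v + y * Complex.I) := by
      intro y
      rw [window]
      congr 1 <;> push_cast <;> ring
    rw [← e, ← e] at hrect
    have e3 : window x n t k - window x n η k
        = Complex.I • (∫ y in η..t, integrand x n ((2 * Real.pi * k + 1 * Real.pi : ℝ)
            + y * Complex.I))
          - Complex.I • (∫ y in η..t, integrand x n ((2 * Real.pi * k + -1 * Real.pi : ℝ)
            + y * Complex.I)) := by
      linear_combination -hrect
    rw [e3]
    refine (norm_sub_le _ _).trans ?_
    have hI : ∀ z : ℂ, ‖Complex.I • z‖ = ‖z‖ := fun z => by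
      rw [norm_smul, Complex.norm_I, one_mul]
    rw [hI, hI]
    linarith

omit hx in
lemma window_im_eq (x : ℝ) (n k : ℕ) (s : ℂ) : window x n s.im k
    = ∫ u in (-Real.pi - (s.re - 2 * Real.pi * k))..(Real.pi - (s.re - 2 * Real.pi * k)),
        integrand x n (s + u) := by
  have := intervalIntegral.integral_comp_add_left
    (a := -Real.pi - (s.re - 2 * Real.pi * k)) (b := Real.pi - (s.re - 2 * Real.pi * k))
    (fun v : ℝ => integrand x n (v + s.im * Complex.I)) s.re
  rw [window]
  rw [show s.re + (-Real.pi - (s.re - 2 * Real.pi * k)) = 2 * Real.pi * ((k : ℤ) : ℝ) - Real.pi by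
      push_cast; ring,
    show s.re + (Real.pi - (s.re - 2 * Real.pi * k)) = 2 * Real.pi * ((k : ℤ) : ℝ) + Real.pi by
      push_cast; ring] at this
  rw [← this]
  refine intervalIntegral.integral_congr fun u _ => ?_
  congr 1
  conv_rhs => rw [← Complex.re_add_im s]
  push_cast
  ring

lemma exp_neg_re_sq_le_gaussDecay {n : ℕ} (hn : 2 ≤ n) {k : ℕ} {σ : ℂ}
    (h : IsSaddleShift x n k σ) :
    Real.exp (-((shift k σ).re ^ 2 / (4 * Real.log x))) ≤ gaussDecay x k := by
  have hpi := Real.pi_pos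
  have hL0 := Real.log_pos hx
  rcases Nat.eq_zero_or_pos k with rfl | hk
  · simp only [gaussDecay, Nat.cast_zero]
    gcongr
    simp
    positivity
  · have hk1 : (1 : ℝ) ≤ k := by exact_mod_cast hk
    exact exp_neg_sq_le_gaussDecay hx (by nlinarith [(re_bounds hx hn hk h).1])

/-- Each window is the contribution of its saddle up to an error of relative order
`(log n)^{-N-3/2}`, with a constant that is summable in `k`. -/
lemma exists_norm_window_sub_contribution_le : ∃ C : ℝ, 0 < C ∧ ∀ᶠ n : ℕ in atTop,
    ∀ (k : ℕ) (σ : ℂ) (t : ℝ), IsSaddleShift x n k σ → IsPosRoot (x ^ 2) n t → ∀ N ≤ 3,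
      ‖window x n t k - (√(4 * Real.pi * Real.log x) : ℝ) * contribution N x n k σ‖
        ≤ C * Real.exp (-(Real.pi ^ 2 * k ^ 2 / (8 * Real.log x))) * peak x n t
          * (Real.log n ^ (N + 1) * √(Real.log n))⁻¹ := by
  have hL0 := Real.log_pos hx
  have hpi := Real.pi_pos
  set L := Real.log x with hLdef
  set S : ℝ := √(4 * Real.pi * L) with hS
  have hS0 : 0 ≤ S := Real.sqrt_nonneg _
  obtain ⟨C₁, hC₁, h1⟩ := exists_norm_window_sub_le hx
  obtain ⟨C₂, hC₂, h2⟩ := exists_norm_expansion_sub_le hx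
  obtain ⟨C₃, hC₃, h3⟩ := exists_norm_contribution_le hx
  have e1 := eventually_log_mul_exp_le (c := 1 / (4 * L)) (by positivity)
  have e2 := eventually_log_mul_exp_le (c := Real.pi ^ 2 / (8 * L)) (by positivity)
  refine ⟨4 + C₁ + S * C₂ + 2 * Real.pi + S * C₃, by positivity, ?_⟩
  filter_upwards [h1, h2, e1, e2, eventually_root_bounds hx, eventually_ge_atTop 2,
    tendsto_log_nat.eventually_ge_atTop 1] with n h1 h2 e1 e2 hr hn hl k σ t h ht N hN
  set P := peak x n t with hP
  have hP0 : 0 < P := peak_pos hx n t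
  set ℓ := Real.log n with hℓ
  have hl0 : 0 < ℓ := by linarith
  have hsq : 0 < √ℓ := Real.sqrt_pos.mpr hl0
  set E : ℝ := (ℓ ^ (N + 1) * √ℓ)⁻¹ with hE
  have hE0 : 0 < E := by positivity
  have h4E : (ℓ ^ 4 * √ℓ)⁻¹ ≤ E := by
    rw [hE]
    gcongr
    · omega
  set D : ℝ := Real.exp (-(Real.pi ^ 2 * k ^ 2 / (8 * L))) with hD
  have hD0 : 0 < D := Real.exp_pos _
  have hDD : gaussDecay x k = D * D := by
    rw [gaussDecay, hD, ← Real.exp_add]; congr 1; ring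
  have hD1 : D ≤ 1 := Real.exp_le_one_iff.mpr (by
    have : 0 ≤ Real.pi ^ 2 * k ^ 2 / (8 * L) := by positivity
    linarith)
  have hGD : gaussDecay x k ≤ D := by rw [hDD]; nlinarith
  have hint := norm_integrand_le hx hn h ht
  have hdec := exp_neg_re_sq_le_gaussDecay hx hn h
  have hmain : ‖integrand x n (shift k σ)‖ ≤ D * P :=
    hint.trans (by have := hdec.trans hGD; gcongr)
  have hcontr := h3 n hn k σ t h ht N hN
  rcases le_or_gt ((k : ℝ) ^ 2) ℓ with hk | hk
  · have g1 := h1 k σ hk h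
    have g2 := h2 k σ hk h N hN
    rw [← window_im_eq] at g1
    have g0 := norm_window_sub_window_le hx hn h ht
    rw [contribution_eq hx hn h]
    set F := integrand x n (shift k σ) with hF
    set A := 1 / (1 - Complex.I * shift k σ) ^ (1 / 2 : ℂ)
          * truncSeries 3 (((1 / (4 * L) : ℝ) : ℂ) / tau x (shift k σ)) 0
            (1 / tau x (shift k σ)) with hA
    set B := 1 / (1 + omega x n (shift k σ)) ^ (1 / 2 : ℂ)
          * truncSeries N (aCoef x n (shift k σ)) (lam x (shift k σ))
            (1 / (n * lam x (shift k σ))) with hB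
    have t1 : t * Real.exp (-(t / (2 * L))) ≤ 2 * E := by
      obtain ⟨r1, r2⟩ := hr t ht
      have : Real.exp (-(t / (2 * L))) ≤ Real.exp (-(1 / (4 * L) * ℓ)) := by
        rw [Real.exp_le_exp, neg_le_neg_iff]
        calc 1 / (4 * L) * ℓ = (ℓ / 2) / (2 * L) := by field_simp; norm_num
          _ ≤ _ := by gcongr
      calc _ ≤ (2 * ℓ) * Real.exp (-(1 / (4 * L) * ℓ)) := by
            gcongr
        _ = 2 * (ℓ * Real.exp (-(1 / (4 * L) * ℓ))) := by ring
        _ ≤ 2 * E := by linarith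
    have b0 : ‖window x n t k - window x n (shift k σ).im k‖ ≤ 4 * (D * P * E) := by
      refine g0.trans ?_
      calc _ = 2 * ((t * Real.exp (-(t / (2 * L)))) * (gaussDecay x k * P)) := by ring
        _ ≤ 2 * ((2 * E) * (D * P)) := by
          have := gaussDecay_pos x k
          gcongr
        _ = _ := by ring
    have b1 : ‖window x n (shift k σ).im k - F * (S * A)‖ ≤ C₁ * (D * P * E) := by
      have : F * (S * A) = F * ((S : ℂ) * (1 / (1 - Complex.I * shift k σ) ^ (1 / 2 : ℂ))
          * truncSeries 3 (((1 / (4 * L) : ℝ) : ℂ) / tau x (shift k σ)) 0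
            (1 / tau x (shift k σ))) := by rw [hA]; ring
      rw [this]
      refine g1.trans ?_
      calc _ ≤ C₁ * (D * P) * E := by gcongr
        _ = _ := by ring
    have b2 : ‖F * (S * A) - S * (F * B)‖ ≤ S * C₂ * (D * P * E) := by
      rw [show F * (S * A) - S * (F * B) = S * (F * (A - B)) by ring, norm_mul, norm_mul,
        Complex.norm_real, Real.norm_of_nonneg hS0]
      calc _ ≤ S * ((D * P) * (C₂ * E)) := by gcongr
        _ = _ := by ring
    have e : window x n t k - S * (F / (1 + omega x n (shift k σ)) ^ (1 / 2 : ℂ)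
          * truncSeries N (aCoef x n (shift k σ)) (lam x (shift k σ))
            (1 / (n * lam x (shift k σ))))
        = (window x n t k - window x n (shift k σ).im k)
          + (window x n (shift k σ).im k - F * (S * A)) + (F * (S * A) - S * (F * B)) := by
      rw [hB]; ring
    rw [e]
    refine norm_add₃_le.trans ?_
    have : 0 ≤ (2 * Real.pi + S * C₃) * (D * P * E) := by positivity
    calc _ ≤ 4 * (D * P * E) + C₁ * (D * P * E) + S * C₂ * (D * P * E) := by gcongr
      _ ≤ _ := by linarith
  · have hk1 : 1 ≤ k := by
      by_contra hk0
      have : k = 0 := by omega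
      rw [this] at hk
      norm_num at hk
      linarith
    have hDE : D ≤ E := by
      refine le_trans ?_ h4E
      refine le_trans ?_ e2
      rw [hD]
      calc _ ≤ Real.exp (-(Real.pi ^ 2 / (8 * L) * ℓ)) := by
            rw [Real.exp_le_exp, neg_le_neg_iff]
            calc Real.pi ^ 2 / (8 * L) * ℓ ≤ Real.pi ^ 2 / (8 * L) * k ^ 2 := by gcongr
              _ = _ := by ring
        _ ≤ _ := le_mul_of_one_le_left (Real.exp_pos _).le hl
    have hGE : gaussDecay x k ≤ D * E := by rw [hDD]; gcongr
    have b1 := norm_window_le hx n t hk1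
    have b2 : ‖(S : ℂ) * contribution N x n k σ‖ ≤ S * C₃ * (D * E * P) := by
      rw [norm_mul, Complex.norm_real, Real.norm_of_nonneg hS0, mul_assoc]
      gcongr
      refine hcontr.trans ?_
      rw [mul_assoc]
      have := hdec.trans hGE
      gcongr
    refine (norm_sub_le _ _).trans ?_
    have : 0 ≤ (4 + C₁ + S * C₂) * (D * P * E) := by positivity
    calc _ ≤ 2 * Real.pi * (D * E * P) + S * C₃ * (D * E * P) := by
          refine add_le_add (b1.trans ?_) b2
          gcongr
      _ ≤ _ := by linarith

end

/-! ### The error of the expansion -/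

lemma summable_exp_neg_sq {c : ℝ} (hc : 0 < c) :
    Summable fun k : ℕ => Real.exp (-(c * ((k : ℝ) + 1) ^ 2)) := by
  refine Summable.of_nonneg_of_le (fun _ => (Real.exp_pos _).le) (fun k => ?_)
    (Real.summable_exp_nat_mul_iff.mpr (neg_lt_zero.mpr hc))
  have : (0 : ℝ) ≤ k := Nat.cast_nonneg k
  rw [Real.exp_le_exp]
  nlinarith [mul_nonneg hc.le this, mul_nonneg hc.le (sq_nonneg (k : ℝ))]

lemma shift_zero (σ : ℂ) : shift 0 σ = σ := by simp [shift]

section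

variable {x : ℝ} (hx : 1 < x)

include hx

lemma summable_contribution {n : ℕ} (hn : 2 ≤ n) {σ : ℕ → ℂ} (h : ∀ k, IsSaddleShift x n k (σ k))
    {N : ℕ} (hN : N ≤ 3) : Summable fun k : ℕ => contribution N x n (k + 1) (σ (k + 1)) := by
  have hL0 := Real.log_pos hx
  have hpi := Real.pi_pos
  obtain ⟨C, hC, hb⟩ := exists_norm_contribution_le hx
  obtain ⟨t, ht, -⟩ := existsUnique_isPosRoot hx (n := n) (by omega)
  have hp := peak_pos hx n t
  refine Summable.of_norm_bounded
    (g := fun k : ℕ => C * Real.exp (-(Real.pi ^ 2 / (4 * Real.log x) * ((k : ℝ) + 1) ^ 2))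
      * peak x n t)
    (((summable_exp_neg_sq (by positivity)).mul_left C).mul_right _) fun k => ?_
  refine (hb n hn _ _ t (h (k + 1)) ht N hN).trans ?_
  have h1 := exp_neg_re_sq_le_gaussDecay hx hn (h (k + 1))
  have e : gaussDecay x (k + 1)
      = Real.exp (-(Real.pi ^ 2 / (4 * Real.log x) * ((k : ℝ) + 1) ^ 2)) := by
    rw [gaussDecay]; push_cast; congr 1; ring
  rw [e] at h1
  gcongr

lemma omega_root {n : ℕ} (hn : 2 ≤ n) {t : ℝ} (ht : IsPosRoot (x ^ 2) n t) :
    omega x n (Complex.I * t) = ((t * (1 - t / scale x n) : ℝ) : ℂ) := by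
  have h := omega_eq hx hn (isSaddleShift_zero hx hn ht)
  rw [shift_zero] at h
  rw [h]
  push_cast
  linear_combination (-(t : ℂ) - Complex.I ^ 2 * t ^ 2 / scale x n
    + t ^ 2 / scale x n) * Complex.I_sq

lemma prefactor_root {n : ℕ} (hn : 2 ≤ n) {t : ℝ} (ht : IsPosRoot (x ^ 2) n t) :
    prefactor x n 0 (Complex.I * t)
      = ((peak x n t / √(1 + t * (1 - t / scale x n)) : ℝ) : ℂ) := by
  have hM := scale_pos hx (n := n) (by omega)
  have ht0 := ht.1
  have h1 : t / scale x n ≤ 1 := (div_le_one hM).mpr (root_lt_scale hx ht).le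
  have h2 : 0 ≤ 1 + t * (1 - t / scale x n) := by nlinarith
  rw [prefactor_zero_eq hx hn (isSaddleShift_zero hx hn ht), shift_zero, omega_root hx hn ht,
    integrand_I_mul, Complex.ofReal_div, Real.sqrt_eq_rpow, Complex.ofReal_cpow h2]
  push_cast
  rfl

omit hx in
lemma contribution_zero_zero (n : ℕ) (σ : ℂ) : contribution 0 x n 0 σ = prefactor x n 0 σ := by
  rw [← saddleSeries_zero, saddleSeries]
  simp [coeff]

lemma eventually_peak_le : ∀ᶠ n : ℕ in atTop, ∀ t : ℝ, IsPosRoot (x ^ 2) n t →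
    peak x n t * (√(Real.log n))⁻¹ ≤ 2 * (peak x n t / √(1 + t * (1 - t / scale x n))) := by
  filter_upwards [eventually_root_bounds hx, eventually_ge_atTop 2,
    tendsto_log_nat.eventually_ge_atTop 1] with n hr hn hl t ht
  have hM := scale_pos hx (n := n) (by omega)
  have hp := peak_pos hx n t
  have ht0 := ht.1
  obtain ⟨-, h2⟩ := hr t ht
  have h1 : t / scale x n ≤ 1 := (div_le_one hM).mpr (root_lt_scale hx ht).le
  have h3 : 0 ≤ t / scale x n := by positivity
  have h4 : 0 < 1 + t * (1 - t / scale x n) := by nlinarith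
  have h5 : √(1 + t * (1 - t / scale x n)) ≤ 2 * √(Real.log n) := by
    rw [Real.sqrt_le_left (by positivity), mul_pow, Real.sq_sqrt (by linarith)]
    nlinarith
  have h6 : 0 < √(1 + t * (1 - t / scale x n)) := Real.sqrt_pos.mpr h4
  have h7 : 0 < √(Real.log n) := Real.sqrt_pos.mpr (by linarith)
  rw [← div_eq_mul_inv, ← mul_div_assoc, div_le_div_iff₀ h7 h6]
  nlinarith

lemma exists_norm_wp_sub_expansion_le : ∃ C : ℝ, 0 < C ∧ ∀ᶠ n : ℕ in atTop,
    ∀ (σ : ℕ → ℂ) (t : ℝ), (∀ k, IsSaddleShift x n k (σ k)) → IsPosRoot (x ^ 2) n t → ∀ N ≤ 3,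
      ‖((wp n (x ^ (-2 : ℤ)) : ℝ) : ℂ) - expansion N x n σ‖
        ≤ C * peak x n t * (Real.log n ^ (N + 1) * √(Real.log n))⁻¹ := by
  have hL0 := Real.log_pos hx
  have hpi := Real.pi_pos
  obtain ⟨C, hC, h⟩ := exists_norm_window_sub_contribution_le hx
  set S : ℝ := √(4 * Real.pi * Real.log x) with hS
  have hS0 : 0 < S := Real.sqrt_pos.mpr (by positivity)
  set d : ℕ → ℝ := fun k => Real.exp (-(Real.pi ^ 2 / (8 * Real.log x) * ((k : ℝ) + 1) ^ 2)) with hd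
  have hds : Summable d := summable_exp_neg_sq (by positivity)
  have hd0 : 0 ≤ ∑' k, d k := tsum_nonneg fun k => (Real.exp_pos _).le
  refine ⟨C * (1 + 2 * ∑' k, d k) / S, by positivity, ?_⟩
  filter_upwards [h, eventually_ge_atTop 2] with n h hn σ t hσ ht N hN
  set E := (Real.log n ^ (N + 1) * √(Real.log n))⁻¹ with hE
  have hp := peak_pos hx n t
  obtain ⟨w1, w2⟩ := hasSum_window_nat hx n t
  have c1 := (summable_contribution hx hn hσ hN).mul_left (S : ℂ)
  have b0 := h 0 (σ 0) t (hσ 0) ht N hN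
  have b1 := fun k => h (k + 1) (σ (k + 1)) t (hσ (k + 1)) ht N hN
  have b2 : ‖∑' k : ℕ, (window x n t ((k + 1 : ℕ) : ℤ)
      - S * contribution N x n (k + 1) (σ (k + 1)))‖ ≤ C * (∑' k, d k) * peak x n t * E := by
    have hs : HasSum (fun k => C * d k * peak x n t * E) (C * (∑' k, d k) * peak x n t * E) :=
      ((hds.hasSum.mul_left C).mul_right _).mul_right _
    refine tsum_of_norm_bounded hs fun k => ?_
    refine (b1 k).trans (le_of_eq ?_)
    rw [hd]
    push_cast
    congr 4
    ring
  have e : (S : ℂ) * (((wp n (x ^ (-2 : ℤ)) : ℝ) : ℂ) - expansion N x n σ)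
      = (window x n t 0 - S * contribution N x n 0 (σ 0))
        + ((2 * (∑' k : ℕ, (window x n t ((k + 1 : ℕ) : ℤ)
          - S * contribution N x n (k + 1) (σ (k + 1)))).re : ℝ) : ℂ) := by
    rw [w1.tsum_sub c1, tsum_mul_left, Complex.sub_re, Complex.re_ofReal_mul, expansion,
      saddleSeries_zero]
    rw [← hS, Complex.ofReal_mul] at w2
    rw [mul_sub, w2]
    push_cast
    ring
  have hnorm : S * ‖((wp n (x ^ (-2 : ℤ)) : ℝ) : ℂ) - expansion N x n σ‖
      ≤ C * (1 + 2 * ∑' k, d k) * peak x n t * E := by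
    have e2 := congrArg norm e
    rw [norm_mul, Complex.norm_real, Real.norm_of_nonneg hS0.le] at e2
    rw [e2]
    refine (norm_add_le _ _).trans ?_
    rw [Complex.norm_real, norm_mul, Real.norm_two, Real.norm_eq_abs]
    have b3 := (Complex.abs_re_le_norm _).trans b2
    have b4 : ‖window x n t 0 - S * contribution N x n 0 (σ 0)‖ ≤ C * peak x n t * E := by
      simp only [Nat.cast_zero] at b0
      rw [← hE, show Real.exp (-(Real.pi ^ 2 * 0 ^ 2 / (8 * Real.log x))) = 1 by simp,
        mul_one] at b0
      exact b0
    linarith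
  rw [show C * (1 + 2 * ∑' k, d k) / S * peak x n t * E
    = C * (1 + 2 * ∑' k, d k) * peak x n t * E / S by ring, le_div_iff₀ hS0]
  linarith

/-- The remainder after the term `j = N`, measured against the leading factor of the saddle
`s_0`. -/
lemma exists_norm_wp_sub_expansion_le_prefactor : ∃ C : ℝ, 0 < C ∧ ∀ᶠ n : ℕ in atTop,
    ∀ σ : ℕ → ℂ, (∀ k, IsSaddleShift x n k (σ k)) → ∀ N ≤ 3,
      ‖((wp n (x ^ (-2 : ℤ)) : ℝ) : ℂ) - expansion N x n σ‖
        ≤ C * ‖prefactor x n 0 (σ 0) / (Real.log n : ℂ) ^ (N + 1)‖ := by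
  obtain ⟨C, hC, h⟩ := exists_norm_wp_sub_expansion_le hx
  refine ⟨C * 2, by positivity, ?_⟩
  filter_upwards [h, eventually_peak_le hx, eventually_ge_atTop 2] with n h hp hn σ hσ N hN
  obtain ⟨t, ht, -⟩ := existsUnique_isPosRoot hx (n := n) (by omega)
  have hl : 0 ≤ Real.log n := Real.log_natCast_nonneg n
  have hpk := peak_pos hx n t
  refine (h σ t hσ ht N hN).trans ?_
  rw [eq_root_of_zero hx hn (hσ 0) ht, prefactor_root hx hn ht, norm_div, norm_pow,
    Complex.norm_real, Complex.norm_real, Real.norm_of_nonneg hl,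
    Real.norm_of_nonneg (by positivity), mul_inv]
  calc C * peak x n t * ((Real.log n ^ (N + 1))⁻¹ * (√(Real.log n))⁻¹)
      = C * (peak x n t * (√(Real.log n))⁻¹) * (Real.log n ^ (N + 1))⁻¹ := by ring
    _ ≤ C * (2 * (peak x n t / √(1 + t * (1 - t / scale x n)))) * (Real.log n ^ (N + 1))⁻¹ := by
      have := hp t ht
      gcongr
    _ = _ := by ring

/-! ### Boundedness of the coefficients and dominance of the saddle `s_0` -/

lemma eventually_norm_inv_nat_mul_lam_le (k : ℕ) : ∀ᶠ n : ℕ in atTop, ∀ σ : ℂ,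
    IsSaddleShift x n k σ →
      ‖1 / (n * lam x (shift k σ))‖ ≤ (4 * Real.log x + 1) / Real.log n := by
  have hL0 := Real.log_pos hx
  filter_upwards [eventually_isCentral hx, eventually_ge_atTop 2,
    tendsto_log_nat.eventually_ge_atTop 1, tendsto_log_nat.eventually_ge_atTop ((k : ℝ) ^ 2)]
    with n hc hn hl hk σ h
  have hC := hc k σ hk h
  have h1 := norm_inv_nat_mul_lam_le hx hn h
  have hl0 : 0 < Real.log n := by linarith
  have hs : Real.log n / 2 ≤ ‖shift k σ‖ :=
    hC.half_log_le.trans ((le_abs_self _).trans (Complex.abs_im_le_norm _))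
  have h2 : 2 * Real.log x / ‖shift k σ‖ ≤ 2 * Real.log x / (Real.log n / 2) := by gcongr
  have h3 : (1 : ℝ) / n ≤ 1 / Real.log n := by
    gcongr
    exact Real.log_le_self (Nat.cast_nonneg n)
  calc _ ≤ 2 * Real.log x / (Real.log n / 2) + 1 / Real.log n := by linarith
    _ = _ := by field_simp; ring

lemma coeff_isBigO {σ : ℕ → ℕ → ℂ}
    (hσ : ∀ᶠ n : ℕ in atTop, ∀ k : ℕ, IsSaddleShift x n k (σ n k)) (j k : ℕ) :
    (fun n : ℕ => coeff x n (shift k (σ n k)) j) =O[atTop] fun _ : ℕ => (1 : ℝ) := by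
  have hL0 := Real.log_pos hx
  obtain ⟨C, hC, hb⟩ := exists_norm_reducedCoeff_le (1 / Real.log x)
  refine IsBigO.of_bound (C * (4 * Real.log x + 1) ^ j) ?_
  filter_upwards [hσ, eventually_ge_atTop 2, eventually_norm_inv_nat_mul_lam_le hx k,
    tendsto_log_nat.eventually_ge_atTop 1] with n h hn hw hl
  have h1 := hb _ _ (norm_aCoef_le hx hn (h k)) (norm_lam_le_one hx hn (h k))
    (one_le_norm_one_add_two_aCoef hx hn (h k)) j
  have h2 := hw _ (h k)
  have h3 : ‖chi x n (shift k (σ n k))‖ ≤ 4 * Real.log x + 1 := by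
    rw [chi, div_eq_mul_one_div, norm_mul, Complex.norm_real, Real.norm_of_nonneg (by linarith)]
    rw [le_div_iff₀ (by linarith)] at h2
    linarith
  rw [coeff_eq, norm_mul, norm_pow, norm_one, mul_one]
  gcongr

/-- The factor `e^{-π²/(4 log x)} < 1` lost on the way from `s_0` to any other saddle outweighs the
discrepancies of the square roots and of the truncated series, which tend to one. -/
lemma eventually_norm_contribution_lt {N : ℕ} (hN : N ≤ 3) {k : ℕ} (hk : 1 ≤ k) :
    ∀ᶠ n : ℕ in atTop, ∀ σ σ₀ : ℂ, IsSaddleShift x n k σ → IsSaddleShift x n 0 σ₀ →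
      ‖contribution N x n k σ‖ < ‖saddleSeries N x n 0 σ₀‖ := by
  have hL0 := Real.log_pos hx
  have hpi := Real.pi_pos
  obtain ⟨C, hC, hb⟩ := exists_norm_truncSeries_sub_le (1 / Real.log x)
  set B := C * (4 * Real.log x + 1) with hB
  set q := gaussDecay x k with hq
  have hq0 : 0 < q := gaussDecay_pos x k
  have hq1 : q < 1 := by
    rw [hq, gaussDecay, Real.exp_lt_one_iff, neg_lt_zero]
    have : (0 : ℝ) < k := by exact_mod_cast hk
    positivity
  have hinv : Tendsto (fun n : ℕ => (Real.log n)⁻¹) atTop (𝓝 0) :=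
    tendsto_inv_atTop_zero.comp tendsto_log_nat
  have hlim : Tendsto (fun n : ℕ => q * (1 + B * (Real.log n)⁻¹) * √(1 + 10 * (Real.log n)⁻¹))
      atTop (𝓝 (q * (1 + B * 0) * √(1 + 10 * 0))) :=
    (((hinv.const_mul B).const_add 1).const_mul q).mul ((hinv.const_mul 10).const_add 1).sqrt
  have hlim2 : Tendsto (fun n : ℕ => 1 - B * (Real.log n)⁻¹) atTop (𝓝 (1 - B * 0)) :=
    (hinv.const_mul B).const_sub 1
  have hlt := hlim.eventually_lt hlim2 (by simpa using hq1)
  filter_upwards [hlt, eventually_norm_inv_nat_mul_lam_le hx k,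
    eventually_norm_inv_nat_mul_lam_le hx 0, eventually_root_sub_im_le hx, eventually_isCentral hx,
    tendsto_log_nat.eventually_ge_atTop 1, tendsto_log_nat.eventually_ge_atTop ((k : ℝ) ^ 2),
    eventually_ge_atTop 2, eventually_log_pow_le_nat 2 (c := Real.log x / 2) (by positivity)]
    with n hlt hw hw0 hdiff hcent hl hkl hn hlog σ σ₀ h h0
  obtain ⟨t, ht, -⟩ := existsUnique_isPosRoot hx (n := n) (by omega)
  obtain rfl := eq_root_of_zero hx hn h0 ht
  have hM := scale_pos hx (n := n) (by omega)
  have hp := peak_pos hx n t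
  have ht0 := ht.1
  have hl0 : 0 < Real.log n := by linarith
  have hCe := hcent k σ hkl h
  set η := (shift k σ).im with hη
  have hη1 : Real.log n / 2 ≤ η := hCe.half_log_le
  have hη0 : 0 < η := by linarith
  have htη : t ≤ η + 4 := by linarith [hdiff k σ t hkl h ht]
  -- the truncated series are close to one
  have series : ∀ (j : ℕ) (s : ℂ), IsSaddleShift x n j s →
      ‖1 / (n * lam x (shift j s))‖ ≤ (4 * Real.log x + 1) / Real.log n →
      ‖truncSeries N (aCoef x n (shift j s)) (lam x (shift j s)) (1 / (n * lam x (shift j s))) - 1‖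
        ≤ B * (Real.log n)⁻¹ := by
    intro j s hs hws
    have h1 := hb _ _ _ (norm_aCoef_le hx hn hs) (norm_lam_le_one hx hn hs)
      (one_le_norm_one_add_two_aCoef hx hn hs) (norm_inv_nat_mul_lam_le_three hx hn hs) 0 N
      (Nat.zero_le _) hN
    rw [truncSeries_zero, zero_add, pow_one] at h1
    refine h1.trans ?_
    calc _ ≤ C * ((4 * Real.log x + 1) / Real.log n) := by gcongr
      _ = _ := by rw [hB]; ring
  have s1 := series k σ h (hw σ h)
  have s0 := series 0 _ h0 (hw0 _ h0)
  rw [saddleSeries_zero, contribution_eq hx hn h, contribution_eq hx hn h0, norm_mul, norm_mul,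
    norm_div, norm_div, norm_cpow_half, norm_cpow_half]
  set T := truncSeries N (aCoef x n (shift k σ)) (lam x (shift k σ))
    (1 / (n * lam x (shift k σ))) with hT
  set T₀ := truncSeries N (aCoef x n (shift 0 (Complex.I * t))) (lam x (shift 0 (Complex.I * t)))
    (1 / (n * lam x (shift 0 (Complex.I * t)))) with hT0
  have u1 : ‖T‖ ≤ 1 + B * (Real.log n)⁻¹ := by
    have := norm_add_le (T - 1) 1
    rw [sub_add_cancel, norm_one] at this
    linarith
  have u0 : 1 - B * (Real.log n)⁻¹ ≤ ‖T₀‖ := by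
    have := norm_sub_norm_le 1 T₀
    rw [norm_one, norm_sub_rev] at this
    linarith
  have v1 : ‖integrand x n (shift k σ)‖ ≤ q * peak x n t := by
    refine (norm_integrand_le hx hn h ht).trans ?_
    have := exp_neg_re_sq_le_gaussDecay hx hn h
    gcongr
  have v0 : ‖integrand x n (shift 0 (Complex.I * t))‖ = peak x n t := by
    rw [shift_zero, integrand_I_mul, Complex.norm_real, Real.norm_of_nonneg hp.le]
  have w1 : η ≤ ‖1 + omega x n (shift k σ)‖ := by
    refine le_trans ?_ (Complex.re_le_norm _)
    have h1 := omega_re_ge hx hn h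
    have h2 : η * (η / scale x n) ≤ 1 := by
      rw [← mul_div_assoc, div_le_one hM, scale]
      have := hCe.im_le
      nlinarith
    simp only [Complex.add_re, Complex.one_re]
    linarith [mul_sub η 1 (η / scale x n)]
  have w0 : ‖1 + omega x n (shift 0 (Complex.I * t))‖ ≤ η + 5 := by
    rw [shift_zero, omega_root hx hn ht]
    refine (norm_add_le _ _).trans ?_
    have h1 : t / scale x n ≤ 1 := (div_le_one hM).mpr (root_lt_scale hx ht).le
    have h3 : 0 ≤ t / scale x n := by positivity
    rw [norm_one, Complex.norm_real, Real.norm_of_nonneg (by nlinarith)]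
    nlinarith
  have w2 : √‖1 + omega x n (shift 0 (Complex.I * t))‖
      ≤ √(1 + 10 * (Real.log n)⁻¹) * √‖1 + omega x n (shift k σ)‖ := by
    rw [← Real.sqrt_mul (by positivity)]
    refine Real.sqrt_le_sqrt (w0.trans ?_)
    have : 5 ≤ 10 * (Real.log n)⁻¹ * η := by
      rw [← div_eq_mul_inv, div_mul_eq_mul_div, le_div_iff₀ hl0]
      linarith
    calc η + 5 ≤ (1 + 10 * (Real.log n)⁻¹) * η := by linarith
      _ ≤ _ := by gcongr
  have p1 : 0 < √‖1 + omega x n (shift k σ)‖ := Real.sqrt_pos.mpr (by linarith)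
  have p0 : 0 < √‖1 + omega x n (shift 0 (Complex.I * t))‖ :=
    Real.sqrt_pos.mpr (by linarith [one_le_norm_one_add_omega hx hn h0])
  rw [v0, div_mul_eq_mul_div, div_mul_eq_mul_div, div_lt_div_iff₀ p1 p0]
  have hB0 : 0 ≤ B := by positivity
  calc ‖integrand x n (shift k σ)‖ * ‖T‖ * √‖1 + omega x n (shift 0 (Complex.I * t))‖
      ≤ (q * peak x n t) * (1 + B * (Real.log n)⁻¹)
        * (√(1 + 10 * (Real.log n)⁻¹) * √‖1 + omega x n (shift k σ)‖) := by gcongr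
    _ = (q * (1 + B * (Real.log n)⁻¹) * √(1 + 10 * (Real.log n)⁻¹))
        * (peak x n t * √‖1 + omega x n (shift k σ)‖) := by ring
    _ < (1 - B * (Real.log n)⁻¹) * (peak x n t * √‖1 + omega x n (shift k σ)‖) := by gcongr
    _ ≤ ‖T₀‖ * (peak x n t * √‖1 + omega x n (shift k σ)‖) := by gcongr
    _ = _ := by ring

end

/-! ### The theta function -/

lemma integral_abs_mul_exp_le {a : ℝ} (ha : 0 < a) :
    ∫ u in (-Real.pi)..Real.pi, |u| * Real.exp (-(a * u ^ 2)) ≤ 1 / a := by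
  have hpi := Real.pi_pos
  have hc : Continuous fun u : ℝ => |u| * Real.exp (-(a * u ^ 2)) := by fun_prop
  have hhalf : ∫ u in (0 : ℝ)..Real.pi, |u| * Real.exp (-(a * u ^ 2)) ≤ 1 / (2 * a) := by
    have e : ∫ u in (0 : ℝ)..Real.pi, |u| * Real.exp (-(a * u ^ 2))
        = ∫ u in (0 : ℝ)..Real.pi, u * Real.exp (-(a * u ^ 2)) := by
      refine intervalIntegral.integral_congr fun u hu => ?_
      rw [Set.uIcc_of_le hpi.le] at hu
      simp only [abs_of_nonneg hu.1]
    have hd : ∀ u ∈ Set.uIcc 0 Real.pi,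
        HasDerivAt (fun u : ℝ => -(1 / (2 * a)) * Real.exp (-(a * u ^ 2)))
          (u * Real.exp (-(a * u ^ 2))) u := by
      intro u _
      have h := ((((hasDerivAt_pow 2 u).const_mul a).neg).exp).const_mul (-(1 / (2 * a)))
      refine h.congr_deriv ?_
      push_cast
      field_simp
      exact mul_comm _ _
    rw [e, intervalIntegral.integral_eq_sub_of_hasDerivAt hd
      (by apply Continuous.intervalIntegrable; fun_prop)]
    have := Real.exp_pos (-(a * Real.pi ^ 2))
    have h2 : 0 < 1 / (2 * a) := by positivity
    simp
    positivity
  have hneg : ∫ u in (-Real.pi)..0, |u| * Real.exp (-(a * u ^ 2))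
      = ∫ u in (0 : ℝ)..Real.pi, |u| * Real.exp (-(a * u ^ 2)) := by
    have := intervalIntegral.integral_comp_neg (a := -Real.pi) (b := 0)
      (fun u : ℝ => |u| * Real.exp (-(a * u ^ 2)))
    simpa using this
  rw [← intervalIntegral.integral_add_adjacent_intervals (b := 0)
    (hc.intervalIntegrable _ _) (hc.intervalIntegrable _ _), hneg]
  calc _ ≤ 1 / (2 * a) + 1 / (2 * a) := add_le_add hhalf hhalf
    _ = _ := by field_simp; norm_num

lemma norm_one_add_mul_exp_le {l u : ℝ} (hl : 0 ≤ l) (hu : |u| ≤ Real.pi) :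
    ‖1 + (l : ℂ) * Complex.exp (Complex.I * u)‖
      ≤ (1 + l) * Real.exp (-(2 * (l / (1 + l) ^ 2) * u ^ 2 / Real.pi ^ 2)) := by
  have hpi := Real.pi_pos
  have h1 := Real.cos_le_one_sub_mul_cos_sq hu
  have e : ‖1 + (l : ℂ) * Complex.exp (Complex.I * u)‖ ^ 2 = 1 + 2 * l * Real.cos u + l ^ 2 := by
    rw [Complex.sq_norm, mul_comm Complex.I, Complex.exp_mul_I, ← Complex.ofReal_cos,
      ← Complex.ofReal_sin, Complex.normSq_apply]
    have h2 : (1 + (l : ℂ) * ((Real.cos u : ℂ) + (Real.sin u : ℂ) * Complex.I)).re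
        = 1 + l * Real.cos u := by simp [-Complex.ofReal_cos, -Complex.ofReal_sin]
    have h3 : (1 + (l : ℂ) * ((Real.cos u : ℂ) + (Real.sin u : ℂ) * Complex.I)).im
        = l * Real.sin u := by simp [-Complex.ofReal_cos, -Complex.ofReal_sin]
    rw [h2, h3]
    linear_combination l ^ 2 * Real.sin_sq_add_cos_sq u
  have h2 := Real.add_one_le_exp (-(4 * (l / (1 + l) ^ 2) * u ^ 2 / Real.pi ^ 2))
  refine le_of_sq_le_sq ?_ (by positivity)
  rw [e, mul_pow, ← Real.exp_nat_mul]
  have e2 : ((2 : ℕ) : ℝ) * -(2 * (l / (1 + l) ^ 2) * u ^ 2 / Real.pi ^ 2)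
      = -(4 * (l / (1 + l) ^ 2) * u ^ 2 / Real.pi ^ 2) := by push_cast; ring
  rw [e2]
  calc 1 + 2 * l * Real.cos u + l ^ 2
      ≤ 1 + 2 * l * (1 - 2 / Real.pi ^ 2 * u ^ 2) + l ^ 2 := by gcongr
    _ = (1 + l) ^ 2 * (-(4 * (l / (1 + l) ^ 2) * u ^ 2 / Real.pi ^ 2) + 1) := by
      have : 1 + l ≠ 0 := by positivity
      field_simp
      ring
    _ ≤ _ := by gcongr

/-- The factor by which the window `k` differs from the window `0`, to leading order. -/
def windowPhase (x : ℝ) (t : ℝ) (k : ℕ) : ℂ :=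
  Complex.exp (-((Real.pi : ℂ) ^ 2 * k ^ 2 + Real.pi * k * (Complex.I * t)) / Real.log x)

lemma windowPhase_re (x t : ℝ) (k : ℕ) : (windowPhase x t k).re
    = Real.exp (-(Real.pi ^ 2 * k ^ 2 / Real.log x)) * Real.cos (Real.pi * k * t / Real.log x) := by
  rw [windowPhase, Complex.exp_re]
  have e : (-((Real.pi : ℂ) ^ 2 * k ^ 2 + Real.pi * k * (Complex.I * t)) / Real.log x)
      = ((-(Real.pi ^ 2 * k ^ 2 / Real.log x) : ℝ) : ℂ)
        + ((-(Real.pi * k * t / Real.log x) : ℝ) : ℂ) * Complex.I := by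
    push_cast; ring
  rw [e, Complex.add_re, Complex.add_im, Complex.re_ofReal_mul, Complex.im_ofReal_mul,
    Complex.ofReal_re, Complex.ofReal_im, Complex.I_re, Complex.I_im]
  simp

lemma norm_windowPhase (x t : ℝ) (k : ℕ) :
    ‖windowPhase x t k‖ = Real.exp (-(Real.pi ^ 2 * k ^ 2 / Real.log x)) := by
  rw [windowPhase, Complex.norm_exp]
  congr 1
  have e : (-((Real.pi : ℂ) ^ 2 * k ^ 2 + Real.pi * k * (Complex.I * t)) / Real.log x)
      = ((-(Real.pi ^ 2 * k ^ 2 / Real.log x) : ℝ) : ℂ)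
        + ((-(Real.pi * k * t / Real.log x) : ℝ) : ℂ) * Complex.I := by
    push_cast; ring
  rw [e, Complex.add_re, Complex.re_ofReal_mul, Complex.ofReal_re, Complex.I_re]
  simp

lemma theta_eq (x t : ℝ) :
    theta (x ^ 2) t = 1 + 2 * ∑' k : ℕ, (windowPhase x t (k + 1)).re := by
  rw [theta, Real.log_pow]
  congr 3
  funext k
  rw [windowPhase_re]
  push_cast
  congr 2
  · rw [neg_div, mul_assoc, mul_div_mul_left _ _ two_ne_zero]
  · rw [mul_assoc 2, mul_assoc 2, mul_div_mul_left _ _ two_ne_zero]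

lemma abs_exp_neg_sub_one_le (y : ℝ) : |Real.exp (-y) - 1| ≤ |y| * Real.exp |y| := by
  have h1 : Real.exp (-y) * Real.exp y = 1 := by rw [← Real.exp_add]; simp
  have h2 := mul_le_mul_of_nonneg_left (Real.add_one_le_exp y) (Real.exp_pos (-y)).le
  have h3 := Real.add_one_le_exp (-y)
  have h4 : Real.exp (-y) ≤ Real.exp |y| := Real.exp_le_exp.mpr (neg_le_abs y)
  have h5 : 1 ≤ Real.exp |y| := Real.one_le_exp (abs_nonneg y)
  have h6 := abs_nonneg y
  refine abs_le.mpr ⟨?_, ?_⟩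
  · nlinarith [le_abs_self y]
  · calc Real.exp (-y) - 1 ≤ -y * Real.exp (-y) := by linarith
      _ ≤ |y| * Real.exp (-y) := by gcongr; exact neg_le_abs y
      _ ≤ _ := by gcongr

section

variable {x : ℝ} (hx : 1 < x)

include hx

lemma summable_windowPhase (t : ℝ) : Summable fun k : ℕ => windowPhase x t (k + 1) := by
  have hL0 := Real.log_pos hx
  have hpi := Real.pi_pos
  refine Summable.of_norm_bounded
    (summable_exp_neg_sq (c := Real.pi ^ 2 / Real.log x) (by positivity)) fun k => ?_
  rw [norm_windowPhase]
  push_cast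
  exact le_of_eq (by congr 1; ring)

lemma exists_abs_theta_le : ∃ C : ℝ, ∀ t : ℝ, |theta (x ^ 2) t| ≤ C := by
  have hL0 := Real.log_pos hx
  have hpi := Real.pi_pos
  have hs := summable_exp_neg_sq (c := Real.pi ^ 2 / Real.log x) (by positivity)
  refine ⟨1 + 2 * ∑' k : ℕ, Real.exp (-(Real.pi ^ 2 / Real.log x * ((k : ℝ) + 1) ^ 2)),
    fun t => ?_⟩
  have h := tsum_of_norm_bounded hs.hasSum (f := fun k : ℕ => (windowPhase x t (k + 1)).re)
    fun k => by
      refine (Complex.abs_re_le_norm _).trans ?_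
      rw [norm_windowPhase]
      push_cast
      exact le_of_eq (by congr 1; ring)
  rw [theta_eq]
  refine (abs_add_le _ _).trans ?_
  rw [abs_one, abs_mul, abs_two]
  rw [Real.norm_eq_abs] at h
  linarith

lemma integrand_add_two_pi_mul (n k : ℕ) (t u : ℝ) :
    integrand x n ((u + 2 * Real.pi * k : ℝ) + t * Complex.I)
      = integrand x n (u + t * Complex.I) * (windowPhase x t k
        * (Real.exp (-(Real.pi * k * u / Real.log x)) : ℝ)) := by
  have hL : (Real.log x : ℂ) ≠ 0 := by exact_mod_cast (Real.log_pos hx).ne'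
  have e1 : lam x ((u + 2 * Real.pi * k : ℝ) + t * Complex.I) = lam x (u + t * Complex.I) := by
    rw [lam, lam, show Complex.I * (((u + 2 * Real.pi * k : ℝ) : ℂ) + t * Complex.I)
      = Complex.I * (u + t * Complex.I) + k * (2 * Real.pi * Complex.I) by push_cast; ring,
      Complex.exp_add, Complex.exp_nat_mul_two_pi_mul_I, mul_one]
  rw [integrand, integrand, e1, windowPhase]
  push_cast
  rw [← Complex.exp_add, mul_right_comm (Complex.exp _), ← Complex.exp_add]
  congr 2
  field_simp
  ring

lemma norm_integrand_root_le {n : ℕ} (hn : 2 ≤ n) {t : ℝ} (ht : IsPosRoot (x ^ 2) n t)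
    (htM : t / scale x n ≤ 1 / 2) {u : ℝ} (hu : |u| ≤ Real.pi) :
    ‖integrand x n (u + t * Complex.I)‖
      ≤ peak x n t * Real.exp (-(t / (2 * Real.log x * Real.pi ^ 2) * u ^ 2)) := by
  have hx0 : 0 < x := by linarith
  have hL0 := Real.log_pos hx
  have hpi := Real.pi_pos
  have hM := scale_pos hx (n := n) (by omega)
  have ht0 := ht.1
  have hlt := root_lt_scale hx ht
  have hn0 : (0 : ℝ) < n := by exact_mod_cast (by omega : 0 < n)
  set l := x * Real.exp (-t) with hl
  have hl0 : 0 < l := by positivity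
  have e1 : lam x (u + t * Complex.I) = (l : ℂ) * Complex.exp (Complex.I * u) := by
    rw [lam, mul_add, Complex.exp_add, show Complex.I * (t * Complex.I) = ((-t : ℝ) : ℂ) by
      push_cast; linear_combination (t : ℂ) * Complex.I_sq, hl]
    push_cast
    ring
  have h1 := norm_one_add_mul_exp_le hl0.le hu
  -- the exponent is governed by `n λ / (1 + λ)² = t (1 - t / M) / (2 log x)`
  have h2 : t / (4 * Real.log x) ≤ n * (l / (1 + l) ^ 2) := by
    have e2 := one_add_lam_root hx ht
    rw [← hl] at e2
    have hne : scale x n - t ≠ 0 := by linarith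
    have e3 : l = t / (scale x n - t) := by
      have : l = scale x n / (scale x n - t) - 1 := by linarith
      rw [this]; field_simp; ring
    have e4 : n * (l / (1 + l) ^ 2) = t * (1 - t / scale x n) / (2 * Real.log x) := by
      rw [e2, e3]
      have : (n : ℝ) = scale x n / (2 * Real.log x) := by rw [scale]; field_simp
      rw [this]
      field_simp
    rw [e4, div_le_div_iff₀ (by positivity) (by positivity)]
    nlinarith [mul_pos ht0 hL0]
  have h3 : Real.exp (-(2 * (l / (1 + l) ^ 2) * u ^ 2 / Real.pi ^ 2)) ^ n
      ≤ Real.exp (-(t / (2 * Real.log x * Real.pi ^ 2) * u ^ 2)) := by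
    rw [← Real.exp_nat_mul, Real.exp_le_exp]
    have : t / (2 * Real.log x * Real.pi ^ 2) * u ^ 2
        = t / (4 * Real.log x) * (2 * u ^ 2 / Real.pi ^ 2) := by field_simp; ring
    rw [this]
    have h4 : t / (4 * Real.log x) * (2 * u ^ 2 / Real.pi ^ 2)
        ≤ n * (l / (1 + l) ^ 2) * (2 * u ^ 2 / Real.pi ^ 2) := by gcongr
    calc _ = -(n * (l / (1 + l) ^ 2) * (2 * u ^ 2 / Real.pi ^ 2)) := by ring
      _ ≤ _ := by linarith
  have h5 : Real.exp (-(u ^ 2 / (4 * Real.log x))) ≤ 1 := by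
    rw [Real.exp_le_one_iff, neg_nonpos]; positivity
  rw [integrand, norm_mul, norm_exp_gauss_line x, norm_pow, e1, peak]
  calc _ ≤ Real.exp (t ^ 2 / (4 * Real.log x)) * 1
        * ((1 + l) * Real.exp (-(2 * (l / (1 + l) ^ 2) * u ^ 2 / Real.pi ^ 2))) ^ n := by gcongr
    _ = Real.exp (t ^ 2 / (4 * Real.log x)) * (1 + l) ^ n
        * Real.exp (-(2 * (l / (1 + l) ^ 2) * u ^ 2 / Real.pi ^ 2)) ^ n := by
      rw [mul_pow]; ring
    _ ≤ _ := by gcongr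

/-- On the line of the root all windows are translates of the central one, up to a factor
`e^{-πku/log x}`, which the concentration of the integrand at `u = 0` makes close to one. -/
lemma norm_window_sub_phase_mul_le {n : ℕ} (hn : 2 ≤ n) {t : ℝ} (ht : IsPosRoot (x ^ 2) n t)
    (htM : t / scale x n ≤ 1 / 2) (k : ℕ) :
    ‖window x n t k - windowPhase x t k * window x n t 0‖
      ≤ 2 * Real.pi ^ 3 * (k * Real.exp (-(Real.pi ^ 2 * (k * (k - 1)) / Real.log x)))
        * (peak x n t / t) := by
  have hL0 := Real.log_pos hx
  have hpi := Real.pi_pos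
  have ht0 := ht.1
  have hp := peak_pos hx n t
  set F : ℝ → ℂ := fun u => integrand x n (u + t * Complex.I) with hF
  have hFc : Continuous F := (differentiable_integrand x n).continuous.comp (by fun_prop)
  have e0 : window x n t 0 = ∫ u in (-Real.pi)..Real.pi, F u := by
    rw [window]; simp [hF]
  have ek : window x n t k = ∫ u in (-Real.pi)..Real.pi, F u * (windowPhase x t k
      * (Real.exp (-(Real.pi * k * u / Real.log x)) : ℝ)) := by
    have := intervalIntegral.integral_comp_add_right (a := -Real.pi) (b := Real.pi)
      (fun v : ℝ => integrand x n (v + t * Complex.I)) (2 * Real.pi * k)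
    rw [window]
    rw [show -Real.pi + 2 * Real.pi * k = 2 * Real.pi * ((k : ℤ) : ℝ) - Real.pi by
        push_cast; ring,
      show Real.pi + 2 * Real.pi * k = 2 * Real.pi * ((k : ℤ) : ℝ) + Real.pi by
        push_cast; ring] at this
    rw [← this]
    exact intervalIntegral.integral_congr fun u _ => integrand_add_two_pi_mul hx n k t u
  set a := t / (2 * Real.log x * Real.pi ^ 2) with ha
  have ha0 : 0 < a := by positivity
  set K := Real.pi * k / Real.log x * Real.exp (-(Real.pi ^ 2 * (k * (k - 1)) / Real.log x))
    * peak x n t with hK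
  have hK0 : 0 ≤ K := by positivity
  have ed : window x n t k - windowPhase x t k * window x n t 0
      = ∫ u in (-Real.pi)..Real.pi, F u * (windowPhase x t k
        * ((Real.exp (-(Real.pi * k * u / Real.log x)) - 1 : ℝ) : ℂ)) := by
    rw [ek, e0, ← intervalIntegral.integral_const_mul, ← intervalIntegral.integral_sub]
    · refine intervalIntegral.integral_congr fun u _ => ?_
      push_cast
      ring
    · apply Continuous.intervalIntegrable; fun_prop
    · apply Continuous.intervalIntegrable; fun_prop
  rw [ed]
  have hbound : ∀ u ∈ Set.Ioc (-Real.pi) Real.pi, ‖F u * (windowPhase x t k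
        * ((Real.exp (-(Real.pi * k * u / Real.log x)) - 1 : ℝ) : ℂ))‖
      ≤ K * (|u| * Real.exp (-(a * u ^ 2))) := by
    intro u hu
    have hu' : |u| ≤ Real.pi := abs_le.mpr ⟨hu.1.le, hu.2⟩
    have h1 := norm_integrand_root_le hx hn ht htM hu'
    have h2 := abs_exp_neg_sub_one_le (Real.pi * k * u / Real.log x)
    have e2 : |Real.pi * k * u / Real.log x| = Real.pi * k / Real.log x * |u| := by
      rw [abs_div, abs_mul, abs_of_nonneg (by positivity : 0 ≤ Real.pi * k), abs_of_pos hL0]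
      ring
    rw [e2] at h2
    have h3 : Real.exp (Real.pi * k / Real.log x * |u|)
        ≤ Real.exp (Real.pi * k / Real.log x * Real.pi) := by gcongr
    have e3 : Real.exp (-(Real.pi ^ 2 * k ^ 2 / Real.log x))
        * Real.exp (Real.pi * k / Real.log x * Real.pi)
        = Real.exp (-(Real.pi ^ 2 * (k * (k - 1)) / Real.log x)) := by
      rw [← Real.exp_add]; congr 1; ring
    rw [norm_mul, norm_mul, norm_windowPhase, Complex.norm_real, Real.norm_eq_abs]
    calc _ ≤ (peak x n t * Real.exp (-(a * u ^ 2)))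
          * (Real.exp (-(Real.pi ^ 2 * k ^ 2 / Real.log x))
          * (Real.pi * k / Real.log x * |u| * Real.exp (Real.pi * k / Real.log x * Real.pi))) := by
          gcongr
          exact h2.trans (by gcongr)
      _ = Real.pi * k / Real.log x * (Real.exp (-(Real.pi ^ 2 * k ^ 2 / Real.log x))
        * Real.exp (Real.pi * k / Real.log x * Real.pi)) * peak x n t
          * (|u| * Real.exp (-(a * u ^ 2))) := by ring
      _ = _ := by rw [e3, hK]
  have h := intervalIntegral.norm_integral_le_of_norm_le (by linarith : -Real.pi ≤ Real.pi)
    (Filter.Eventually.of_forall hbound) (μ := MeasureTheory.volume)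
    (by apply Continuous.intervalIntegrable; fun_prop)
  refine h.trans ?_
  rw [intervalIntegral.integral_const_mul]
  calc _ ≤ K * (1 / a) := by gcongr; exact integral_abs_mul_exp_le ha0
    _ = _ := by rw [hK, ha]; field_simp

/-- The polynomial is the central window times the theta function, up to an error smaller than the
window by a factor of order `t^{-1/2}`. -/
lemma exists_abs_wp_sub_le : ∃ C : ℝ, 0 < C ∧ ∀ n : ℕ, 2 ≤ n → ∀ t : ℝ, IsPosRoot (x ^ 2) n t →
    t / scale x n ≤ 1 / 2 →
      |√(4 * Real.pi * Real.log x) * wp n (x ^ (-2 : ℤ)) - (window x n t 0).re * theta (x ^ 2) t|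
        ≤ C * (peak x n t / t) := by
  have hL0 := Real.log_pos hx
  have hpi := Real.pi_pos
  set d : ℕ → ℝ := fun k => 2 * Real.pi ^ 3 * (((k : ℝ) + 1)
    * Real.exp (-(Real.pi ^ 2 * (((k : ℝ) + 1) * k) / Real.log x))) with hd
  have hds : Summable d := by
    refine Summable.mul_left _ ?_
    set c := Real.pi ^ 2 / Real.log x with hc
    have hc0 : 0 < c := by positivity
    refine Summable.of_nonneg_of_le (fun k => by positivity) (fun k => ?_)
      ((Real.summable_pow_mul_exp_neg_nat_mul 1 hc0).add
        (Real.summable_pow_mul_exp_neg_nat_mul 0 hc0))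
    have hk : (0 : ℝ) ≤ k := Nat.cast_nonneg k
    have : Real.exp (-(Real.pi ^ 2 * (((k : ℝ) + 1) * k) / Real.log x)) ≤ Real.exp (-c * k) := by
      rw [Real.exp_le_exp, hc]
      have : 0 ≤ Real.pi ^ 2 / Real.log x * k ^ 2 := by positivity
      calc _ = -(Real.pi ^ 2 / Real.log x) * k - Real.pi ^ 2 / Real.log x * k ^ 2 := by ring
        _ ≤ _ := by linarith
    calc _ ≤ ((k : ℝ) + 1) * Real.exp (-c * k) := by gcongr
      _ = _ := by ring
  have hd0 : 0 ≤ ∑' k, d k := tsum_nonneg fun k => by positivity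
  refine ⟨2 * (∑' k, d k) + 1, by positivity, fun n hn t ht htM => ?_⟩
  have ht0 := ht.1
  have hp := peak_pos hx n t
  obtain ⟨w1, w2⟩ := hasSum_window_nat hx n t
  have hsp := (summable_windowPhase hx t).mul_right (window x n t 0)
  have b : ‖∑' k : ℕ, (window x n t ((k + 1 : ℕ) : ℤ) - windowPhase x t (k + 1) * window x n t 0)‖
      ≤ (∑' k, d k) * (peak x n t / t) := by
    refine tsum_of_norm_bounded (hds.hasSum.mul_right _) fun k => ?_
    refine (norm_window_sub_phase_mul_le hx hn ht htM (k + 1)).trans (le_of_eq ?_)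
    rw [hd]
    push_cast
    congr 5
    ring
  have hreal : window x n t 0 = ((window x n t 0).re : ℂ) := by
    have h := window_neg x n t 0
    rw [neg_zero] at h
    exact (Complex.conj_eq_iff_re.mp h.symm).symm
  rw [w1.tsum_sub hsp, tsum_mul_right] at b
  have b2 := (Complex.abs_re_le_norm _).trans b
  have w3 := congrArg Complex.re w2
  rw [Complex.ofReal_re, Complex.add_re, Complex.ofReal_re] at w3
  have e : √(4 * Real.pi * Real.log x) * wp n (x ^ (-2 : ℤ))
      - (window x n t 0).re * theta (x ^ 2) t
      = 2 * (∑' k : ℕ, window x n t ((k + 1 : ℕ) : ℤ)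
        - (∑' k : ℕ, windowPhase x t (k + 1)) * window x n t 0).re := by
    rw [w3, theta_eq, Complex.sub_re, hreal, Complex.re_mul_ofReal, Complex.ofReal_re,
      Complex.re_tsum (summable_windowPhase hx t)]
    ring
  rw [e, abs_mul, abs_two]
  have : 0 < peak x n t / t := by positivity
  linarith

end

/-! ### The limit formula -/

section

variable {x : ℝ} (hx : 1 < x) {r : ℕ → ℝ} (hr : ∀ᶠ n : ℕ in atTop, IsPosRoot (x ^ 2) n (r n))

include hx hr

lemma tendsto_root : Tendsto r atTop atTop := by
  refine tendsto_atTop_mono' atTop ?_ (tendsto_log_nat.atTop_div_const zero_lt_two)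
  filter_upwards [hr, eventually_root_bounds hx] with n h hb
  exact (hb _ h).1

lemma tendsto_root_sq_div : Tendsto (fun n : ℕ => r n ^ 2 / n) atTop (𝓝 0) := by
  refine tendsto_order.mpr ⟨fun a ha => ?_, fun a ha => ?_⟩
  · filter_upwards with n
    exact ha.trans_le (by positivity)
  · filter_upwards [hr, eventually_root_bounds hx, eventually_ge_atTop 1,
      eventually_log_pow_le_nat 2 (c := a / 8) (by positivity)] with n h hb hn hl
    have hn0 : (0 : ℝ) < n := by exact_mod_cast hn
    have h0 := h.1
    have h1 : r n ^ 2 ≤ (2 * Real.log n) ^ 2 := by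
      have := (hb _ h).2
      gcongr
    rw [div_lt_iff₀ hn0]
    nlinarith

lemma tendsto_root_div_scale : Tendsto (fun n : ℕ => r n / scale x n) atTop (𝓝 0) := by
  have hL0 := Real.log_pos hx
  have h := (tendsto_root_sq_div hx hr).div_const (2 * Real.log x)
  rw [zero_div] at h
  refine squeeze_zero' ?_ ?_ h
  · filter_upwards [hr, eventually_ge_atTop 1] with n h hn
    have := h.1
    have := scale_pos hx hn
    positivity
  · filter_upwards [(tendsto_root hx hr).eventually_ge_atTop 1, eventually_ge_atTop 1] with n h hn
    have hn0 : (0 : ℝ) < n := by exact_mod_cast hn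
    rw [div_div, scale, show (n : ℝ) * (2 * Real.log x) = 2 * n * Real.log x by ring]
    gcongr
    nlinarith

/-- The leading factor of the saddle `s_0` is asymptotic to the factor of the limit formula:
`(1 - t/M)^{-n}` is `e^{t/(2 log x)}` up to a factor `e^{O(t²/n)}`. -/
lemma tendsto_prefactor_div_gnFactor : Tendsto (fun n : ℕ =>
    peak x n (r n) / √(1 + r n * (1 - r n / scale x n)) / gnFactor (x ^ 2) (r n))
    atTop (𝓝 1) := by
  have hL0 := Real.log_pos hx
  have hq := tendsto_root_div_scale hx hr
  have hsq := tendsto_root_sq_div hx hr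
  have hinv : Tendsto (fun n : ℕ => (r n)⁻¹) atTop (𝓝 0) :=
    tendsto_inv_atTop_zero.comp (tendsto_root hx hr)
  have l1 : Tendsto (fun n : ℕ => √(1 / ((r n)⁻¹ + (1 - r n / scale x n)))) atTop (𝓝 1) := by
    have := ((tendsto_const_nhds (x := (1 : ℝ))).div (hinv.add (hq.const_sub 1))
      (by norm_num)).sqrt
    simpa using this
  have l2 : Tendsto (fun n : ℕ => (1 / (1 - r n / scale x n)) ^ n
      * Real.exp (-(r n / (2 * Real.log x)))) atTop (𝓝 1) := by
    have hup : Tendsto (fun n : ℕ => Real.exp (1 / (2 * Real.log x ^ 2) * (r n ^ 2 / n))) atTop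
        (𝓝 1) := by
      have := (Real.continuous_exp.tendsto _).comp
        (hsq.const_mul (1 / (2 * Real.log x ^ 2)))
      simpa [Function.comp_def] using this
    refine tendsto_of_tendsto_of_tendsto_of_le_of_le' tendsto_const_nhds hup ?_ ?_
    all_goals
      filter_upwards [hr, eventually_ge_atTop 2, hq.eventually_le_const
        (show (0 : ℝ) < 1 / 2 by norm_num)] with n h hn hq2
      have hM := scale_pos hx (n := n) (by omega)
      have hn0 : (0 : ℝ) < n := by exact_mod_cast (by omega : 0 < n)
      have h0 := h.1
      set q := r n / scale x n with hqd
      have hq0 : 0 < q := by positivity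
      have hnq : r n / (2 * Real.log x) = n * q := by
        rw [hqd, scale]; field_simp
      rw [hnq]
      have h1q : 0 < 1 - q := by linarith
      have e : Real.exp (n * q) * Real.exp (-(n * q)) = 1 := by rw [← Real.exp_add]; simp
    · have h1 : Real.exp (n * q) ≤ (1 / (1 - q)) ^ n := by
        rw [Real.exp_nat_mul]
        gcongr
        rw [le_div_iff₀ h1q]
        have h2 := Real.add_one_le_exp (-q)
        have h3 : Real.exp q * Real.exp (-q) = 1 := by rw [← Real.exp_add]; simp
        nlinarith [Real.exp_pos q]
      exact e.symm.le.trans (by gcongr)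
    · have h1 : (1 / (1 - q)) ^ n ≤ Real.exp (n * (q + 2 * q ^ 2)) := by
        rw [Real.exp_nat_mul]
        gcongr
        rw [div_le_iff₀ h1q]
        have h2 := Real.add_one_le_exp (q + 2 * q ^ 2)
        have h3 : 1 ≤ (q + 2 * q ^ 2 + 1) * (1 - q) := by nlinarith [mul_pos hq0 hq0]
        nlinarith
      calc _ ≤ Real.exp (n * (q + 2 * q ^ 2)) * Real.exp (-(n * q)) := by gcongr
        _ = Real.exp (1 / (2 * Real.log x ^ 2) * (r n ^ 2 / n)) := by
          rw [← Real.exp_add]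
          congr 1
          rw [hqd, scale]
          field_simp
          ring
  have l := l1.mul l2
  rw [mul_one] at l
  refine l.congr' ?_
  filter_upwards [hr, eventually_ge_atTop 2] with n h hn
  have hM := scale_pos hx (n := n) (by omega)
  have h0 := h.1
  have hlt := root_lt_scale hx h
  have hd : 0 < scale x n - r n := by linarith
  have h1q : 0 < 1 - r n / scale x n := by
    rw [sub_pos, div_lt_one hM]; exact hlt
  have e1 : √(1 / ((r n)⁻¹ + (1 - r n / scale x n)))
      = √(r n) / √(1 + r n * (1 - r n / scale x n)) := by
    rw [← Real.sqrt_div h0.le]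
    congr 1
    field_simp
  have e2 : 1 / (1 - r n / scale x n) = scale x n / (scale x n - r n) := by
    field_simp
  have e3 : Real.exp ((r n ^ 2 + 2 * r n) / (2 * Real.log (x ^ 2)))
      = Real.exp (r n ^ 2 / (4 * Real.log x)) * Real.exp (r n / (2 * Real.log x)) := by
    rw [← Real.exp_add, Real.log_pow]
    congr 1
    push_cast
    field_simp
    ring
  have h2 : 0 < √(r n) := Real.sqrt_pos.mpr h0
  have h3 : 0 < √(1 + r n * (1 - r n / scale x n)) := Real.sqrt_pos.mpr (by positivity)
  rw [e1, e2, gnFactor, e3, peak, one_add_lam_root hx h, Real.exp_neg]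
  field_simp

/-- The limit formula for the polynomial itself. -/
lemma tendsto_wp_div_gnFactor_sub_theta : Tendsto (fun n : ℕ =>
    wp n (x ^ (-2 : ℤ)) / gnFactor (x ^ 2) (r n) - theta (x ^ 2) (r n)) atTop (𝓝 0) := by
  have hL0 := Real.log_pos hx
  have hpi := Real.pi_pos
  set S : ℝ := √(4 * Real.pi * Real.log x) with hS
  have hS0 : 0 < S := Real.sqrt_pos.mpr (by positivity)
  obtain ⟨A, hA⟩ := exists_abs_theta_le hx
  obtain ⟨C, hC, hw⟩ := exists_abs_wp_sub_le hx
  obtain ⟨K, hK, hc⟩ := exists_norm_window_sub_contribution_le hx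
  have hR := tendsto_prefactor_div_gnFactor hx hr
  set R : ℕ → ℝ := fun n =>
    peak x n (r n) / √(1 + r n * (1 - r n / scale x n)) / gnFactor (x ^ 2) (r n) with hRd
  have hinv : Tendsto (fun n : ℕ => (Real.log n)⁻¹) atTop (𝓝 0) :=
    tendsto_inv_atTop_zero.comp tendsto_log_nat
  have hinv2 : Tendsto (fun n : ℕ => (√(r n))⁻¹) atTop (𝓝 0) :=
    tendsto_inv_atTop_zero.comp (Real.tendsto_sqrt_atTop.comp (tendsto_root hx hr))
  have hA0 : 0 ≤ A := (abs_nonneg _).trans (hA 0)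
  have hlim : Tendsto (fun n : ℕ => A * (|R n - 1| + 2 * K / S * R n * (Real.log n)⁻¹)
      + 2 * C / S * R n * (√(r n))⁻¹) atTop (𝓝 0) := by
    have h1 := ((hR.sub_const 1).abs.add
      ((hR.const_mul (2 * K / S)).mul hinv)).const_mul A
    have h2 := (hR.const_mul (2 * C / S)).mul hinv2
    have := h1.add h2
    simpa using this
  refine squeeze_zero_norm' ?_ hlim
  filter_upwards [hr, eventually_ge_atTop 2, hc, eventually_peak_le hx,
    (tendsto_root_div_scale hx hr).eventually_le_const (show (0 : ℝ) < 1 / 2 by norm_num),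
    (tendsto_root hx hr).eventually_ge_atTop 1, tendsto_log_nat.eventually_ge_atTop 1]
    with n ht hn hc hpk hq ht1 hl
  have hM := scale_pos hx (n := n) (by omega)
  have hp := peak_pos hx n (r n)
  set t := r n with htd
  have ht0 : 0 < t := ht.1
  set G := gnFactor (x ^ 2) t with hG
  have hG0 : 0 < G := by rw [hG, gnFactor]; have := Real.sqrt_pos.mpr ht0; positivity
  set Q := peak x n t / √(1 + t * (1 - t / scale x n)) with hQ
  have hRn : R n = Q / G := rfl
  have hq0 : 0 ≤ t / scale x n := by positivity
  have hd0 : 0 < 1 + t * (1 - t / scale x n) := by nlinarith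
  have hs0 : 0 < √(1 + t * (1 - t / scale x n)) := Real.sqrt_pos.mpr hd0
  have hQ0 : 0 < Q := by positivity
  -- the central window
  have c0 := hc 0 (Complex.I * t) t (isSaddleShift_zero hx hn ht) ht 0 (Nat.zero_le _)
  rw [contribution_zero_zero, prefactor_root hx hn ht, ← hS, ← hQ] at c0
  have c1 : |(window x n t 0).re - S * Q| ≤ 2 * K * Q * (Real.log n)⁻¹ := by
    have h1 := (Complex.abs_re_le_norm _).trans c0
    rw [← Complex.ofReal_mul, Complex.sub_re, Complex.ofReal_re, Nat.cast_zero] at h1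
    refine h1.trans ?_
    have h2 := hpk t ht
    have e : Real.exp (-(Real.pi ^ 2 * ((0 : ℕ) : ℝ) ^ 2 / (8 * Real.log x))) = 1 := by simp
    rw [e, zero_add, pow_one, mul_inv]
    calc K * 1 * peak x n t * ((Real.log n)⁻¹ * (√(Real.log n))⁻¹)
        = K * (peak x n t * (√(Real.log n))⁻¹) * (Real.log n)⁻¹ := by ring
      _ ≤ K * (2 * Q) * (Real.log n)⁻¹ := by gcongr
      _ = _ := by ring
  have c2 := hw n hn t ht hq
  have c3 : peak x n t / t ≤ 2 * Q * (√t)⁻¹ := by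
    have h1 : √(1 + t * (1 - t / scale x n)) ≤ 2 * √t := by
      rw [Real.sqrt_le_left (by positivity), mul_pow, Real.sq_sqrt ht0.le]
      nlinarith
    have h2 : peak x n t = Q * √(1 + t * (1 - t / scale x n)) := by
      rw [hQ, div_mul_cancel₀ _ hs0.ne']
    have h3 : 0 < √t := Real.sqrt_pos.mpr ht0
    have h4 : √t * √t = t := Real.mul_self_sqrt ht0.le
    rw [h2, div_le_iff₀ ht0]
    calc Q * √(1 + t * (1 - t / scale x n)) ≤ Q * (2 * √t) := by gcongr
      _ = 2 * Q * (√t)⁻¹ * (√t * √t) := by field_simp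
      _ = _ := by rw [h4]
  set W := (window x n t 0).re with hW
  set θ := theta (x ^ 2) t with hθ
  set p := wp n (x ^ (-2 : ℤ)) with hpd
  have e : p / G - θ = θ * ((Q / G - 1) + (W - S * Q) / (S * G)) + (S * p - W * θ) / (S * G) := by
    field_simp
    ring
  have hSG : 0 < S * G := by positivity
  rw [Real.norm_eq_abs, e]
  refine (abs_add_le _ _).trans (add_le_add ?_ ?_)
  · rw [abs_mul]
    refine mul_le_mul (hA t) ((abs_add_le _ _).trans (add_le_add le_rfl ?_)) (abs_nonneg _) hA0
    rw [abs_div, abs_of_pos hSG, div_le_iff₀ hSG, hRn]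
    refine c1.trans (le_of_eq ?_)
    field_simp
  · rw [abs_div, abs_of_pos hSG, div_le_iff₀ hSG, hRn]
    refine c2.trans ?_
    calc C * (peak x n t / t) ≤ C * (2 * Q * (√t)⁻¹) := by gcongr
      _ = _ := by field_simp

/-- The limit formula for the leading terms of the expansion. -/
lemma tendsto_expansion_div_gnFactor_sub_theta {σ : ℕ → ℕ → ℂ}
    (hσ : ∀ᶠ n : ℕ in atTop, ∀ k : ℕ, IsSaddleShift x n k (σ n k)) : Tendsto (fun n : ℕ =>
      expansion 0 x n (σ n) / (gnFactor (x ^ 2) (r n) : ℂ) - (theta (x ^ 2) (r n) : ℂ))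
      atTop (𝓝 0) := by
  obtain ⟨C, hC, hb⟩ := exists_norm_wp_sub_expansion_le_prefactor hx
  have hR := tendsto_prefactor_div_gnFactor hx hr
  have hinv : Tendsto (fun n : ℕ => (Real.log n)⁻¹) atTop (𝓝 0) :=
    tendsto_inv_atTop_zero.comp tendsto_log_nat
  have h1 : Tendsto (fun n : ℕ => (((wp n (x ^ (-2 : ℤ)) : ℝ) : ℂ) - expansion 0 x n (σ n))
      / (gnFactor (x ^ 2) (r n) : ℂ)) atTop (𝓝 0) := by
    have hlim := (hR.const_mul C).mul hinv
    rw [mul_zero] at hlim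
    refine squeeze_zero_norm' ?_ hlim
    filter_upwards [hσ, hr, hb, eventually_ge_atTop 2] with n h ht hb hn
    have hb := hb (σ n) h 0 (Nat.zero_le _)
    have ht0 := ht.1
    have hp := peak_pos hx n (r n)
    have hl : 0 ≤ Real.log n := Real.log_natCast_nonneg n
    have hG0 : 0 < gnFactor (x ^ 2) (r n) := by
      rw [gnFactor]; have := Real.sqrt_pos.mpr ht0; positivity
    rw [eq_root_of_zero hx hn (h 0) ht, prefactor_root hx hn ht, norm_div, zero_add, pow_one,
      Complex.norm_real, Complex.norm_real, Real.norm_of_nonneg hl,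
      Real.norm_of_nonneg (by positivity)] at hb
    rw [norm_div, Complex.norm_real, Real.norm_of_nonneg hG0.le, div_le_iff₀ hG0]
    refine hb.trans (le_of_eq ?_)
    field_simp
  have h2 := (Complex.continuous_ofReal.tendsto 0).comp (tendsto_wp_div_gnFactor_sub_theta hx hr)
  have h3 := h2.sub h1
  rw [Complex.ofReal_zero, sub_zero] at h3
  refine h3.congr fun n => ?_
  simp only [Function.comp]
  push_cast
  ring

end

end Lacunary

end

theorem theorem1 (x : ℝ) (hx : 1 < x) :
    -- for large `n`, every `σ_k` and the number `r(n)` exist and are unique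
    (∀ᶠ n : ℕ in atTop, ∀ k : ℕ, ∃! σ : ℂ, Lacunary.IsSaddleShift x n k σ) ∧
    (∀ᶠ n : ℕ in atTop, ∃! t : ℝ, Lacunary.IsPosRoot (x ^ 2) n t) ∧
    ∀ (σ : ℕ → ℕ → ℂ) (r : ℕ → ℝ),
      (∀ᶠ n : ℕ in atTop, ∀ k : ℕ, Lacunary.IsSaddleShift x n k (σ n k)) →
      (∀ᶠ n : ℕ in atTop, Lacunary.IsPosRoot (x ^ 2) n (r n)) →
      -- the saddle `s_0 = σ_0 = i r(n)` lies on the imaginary axis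
      (∀ᶠ n : ℕ in atTop, σ n 0 = Complex.I * (r n : ℂ)) ∧
      -- the coefficients stay bounded
      (∀ j ≤ 3, ∀ k : ℕ,
        (fun n : ℕ => Lacunary.coeff x n (Lacunary.shift k (σ n k)) j)
          =O[atTop] fun _ : ℕ => (1 : ℝ)) ∧
      -- the expansion, truncated after the term `j = N`
      (∀ N ≤ 3,
        (∀ᶠ n : ℕ in atTop,
          Summable fun k : ℕ => Lacunary.contribution N x n (k + 1) (σ n (k + 1))) ∧
        ((fun n : ℕ => ((Lacunary.wp n (x ^ (-2 : ℤ)) : ℝ) : ℂ)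
              - Lacunary.expansion N x n (σ n))
          =O[atTop] fun n : ℕ =>
            Lacunary.prefactor x n 0 (σ n 0) / (Real.log n : ℂ) ^ (N + 1)) ∧
        -- the contribution of `s_0` dominates that of each other saddle
        (∀ k : ℕ, 1 ≤ k → ∀ᶠ n : ℕ in atTop,
          ‖Lacunary.contribution N x n k (σ n k)‖ < ‖Lacunary.saddleSeries N x n 0 (σ n 0)‖)) ∧
      -- the leading terms reproduce the earlier asymptotic formula, with `y = x ^ 2`
      Tendsto (fun n : ℕ =>
          Lacunary.expansion 0 x n (σ n) / (Lacunary.gnFactor (x ^ 2) (r n) : ℂ)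
            - (Lacunary.theta (x ^ 2) (r n) : ℂ)) atTop (𝓝 0) ∧
      Tendsto (fun n : ℕ =>
          Lacunary.wp n (x ^ (-2 : ℤ)) / Lacunary.gnFactor (x ^ 2) (r n)
            - Lacunary.theta (x ^ 2) (r n)) atTop (𝓝 0) := by
  open Lacunary in
  refine ⟨eventually_existsUnique_isSaddleShift hx, ?_, fun σ r hσ hr => ⟨?_, ?_, ?_, ?_, ?_⟩⟩
  · filter_upwards [eventually_ge_atTop 1] with n hn
    exact existsUnique_isPosRoot hx hn
  · filter_upwards [hσ, hr, eventually_ge_atTop 2] with n h ht hn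
    exact eq_root_of_zero hx hn (h 0) ht
  · exact fun j _ k => coeff_isBigO hx hσ j k
  · refine fun N hN => ⟨?_, ?_, fun k hk => ?_⟩
    · filter_upwards [hσ, eventually_ge_atTop 2] with n h hn
      exact summable_contribution hx hn h hN
    · obtain ⟨C, -, hb⟩ := exists_norm_wp_sub_expansion_le_prefactor hx
      refine IsBigO.of_bound C ?_
      filter_upwards [hσ, hb] with n h hb
      exact hb (σ n) h N hN
    · filter_upwards [hσ, eventually_norm_contribution_lt hx hN hk] with n h hlt
      exact hlt _ _ (h k) (h 0)
  · exact tendsto_expansion_div_gnFactor_sub_theta hx hr hσ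
  · exact tendsto_wp_div_gnFactor_sub_theta hx hr
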